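/- Consider one-sided matching markets with a set $A$ of $n$ agents and a set $G$ of $n$ items (goods or chores), in which agent $i$ has rational utilities $(u_{ij})_{j\in G}$ of arbitrary sign. A fractional perfect matching is a matrix $x=(x_{ij})_{i\in A,\,j\in G}\ge 0$ with $\sum_{j} x_{ij}=1$ for all $i$ and $\sum_{i} x_{ij}=1$ for all $j$. Write $x_i=(x_{ij})_j$, and call $y\in\mathbb R^G_{\ge 0}$ with $\sum_j y_j=1$ a unit bundle. An HZ (Hylland–Zeckhauser) equilibrium is a pair $(x,p)$ of a fractional perfect matching $x$ and prices $p\in\mathbb R^G_{\ge0}$ such that $p\cdot x_i\le 1$ for every agent $i$ and, for every agent $i$ and every unit bundle $y$ with $p\cdot y\le 1$, we have $u_i\cdot y\le u_i\cdot x_i$, and $p\cdot y\ge p\cdot x_i$ whenever $u_i\cdot y=u_i\cdot x_i$. An HZ earnings equilibrium is a pair $(x,q)$ of a fractional perfect matching $x$ and payments $q\in\mathbb R^G_{\ge0}$ such that $q\cdot x_i\ge 1$ for every agent $i$ and, for every agent $i$ and every unit bundle $y$ with $q\cdot y\ge 1$, we have $u_i\cdot y\le u_i\cdot x_i$, and $q\cdot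 y\le q\cdot x_i$ whenever $u_i\cdot y=u_i\cdot x_i$. Call $u$ bivalued if there are rationals $(a_i)_{i\in A}$, $(b_i)_{i\in A}$ with $u_{ij}\in\{a_i,b_i\}$ for all $i,j$. **Theorem.** There are maps $u\mapsto x(u)$, $u\mapsto p(u)$ and $u\mapsto q(u)$ with rational values, defined for all $n$ and all rational $n\times n$ profiles $u$, such that: 1. for every bivalued $u$, $(x(u),p(u))$ is an HZ equilibrium, and on bivalued profiles $(x(u),p(u))$ is computable in time polynomial in the bit length of $u$; 2. for every bivalued $u$, $(x(u),q(u))$ is an HZ earnings equilibrium (with the same allocation), and on bivalued profiles $(x(u),q(u))$ is computable in time polynomial in the bit length of $u$; 3. the mechanism $u\mapsto x(u)$ is strategyproof on bivalued profiles: for every bivalued $u$, every agent $i$ and every misreport $v\in\mathbb Q^G$ such that the profile $(v,u_{-i})$, obtained from $u$ by replacing $u_i$ by $v$, is again bivalued, $u_i\cdot x_i(v,u_{-i})\le u_i\cdot x_i(u)$. Here polynomial time means that a single random access machine program with logarithmic (bit) cost receives $n$ and the numerators and denominators of the $u_{ij}$ and outputs numerators and nonzero denominators of the results, at a total cost bounded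 by a polynomial in the bit length of the input. -/

import Mathlib

/-! ### Equilibria in one-sided matching markets

`A` is the set of agents, `G` the set of items, `u i j` the utility of agent `i` for item `j`
(of arbitrary sign), and `x i j` the amount of item `j` allocated to agent `i`. -/

section Market

variable {A G : Type*} [Fintype A] [Fintype G]

/-- A fractional perfect matching between agents and items. -/
structure IsFractionalPerfectMatching (x : A → G → ℝ) : Prop where
  nonneg : ∀ i j, 0 ≤ x i j
  agent_matched : ∀ i, ∑ j, x i j = 1
  item_matched : ∀ j, ∑ i, x i j = 1

/-- `(x, p)` is a Hylland-Zeckhauser (HZ) equilibrium: every agent has one unit of money and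
receives a cheapest optimal bundle among the unit bundles that it can afford. -/
structure IsHZEquilibrium (u : A → G → ℝ) (x : A → G → ℝ) (p : G → ℝ) : Prop where
  matching : IsFractionalPerfectMatching x
  price_nonneg : ∀ j, 0 ≤ p j
  budget : ∀ i, p ⬝ᵥ x i ≤ 1
  optimal : ∀ i (y : G → ℝ), (∀ j, 0 ≤ y j) → ∑ j, y j = 1 → p ⬝ᵥ y ≤ 1 →
    u i ⬝ᵥ y ≤ u i ⬝ᵥ x i ∧ (u i ⬝ᵥ y = u i ⬝ᵥ x i → p ⬝ᵥ x i ≤ p ⬝ᵥ y)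

/-- `(x, q)` is an HZ earnings equilibrium: every agent has to earn at least one unit of money
and receives a highest-earning optimal bundle among the unit bundles that earn enough. -/
structure IsHZEarningsEquilibrium (u : A → G → ℝ) (x : A → G → ℝ) (q : G → ℝ) : Prop where
  matching : IsFractionalPerfectMatching x
  payment_nonneg : ∀ j, 0 ≤ q j
  earning : ∀ i, 1 ≤ q ⬝ᵥ x i
  optimal : ∀ i (y : G → ℝ), (∀ j, 0 ≤ y j) → ∑ j, y j = 1 → 1 ≤ q ⬝ᵥ y →
    u i ⬝ᵥ y ≤ u i ⬝ᵥ x i ∧ (u i ⬝ᵥ y = u i ⬝ᵥ x i → q ⬝ᵥ y ≤ q ⬝ᵥ x i)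

end Market

/-- A rational utility profile of a market with `n` agents and `n` items. -/
abbrev Profile (n : ℕ) : Type := Fin n → Fin n → ℚ

/-- A (randomized) mechanism: to every reported profile it assigns an allocation. -/
abbrev Mechanism : Type := ∀ n : ℕ, Profile n → Fin n → Fin n → ℚ

/-- A pricing rule: to every reported profile it assigns prices (or payments) of the items. -/
abbrev PricingRule : Type := ∀ n : ℕ, Profile n → Fin n → ℚ

/-- The utilities are bivalued: those of agent `i` take only two values `a i` and `b i`. -/
def Bivalued {n : ℕ} (u : Profile n) : Prop :=
  ∃ a b : Fin n → ℚ, ∀ i j, u i j = a i ∨ u i j = b i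

/-- On bivalued profiles, no agent can raise its true (expected) utility by reporting, instead
of its true utilities `u i`, any other utilities `v` that keep the profile bivalued. -/
def IsStrategyproofOnBivalued (x : Mechanism) : Prop :=
  ∀ (n : ℕ) (u : Profile n), Bivalued u →
    ∀ (i : Fin n) (v : Fin n → ℚ), Bivalued (Function.update u i v) →
      u i ⬝ᵥ x n (Function.update u i v) i ≤ u i ⬝ᵥ x n u i

/-! ### Polynomial time

The machine model is a random access machine with logarithmic (bit) cost, programmed in a
structured language: finitely many integer variables and integer arrays, the arithmetic
operations `+`, `-`, `*`, `/`, indirect addressing, and while loops.  Every operation is charged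
at least the bit lengths of all numbers that it touches (addresses included), and a
multiplication or division is charged the product of the bit lengths of its operands. -/

namespace RAM

/-- The number of bits of an integer, its sign included. -/
def bitLength (z : ℤ) : ℕ := z.natAbs.size + 1

/-- The memory: integer variables and integer arrays, both named by natural numbers. -/
@[ext]
structure State where
  var : ℕ → ℤ
  arr : ℕ → ℤ → ℤ

/-- Assign the value `v` to the variable `k`. -/
def State.setVar (s : State) (k : ℕ) (v : ℤ) : State :=
  { s with var := Function.update s.var k v }

/-- Assign the value `v` to the cell of index `m` of the array `k`. -/
def State.setArr (s : State) (k : ℕ) (m v : ℤ) : State :=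
  { s with arr := Function.update s.arr k (Function.update (s.arr k) m v) }

/-- Arithmetic expressions; `read k e` is the content of the cell of index `e` of array `k`. -/
inductive Expr : Type
  | const (z : ℤ)
  | var (k : ℕ)
  | read (k : ℕ) (e : Expr)
  | add (e₁ e₂ : Expr)
  | sub (e₁ e₂ : Expr)
  | mul (e₁ e₂ : Expr)
  | div (e₁ e₂ : Expr)

/-- The value of an expression (integer division, with `z / 0 = 0`). -/
def Expr.eval (s : State) : Expr → ℤ
  | .const z => z
  | .var k => s.var k
  | .read k e => s.arr k (e.eval s)
  | .add e₁ e₂ => e₁.eval s + e₂.eval s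
  | .sub e₁ e₂ => e₁.eval s - e₂.eval s
  | .mul e₁ e₂ => e₁.eval s * e₂.eval s
  | .div e₁ e₂ => e₁.eval s / e₂.eval s

/-- The cost of evaluating an expression. -/
def Expr.cost (s : State) : Expr → ℕ
  | .const z => bitLength z
  | .var k => bitLength (s.var k)
  | .read k e => e.cost s + bitLength (e.eval s) + bitLength (s.arr k (e.eval s))
  | .add e₁ e₂ => e₁.cost s + e₂.cost s + bitLength (e₁.eval s) + bitLength (e₂.eval s)
  | .sub e₁ e₂ => e₁.cost s + e₂.cost s + bitLength (e₁.eval s) + bitLength (e₂.eval s)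
  | .mul e₁ e₂ => e₁.cost s + e₂.cost s + bitLength (e₁.eval s) * bitLength (e₂.eval s)
  | .div e₁ e₂ => e₁.cost s + e₂.cost s + bitLength (e₁.eval s) * bitLength (e₂.eval s)

/-- Programs.  A test `e` succeeds if the value of `e` is positive. -/
inductive Program : Type
  | skip
  | assign (k : ℕ) (e : Expr)
  | store (k : ℕ) (index e : Expr)
  | seq (c₁ c₂ : Program)
  | ite (e : Expr) (c₁ c₂ : Program)
  | while (e : Expr) (c : Program)

/-- `Exec c s s' t`: the (deterministic) run of the program `c` from the state `s` halts in the
state `s'`, at total cost `t`. -/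
inductive Exec : Program → State → State → ℕ → Prop
  | skip (s : State) : Exec .skip s s 1
  | assign (s : State) (k : ℕ) (e : Expr) :
      Exec (.assign k e) s (s.setVar k (e.eval s)) (e.cost s + bitLength (e.eval s) + 1)
  | store (s : State) (k : ℕ) (m e : Expr) :
      Exec (.store k m e) s (s.setArr k (m.eval s) (e.eval s))
        (m.cost s + e.cost s + bitLength (m.eval s) + bitLength (e.eval s) + 1)
  | seq {c₁ c₂ : Program} {s s₁ s₂ : State} {t₁ t₂ : ℕ} :
      Exec c₁ s s₁ t₁ → Exec c₂ s₁ s₂ t₂ → Exec (.seq c₁ c₂) s s₂ (t₁ + t₂)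
  | ite_true {e : Expr} {c₁ c₂ : Program} {s s' : State} {t : ℕ} :
      0 < e.eval s → Exec c₁ s s' t → Exec (.ite e c₁ c₂) s s' (e.cost s + 1 + t)
  | ite_false {e : Expr} {c₁ c₂ : Program} {s s' : State} {t : ℕ} :
      e.eval s ≤ 0 → Exec c₂ s s' t → Exec (.ite e c₁ c₂) s s' (e.cost s + 1 + t)
  | while_true {e : Expr} {c : Program} {s s₁ s₂ : State} {t₁ t₂ : ℕ} :
      0 < e.eval s → Exec c s s₁ t₁ → Exec (.while e c) s₁ s₂ t₂ →
        Exec (.while e c) s s₂ (e.cost s + 1 + t₁ + t₂)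
  | while_false {e : Expr} {c : Program} {s : State} :
      e.eval s ≤ 0 → Exec (.while e c) s s (e.cost s + 1)

/-- The initial memory for the profile `u`: variable `0` holds `n`, arrays `0` and `1` hold the
numerators and denominators of the utilities in row-major order (that of `u i j` at index
`i * n + j`), and everything else is `0`. -/
def initialState {n : ℕ} (u : Profile n) : State where
  var := fun k => if k = 0 then (n : ℤ) else 0
  arr := fun k m =>
    if k = 0 then ∑ i : Fin n, ∑ j : Fin n, if m = (i : ℤ) * n + j then (u i j).num else 0
    else if k = 1 then
      ∑ i : Fin n, ∑ j : Fin n, if m = (i : ℤ) * n + j then ((u i j).den : ℤ) else 0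
    else 0

/-- The bit length of the input. -/
def inputSize {n : ℕ} (u : Profile n) : ℕ :=
  bitLength n + ∑ i : Fin n, ∑ j : Fin n, (bitLength (u i j).num + bitLength ((u i j).den : ℤ))

/-- In the memory `s`, arrays `2` and `3` hold numerators and (nonzero) denominators of fractions
for the allocation `x`, in row-major order, and arrays `4` and `5` those for the prices `p`. -/
def HoldsOutput {n : ℕ} (s : State) (x : Fin n → Fin n → ℚ) (p : Fin n → ℚ) : Prop :=
  (∀ i j : Fin n, s.arr 3 ((i : ℤ) * n + j) ≠ 0 ∧
    x i j = (s.arr 2 ((i : ℤ) * n + j) : ℚ) / (s.arr 3 ((i : ℤ) * n + j) : ℚ)) ∧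
  (∀ j : Fin n, s.arr 5 (j : ℤ) ≠ 0 ∧ p j = (s.arr 4 (j : ℤ) : ℚ) / (s.arr 5 (j : ℤ) : ℚ))

/-- One program computes, from every bivalued profile, the allocation `x` together with the prices
`p`, at a cost that is polynomial in the bit length of the profile. -/
def PolyTimeComputableOnBivalued (x : Mechanism) (p : PricingRule) : Prop :=
  ∃ (c : Program) (P : Polynomial ℕ), ∀ (n : ℕ) (u : Profile n), Bivalued u →
    ∃ (s : State) (t : ℕ), Exec c (initialState u) s t ∧ t ≤ P.eval (inputSize u) ∧
      HoldsOutput s (x n u) (p n u)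

end RAM

/-!
The allocation is the egalitarian one for the dichotomous preferences "`i` likes `j` if `u i j` is
maximal in row `i`". Among the agents that remain, a set `S` with the smallest ratio
`|N(S)| / |S| = a / b` is served, where `N(S)` are the unsold items that agents in `S` like: each
agent in `S` gets the total amount `a / b` of these items, and their price is `b / a`. When all
ratios are at least `1`, the remaining agents get one whole liked item each, for free. Finally the
unsold items, which are free, are divided among all agents in proportion to what these
lack. The successive ratios increase, by Hall's condition for the agents that remain
(`PartialOutcome.serve`), so that an agent with a share `r < 1` likes no item of price below
`1 / r`; it spends its unit of money on a liked amount `r`, and it cannot afford more.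
`IsEgalitarian` records these properties, which already imply the rest:

* `IsEgalitarian.isHZEquilibrium`: the utility of a unit bundle is determined by its liked
  amount;
* `IsHZEquilibrium.isHZEarningsEquilibrium`: the payments `(n + 1 - p) / n` are nonnegative, since
  prices are at most `n`, and they define the same budget sets as the prices `p`;
* `IsEgalitarian.dotProduct_le`: a misreport of agent `i` does not increase the amount that `i`
  gets of the items it likes. Look at the items of price at least `1 / r i` whose price drops below
  `1 / r i`. Their buyers other than `i` had a share of at most `r i` and have at least `r i` now,
  all of it among these items; so there is not more left for `i` than before. The items whose
  price drops to `0` need an extra argument, as `i` may get them without reporting to like them: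
  their buyers outnumber them and now take whole items, so, the numbers being integers, nothing at
  all is left for `i`.

For the computation, every agent is split into `a` copies and every item into `b` copies, and the
copies are matched by an auction in unit increments (`IsPriceMatching`). If an agent copy finds no
item copy of price below `n * b`, then some level `t ≤ n * b` is not a price; the agents all of
whose links lead to prices above `t` violate Hall's condition (`IsPriceMatching.violator`), and
their ratio replaces `a / b`. Otherwise the matching tells how to serve `S`. Every round either
serves an agent or decreases the fraction `a / b`, which has numerator and denominator at most
`n`, so the number of steps is polynomial in `n` (`Invariant.mainStep_spec`). The program stores
products only in its output arrays, which it never reads, so that each step lengthens the stored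
numbers by a constant number of bits; hence the bit cost is polynomial as well
(`exists_poly_cost`).
-/

namespace RAM

/-! ### Step counts, total correctness and frames -/

/-- `Run c s s' N`: the run of `c` from `s` halts in `s'` after `N` elementary steps. This is
`Exec` with unit cost for every instruction and every test. -/
inductive Run : Program → State → State → ℕ → Prop
  | skip (s : State) : Run .skip s s 1
  | assign (s : State) (k : ℕ) (e : Expr) : Run (.assign k e) s (s.setVar k (e.eval s)) 1
  | store (s : State) (k : ℕ) (m e : Expr) :
      Run (.store k m e) s (s.setArr k (m.eval s) (e.eval s)) 1
  | seq {c₁ c₂ : Program} {s s₁ s₂ : State} {t₁ t₂ : ℕ} :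
      Run c₁ s s₁ t₁ → Run c₂ s₁ s₂ t₂ → Run (.seq c₁ c₂) s s₂ (t₁ + t₂)
  | ite_true {e : Expr} {c₁ c₂ : Program} {s s' : State} {t : ℕ} :
      0 < e.eval s → Run c₁ s s' t → Run (.ite e c₁ c₂) s s' (1 + t)
  | ite_false {e : Expr} {c₁ c₂ : Program} {s s' : State} {t : ℕ} :
      e.eval s ≤ 0 → Run c₂ s s' t → Run (.ite e c₁ c₂) s s' (1 + t)
  | while_true {e : Expr} {c : Program} {s s₁ s₂ : State} {t₁ t₂ : ℕ} :
      0 < e.eval s → Run c s s₁ t₁ → Run (.while e c) s₁ s₂ t₂ →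
        Run (.while e c) s s₂ (1 + t₁ + t₂)
  | while_false {e : Expr} {c : Program} {s : State} :
      e.eval s ≤ 0 → Run (.while e c) s s 1

/-- Total correctness: from `s`, the program `c` halts within `N` steps in a state satisfying
`Q`. -/
def Reach (c : Program) (s : State) (N : ℕ) (Q : State → Prop) : Prop :=
  ∃ s' k, k ≤ N ∧ Run c s s' k ∧ Q s'

/-- Whether `c` contains an assignment to the variable `k`. -/
def Program.writesVar : Program → ℕ → Bool
  | .skip, _ => false
  | .assign j _, k => j == k
  | .store _ _ _, _ => false
  | .seq c₁ c₂, k => c₁.writesVar k || c₂.writesVar k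
  | .ite _ c₁ c₂, k => c₁.writesVar k || c₂.writesVar k
  | .while _ c, k => c.writesVar k

/-- Whether `c` contains an assignment to a cell of the array `k`. -/
def Program.writesArr : Program → ℕ → Bool
  | .skip, _ => false
  | .assign _ _, _ => false
  | .store j _ _, k => j == k
  | .seq c₁ c₂, k => c₁.writesArr k || c₂.writesArr k
  | .ite _ c₁ c₂, k => c₁.writesArr k || c₂.writesArr k
  | .while _ c, k => c.writesArr k

/-- The states `s` and `s'` agree on the variables and arrays that `c` never writes. -/
structure Same (c : Program) (s s' : State) : Prop where
  var : ∀ k, c.writesVar k = false → s'.var k = s.var k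
  arr : ∀ k, c.writesArr k = false → s'.arr k = s.arr k

theorem Same.refl (c : Program) (s : State) : Same c s s := ⟨fun _ _ => rfl, fun _ _ => rfl⟩

theorem Same.trans {c : Program} {s₁ s₂ s₃ : State} (h : Same c s₁ s₂) (h' : Same c s₂ s₃) :
    Same c s₁ s₃ :=
  ⟨fun k hk => (h'.var k hk).trans (h.var k hk), fun k hk => (h'.arr k hk).trans (h.arr k hk)⟩

theorem Same.weaken {c c' : Program} {s s' : State} (h : Same c s s')
    (hv : ∀ k, c'.writesVar k = false → c.writesVar k = false)
    (ha : ∀ k, c'.writesArr k = false → c.writesArr k = false) : Same c' s s' :=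
  ⟨fun k hk => h.var k (hv k hk), fun k hk => h.arr k (ha k hk)⟩

@[simp] theorem State.var_setVar (s : State) (k j : ℕ) (v : ℤ) :
    (s.setVar k v).var j = if j = k then v else s.var j := by
  simp [State.setVar, Function.update_apply]

@[simp] theorem State.arr_setVar (s : State) (k : ℕ) (v : ℤ) : (s.setVar k v).arr = s.arr := rfl

@[simp] theorem State.var_setArr (s : State) (k : ℕ) (m v : ℤ) :
    (s.setArr k m v).var = s.var := rfl

@[simp] theorem State.arr_setArr (s : State) (k j : ℕ) (m v : ℤ) :
    (s.setArr k m v).arr j = if j = k then Function.update (s.arr k) m v else s.arr j := by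
  simp [State.setArr, Function.update_apply]

theorem Run.same {c : Program} {s s' : State} {t : ℕ} (h : Run c s s' t) : Same c s s' := by
  induction h with
  | skip s => exact .refl _ _
  | assign s k e =>
    refine ⟨fun j hj => ?_, fun _ _ => rfl⟩
    have : j ≠ k := fun h => by simp [Program.writesVar, h] at hj
    simp [this]
  | store s k m e =>
    refine ⟨fun _ _ => rfl, fun j hj => ?_⟩
    have : j ≠ k := fun h => by simp [Program.writesArr, h] at hj
    simp [this]
  | seq _ _ ih₁ ih₂ =>
    exact Same.trans
      (ih₁.weaken (fun _ h => (Bool.or_eq_false_iff.1 h).1)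
        (fun _ h => (Bool.or_eq_false_iff.1 h).1))
      (ih₂.weaken (fun _ h => (Bool.or_eq_false_iff.1 h).2)
        (fun _ h => (Bool.or_eq_false_iff.1 h).2))
  | ite_true _ _ ih =>
    exact ih.weaken (fun _ h => (Bool.or_eq_false_iff.1 h).1)
      (fun _ h => (Bool.or_eq_false_iff.1 h).1)
  | ite_false _ _ ih =>
    exact ih.weaken (fun _ h => (Bool.or_eq_false_iff.1 h).2)
      (fun _ h => (Bool.or_eq_false_iff.1 h).2)
  | while_true _ _ _ ih₁ ih₂ =>
    exact Same.trans (ih₁.weaken (fun _ h => h) (fun _ h => h)) ih₂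
  | while_false _ => exact .refl _ _

namespace Reach

variable {c c₁ c₂ body : Program} {s : State} {N N₁ N₂ : ℕ} {P Q : State → Prop}

theorem mono (h : Reach c s N₁ P) (hN : N₁ ≤ N₂) (hPQ : ∀ s', Same c s s' → P s' → Q s') :
    Reach c s N₂ Q := by
  obtain ⟨s', k, hk, hr, hp⟩ := h
  exact ⟨s', k, hk.trans hN, hr, hPQ s' hr.same hp⟩

theorem imp (h : Reach c s N P) (hPQ : ∀ s', Same c s s' → P s' → Q s') : Reach c s N Q :=
  h.mono le_rfl hPQ

theorem seq (h₁ : Reach c₁ s N₁ P)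
    (h₂ : ∀ s', Same c₁ s s' → P s' → Reach c₂ s' N₂ Q) :
    Reach (.seq c₁ c₂) s (N₁ + N₂) Q := by
  obtain ⟨s', k, hk, hr, hp⟩ := h₁
  obtain ⟨s'', k', hk', hr', hq⟩ := h₂ s' hr.same hp
  exact ⟨s'', k + k', by omega, .seq hr hr', hq⟩

theorem assign {k : ℕ} {e : Expr} (h : Q (s.setVar k (e.eval s))) :
    Reach (.assign k e) s 1 Q := ⟨_, _, le_rfl, .assign s k e, h⟩

theorem ite {e : Expr} (h₁ : 0 < e.eval s → Reach c₁ s N Q)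
    (h₂ : e.eval s ≤ 0 → Reach c₂ s N Q) : Reach (.ite e c₁ c₂) s (N + 1) Q := by
  rcases lt_or_ge 0 (e.eval s) with h | h
  · obtain ⟨s', k, hk, hr, hq⟩ := h₁ h
    exact ⟨s', _, by omega, .ite_true h hr, hq⟩
  · obtain ⟨s', k, hk, hr, hq⟩ := h₂ h
    exact ⟨s', _, by omega, .ite_false h hr, hq⟩

/-- A loop whose body preserves the invariant `I` and decreases the measure `μ` halts after at
most `μ s` iterations. -/
theorem while_ {e : Expr} (I : State → Prop) (μ : State → ℕ) (B : ℕ)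
    (hstep : ∀ s', Same body s s' → I s' → 0 < e.eval s' →
      Reach body s' B (fun s'' => I s'' ∧ μ s'' < μ s')) (h0 : I s) :
    Reach (.while e body) s (μ s * (B + 1) + 1) (fun s' => I s' ∧ e.eval s' ≤ 0) := by
  suffices H : ∀ m s', μ s' ≤ m → Same body s s' → I s' →
      Reach (.while e body) s' (m * (B + 1) + 1) (fun s' => I s' ∧ e.eval s' ≤ 0) from
    H _ s le_rfl (.refl _ _) h0
  intro m
  induction m with
  | zero =>
    intro s' hm hs hI
    rcases lt_or_ge 0 (e.eval s') with h | h
    · obtain ⟨s'', k, _, _, _, hlt⟩ := hstep s' hs hI h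
      omega
    · exact ⟨s', 1, by omega, .while_false h, hI, h⟩
  | succ m ih =>
    intro s' hm hs hI
    rcases lt_or_ge 0 (e.eval s') with h | h
    · obtain ⟨s'', k, hk, hr, hI'', hlt⟩ := hstep s' hs hI h
      obtain ⟨s₃, k', hk', hr', hq⟩ := ih s'' (by omega) (hs.trans hr.same) hI''
      refine ⟨s₃, _, ?_, .while_true h hr hr', hq⟩
      rw [Nat.succ_mul]
      omega
    · exact ⟨s', 1, by omega, .while_false h, hI, h⟩

end Reach

/-- The loop in which the variable `v` runs through `0, …, w - 1`, `w` being a variable. -/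
def forLoop (v w : ℕ) (body : Program) : Program :=
  .seq (.assign v (.const 0)) (.while (.sub (.var w) (.var v))
    (.seq body (.assign v (.add (.var v) (.const 1)))))

/-- The rule for counting loops. The body must not assign to `v` or `w`, and the invariant `I m`,
which holds when `v` has the value `m`, must not depend on the variable `v` itself. -/
theorem Reach.for_ {s : State} {v w : ℕ} {body : Program} (N B : ℕ) (I : ℕ → State → Prop)
    (hvw : w ≠ v) (hv : body.writesVar v = false) (hw : body.writesVar w = false)
    (hN : s.var w = N) (hI : ∀ m s z, I m s → I m (s.setVar v z)) (h0 : I 0 s)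
    (hstep : ∀ m < N, ∀ s', Same (forLoop v w body) s s' → s'.var v = m → I m s' →
      Reach body s' B (I (m + 1))) :
    Reach (forLoop v w body) s (N * (B + 2) + 2) (I N) := by
  have hsame : ∀ s', Same (.seq body (.assign v (.add (.var v) (.const 1)))) (s.setVar v 0) s' →
      Same (forLoop v w body) s s' := by
    intro s' h
    refine Same.trans (s₂ := s.setVar v 0)
      (Run.same (Run.assign s v (.const 0)) |>.weaken ?_ ?_) (h.weaken ?_ ?_) <;>
    · intro k hk
      simp_all [forLoop, Program.writesVar, Program.writesArr]
  have key := Reach.while_ (body := .seq body (.assign v (.add (.var v) (.const 1))))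
    (s := s.setVar v 0) (e := .sub (.var w) (.var v))
    (fun s' => ∃ m : ℕ, m ≤ N ∧ s'.var v = m ∧ I m s' ∧ s'.var w = N)
    (fun s' => N - (s'.var v).toNat) (B + 1)
    (by
      rintro s' hs ⟨m, hm, hvm, hIm, hwN⟩ hpos
      have hlt : m < N := by simp [Expr.eval, hvm, hwN] at hpos; omega
      refine Reach.seq (hstep m hlt s' (hsame s' hs) hvm hIm) fun s₁ hs₁ hI₁ => Reach.assign ?_
      have h1 := hs₁.var v hv
      have h2 := hs₁.var w hw
      refine ⟨⟨m + 1, hlt, ?_, hI _ _ _ hI₁, ?_⟩, ?_⟩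
      · simp [Expr.eval, h1, hvm]
      · simp [hvw, h2, hwN]
      · simp [Expr.eval, h1, hvm]; omega)
    ⟨0, Nat.zero_le _, by simp, hI _ _ _ h0, by simp [hvw, hN]⟩
  have hfor := Reach.seq (c₁ := .assign v (.const 0)) (c₂ := .while (.sub (.var w) (.var v))
    (.seq body (.assign v (.add (.var v) (.const 1))))) (s := s)
    (P := fun s' => s' = s.setVar v 0) (N₁ := 1) (Reach.assign rfl)
    (fun s' _ hs' => by rw [hs']; exact key)
  refine hfor.mono (by simp; ring_nf; omega) ?_
  rintro s' - ⟨⟨m, hm, hvm, hIm, hwN⟩, hle⟩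
  have : m = N := by simp [Expr.eval, hvm, hwN] at hle; omega
  exact this ▸ hIm

/-- The program contains no loop. -/
def Program.loopFree : Program → Bool
  | .skip => true
  | .assign _ _ => true
  | .store _ _ _ => true
  | .seq c₁ c₂ => c₁.loopFree && c₂.loopFree
  | .ite _ c₁ c₂ => c₁.loopFree && c₂.loopFree
  | .while _ _ => false

/-- The final state of a program without loops; the value on loops is immaterial. -/
def Program.out : Program → State → State
  | .skip, s => s
  | .assign k e, s => s.setVar k (e.eval s)
  | .store k m e, s => s.setArr k (m.eval s) (e.eval s)
  | .seq c₁ c₂, s => c₂.out (c₁.out s)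
  | .ite e c₁ c₂, s => if 0 < e.eval s then c₁.out s else c₂.out s
  | .while _ _, s => s

/-- The number of instructions and tests of a program. -/
def Program.size : Program → ℕ
  | .skip => 1
  | .assign _ _ => 1
  | .store _ _ _ => 1
  | .seq c₁ c₂ => c₁.size + c₂.size
  | .ite _ c₁ c₂ => 1 + c₁.size + c₂.size
  | .while _ c => c.size

theorem Reach.out {c : Program} {s : State} {Q : State → Prop} {N : ℕ} (hc : c.loopFree = true)
    (hN : c.size ≤ N) (h : Q (c.out s)) : Reach c s N Q := by
  suffices H : ∃ k ≤ c.size, Run c s (c.out s) k by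
    obtain ⟨k, hk, hr⟩ := H
    exact ⟨_, k, hk.trans hN, hr, h⟩
  clear h hN Q N
  induction c generalizing s with
  | skip => exact ⟨1, le_rfl, .skip s⟩
  | assign k e => exact ⟨1, le_rfl, .assign s k e⟩
  | store k m e => exact ⟨1, le_rfl, .store s k m e⟩
  | seq c₁ c₂ ih₁ ih₂ =>
    simp only [Program.loopFree, Bool.and_eq_true] at hc
    obtain ⟨k₁, h₁, r₁⟩ := ih₁ hc.1 (s := s)
    obtain ⟨k₂, h₂, r₂⟩ := ih₂ hc.2 (s := c₁.out s)
    exact ⟨k₁ + k₂, by simp only [Program.size]; omega, .seq r₁ r₂⟩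
  | ite e c₁ c₂ ih₁ ih₂ =>
    simp only [Program.loopFree, Bool.and_eq_true] at hc
    obtain ⟨k₁, h₁, r₁⟩ := ih₁ hc.1 (s := s)
    obtain ⟨k₂, h₂, r₂⟩ := ih₂ hc.2 (s := s)
    by_cases he : 0 < e.eval s
    · exact ⟨1 + k₁, by simp only [Program.size]; omega, by
        simpa [Program.out, he] using Run.ite_true (c₂ := c₂) he r₁⟩
    · exact ⟨1 + k₂, by simp only [Program.size]; omega, by
        simpa [Program.out, he] using Run.ite_false (c₁ := c₁) (not_lt.1 he) r₂⟩
  | _ => simp [Program.loopFree] at hc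

end RAM

namespace RAM

/-! ### From step counts to bit costs -/

/-- All variables and all arrays except the output arrays `2, …, 5` hold numbers of at most `M`
bits. -/
def Bounded (M : ℕ) (s : State) : Prop :=
  (∀ k, (s.var k).natAbs < 2 ^ M) ∧
    ∀ k m, (k < 2 ∨ 5 < k) → (s.arr k m).natAbs < 2 ^ M

theorem Bounded.mono {M M' : ℕ} {s : State} (h : Bounded M s) (hM : M ≤ M') : Bounded M' s :=
  ⟨fun k => (h.1 k).trans_le (Nat.pow_le_pow_right two_pos hM),
    fun k m hk => (h.2 k m hk).trans_le (Nat.pow_le_pow_right two_pos hM)⟩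

/-- The expression does not read the output arrays. -/
def Expr.clean : Expr → Bool
  | .const _ => true
  | .var _ => true
  | .read k e => (decide (k < 2 ∨ 5 < k)) && e.clean
  | .add e₁ e₂ => e₁.clean && e₂.clean
  | .sub e₁ e₂ => e₁.clean && e₂.clean
  | .mul e₁ e₂ => e₁.clean && e₂.clean
  | .div e₁ e₂ => e₁.clean && e₂.clean

/-- Outside of addresses and divisors, the expression does not multiply. -/
def Expr.additive : Expr → Bool
  | .const _ => true
  | .var _ => true
  | .read _ _ => true
  | .add e₁ e₂ => e₁.additive && e₂.additive
  | .sub e₁ e₂ => e₁.additive && e₂.additive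
  | .mul _ _ => false
  | .div e₁ _ => e₁.additive

/-- The output arrays are never read, and products are stored only there. Hence every step
lengthens the stored numbers by at most a constant number of bits. -/
def Program.tame : Program → Bool
  | .skip => true
  | .assign _ e => e.clean && e.additive
  | .store k m e => m.clean && e.clean && (decide (2 ≤ k ∧ k ≤ 5) || e.additive)
  | .seq c₁ c₂ => c₁.tame && c₂.tame
  | .ite e c₁ c₂ => e.clean && c₁.tame && c₂.tame
  | .while e c => e.clean && c.tame

theorem bitLength_le {z : ℤ} {k : ℕ} (h : z.natAbs < 2 ^ k) : bitLength z ≤ k + 1 := by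
  unfold bitLength
  have := Nat.size_le.2 h
  omega

theorem natAbs_lt_two_pow_bitLength (z : ℤ) : z.natAbs < 2 ^ bitLength z :=
  (Nat.lt_size_self _).trans_le (Nat.pow_le_pow_right two_pos (Nat.le_succ _))

theorem add_lt_two_pow {x y A B : ℕ} (hx : x < 2 ^ A) (hy : y < 2 ^ B) : x + y < 2 ^ (A + B) := by
  rw [pow_add]
  obtain ⟨p, hp⟩ := Nat.exists_eq_add_of_lt hx
  obtain ⟨q, hq⟩ := Nat.exists_eq_add_of_lt hy
  rw [hp, hq]
  nlinarith [Nat.zero_le (x * y), Nat.zero_le (x * q), Nat.zero_le (y * p), Nat.zero_le (p * q)]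

/-- An expression multiplies the bit length of the memory by at most a constant, and its cost is
at most quadratic. -/
theorem Expr.exists_bound (e : Expr) (he : e.clean = true) :
    ∃ C : ℕ, ∀ M s, Bounded M s →
      (e.eval s).natAbs < 2 ^ (C * (M + 1)) ∧ e.cost s ≤ C * (M + 1) ^ 2 := by
  have hbin : ∀ (C₁ C₂ M c₁ c₂ : ℕ) (z₁ z₂ : ℤ), z₁.natAbs < 2 ^ (C₁ * (M + 1)) →
      z₂.natAbs < 2 ^ (C₂ * (M + 1)) → c₁ ≤ C₁ * (M + 1) ^ 2 → c₂ ≤ C₂ * (M + 1) ^ 2 →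
      c₁ + c₂ + bitLength z₁ + bitLength z₂ ≤
          (C₁ + C₂ + (C₁ + 1) * (C₂ + 1) + C₁ + C₂ + 2) * (M + 1) ^ 2 ∧
        c₁ + c₂ + bitLength z₁ * bitLength z₂ ≤
          (C₁ + C₂ + (C₁ + 1) * (C₂ + 1) + C₁ + C₂ + 2) * (M + 1) ^ 2 := by
    intro C₁ C₂ M c₁ c₂ z₁ z₂ h₁ h₂ h₃ h₄
    have e₁ : bitLength z₁ ≤ (C₁ + 1) * (M + 1) := by
      have := bitLength_le h₁
      linarith [Nat.zero_le M]
    have e₂ : bitLength z₂ ≤ (C₂ + 1) * (M + 1) := by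
      have := bitLength_le h₂
      linarith [Nat.zero_le M]
    have e₃ := Nat.mul_le_mul e₁ e₂
    have e₄ : (M + 1) ≤ (M + 1) ^ 2 := Nat.le_self_pow two_ne_zero _
    have e₅ := Nat.mul_le_mul_left (C₁ + 1) e₄
    have e₆ := Nat.mul_le_mul_left (C₂ + 1) e₄
    have e₇ : 0 ≤ (C₁ + 1) * (C₂ + 1) * (M + 1) ^ 2 := Nat.zero_le _
    have e₈ : 0 ≤ (C₁ + C₂ + 2) * (M + 1) ^ 2 := Nat.zero_le _
    constructor <;> nlinarith
  have hpow : ∀ {x C C' M : ℕ}, x < 2 ^ (C * (M + 1)) → C ≤ C' → x < 2 ^ (C' * (M + 1)) :=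
    fun h hC => h.trans_le (Nat.pow_le_pow_right two_pos (Nat.mul_le_mul_right _ hC))
  induction e with
  | const z =>
    refine ⟨bitLength z, fun M s _ => ⟨(natAbs_lt_two_pow_bitLength z).trans_le
      (Nat.pow_le_pow_right two_pos ?_), ?_⟩⟩
    · exact Nat.le_mul_of_pos_right _ (by omega)
    · exact Nat.le_mul_of_pos_right _ (by positivity)
  | var k =>
    refine ⟨1, fun M s h => ⟨(h.1 k).trans_le (Nat.pow_le_pow_right two_pos (by omega)), ?_⟩⟩
    have := bitLength_le (h.1 k)
    have h2 : (M + 1) ≤ (M + 1) ^ 2 := Nat.le_self_pow two_ne_zero _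
    simp only [Expr.cost]
    omega
  | read k e ih =>
    simp only [Expr.clean, Bool.and_eq_true, decide_eq_true_eq] at he
    obtain ⟨C, hC⟩ := ih he.2
    refine ⟨C + C + 2 , fun M s h => ?_⟩
    obtain ⟨h₁, h₂⟩ := hC M s h
    have h₃ := h.2 k (e.eval s) he.1
    refine ⟨h₃.trans_le (Nat.pow_le_pow_right two_pos (by nlinarith)), ?_⟩
    have e₁ := bitLength_le h₁
    have e₂ := bitLength_le h₃
    have e₄ : (M + 1) ≤ (M + 1) ^ 2 := Nat.le_self_pow two_ne_zero _
    have e₅ := Nat.mul_le_mul_left C e₄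
    have e₆ : 1 ≤ (M + 1) ^ 2 := Nat.one_le_pow _ _ (by omega)
    simp only [Expr.cost]
    nlinarith
  | add e₁ e₂ ih₁ ih₂ =>
    simp only [Expr.clean, Bool.and_eq_true] at he
    obtain ⟨C₁, h₁⟩ := ih₁ he.1
    obtain ⟨C₂, h₂⟩ := ih₂ he.2
    refine ⟨_, fun M s h => ⟨?_, (hbin C₁ C₂ M _ _ _ _ (h₁ M s h).1 (h₂ M s h).1 (h₁ M s h).2
      (h₂ M s h).2).1⟩⟩
    refine hpow (C := C₁ + C₂) ?_ (by nlinarith)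
    rw [add_mul]
    exact (Int.natAbs_add_le _ _).trans_lt (add_lt_two_pow (h₁ M s h).1 (h₂ M s h).1)
  | sub e₁ e₂ ih₁ ih₂ =>
    simp only [Expr.clean, Bool.and_eq_true] at he
    obtain ⟨C₁, h₁⟩ := ih₁ he.1
    obtain ⟨C₂, h₂⟩ := ih₂ he.2
    refine ⟨_, fun M s h => ⟨?_, (hbin C₁ C₂ M _ _ _ _ (h₁ M s h).1 (h₂ M s h).1 (h₁ M s h).2
      (h₂ M s h).2).1⟩⟩
    refine hpow (C := C₁ + C₂) ?_ (by nlinarith)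
    rw [add_mul]
    exact (Int.natAbs_sub_le _ _).trans_lt (add_lt_two_pow (h₁ M s h).1 (h₂ M s h).1)
  | mul e₁ e₂ ih₁ ih₂ =>
    simp only [Expr.clean, Bool.and_eq_true] at he
    obtain ⟨C₁, h₁⟩ := ih₁ he.1
    obtain ⟨C₂, h₂⟩ := ih₂ he.2
    refine ⟨_, fun M s h => ⟨?_, (hbin C₁ C₂ M _ _ _ _ (h₁ M s h).1 (h₂ M s h).1 (h₁ M s h).2
      (h₂ M s h).2).2⟩⟩
    refine hpow (C := C₁ + C₂) ?_ (by nlinarith)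
    rw [add_mul, pow_add, Expr.eval, Int.natAbs_mul]
    exact Nat.mul_lt_mul'' (h₁ M s h).1 (h₂ M s h).1
  | div e₁ e₂ ih₁ ih₂ =>
    simp only [Expr.clean, Bool.and_eq_true] at he
    obtain ⟨C₁, h₁⟩ := ih₁ he.1
    obtain ⟨C₂, h₂⟩ := ih₂ he.2
    refine ⟨_, fun M s h => ⟨?_, (hbin C₁ C₂ M _ _ _ _ (h₁ M s h).1 (h₂ M s h).1 (h₁ M s h).2
      (h₂ M s h).2).2⟩⟩
    exact hpow (C := C₁) ((Int.natAbs_ediv_le_natAbs _ _).trans_lt (h₁ M s h).1) (by nlinarith)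

/-- The value of an additive expression is longer than the numbers in the memory by at most a
constant number of bits. -/
theorem Expr.exists_bound_of_additive (e : Expr) (he : e.clean = true) (ha : e.additive = true) :
    ∃ g : ℕ, ∀ M s, Bounded M s → (e.eval s).natAbs < 2 ^ (M + g) := by
  have hadd : ∀ {g₁ g₂ M x y : ℕ}, x < 2 ^ (M + g₁) → y < 2 ^ (M + g₂) →
      x + y < 2 ^ (M + (g₁ + g₂ + 1)) := by
    intro g₁ g₂ M x y hx hy
    have h₁ : x < 2 ^ (M + (g₁ + g₂)) :=
      hx.trans_le (Nat.pow_le_pow_right two_pos (by omega))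
    have h₂ : y < 2 ^ (M + (g₁ + g₂)) :=
      hy.trans_le (Nat.pow_le_pow_right two_pos (by omega))
    rw [← add_assoc, pow_succ]
    omega
  induction e with
  | const z => exact ⟨bitLength z, fun M s _ => (natAbs_lt_two_pow_bitLength z).trans_le
      (Nat.pow_le_pow_right two_pos (by omega))⟩
  | var k => exact ⟨0, fun M s h => h.1 k⟩
  | read k e _ =>
    simp only [Expr.clean, Bool.and_eq_true, decide_eq_true_eq] at he
    exact ⟨0, fun M s h => h.2 k _ he.1⟩
  | add e₁ e₂ ih₁ ih₂ =>
    simp only [Expr.clean, Expr.additive, Bool.and_eq_true] at he ha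
    obtain ⟨g₁, h₁⟩ := ih₁ he.1 ha.1
    obtain ⟨g₂, h₂⟩ := ih₂ he.2 ha.2
    exact ⟨_, fun M s h => (Int.natAbs_add_le _ _).trans_lt (hadd (h₁ M s h) (h₂ M s h))⟩
  | sub e₁ e₂ ih₁ ih₂ =>
    simp only [Expr.clean, Expr.additive, Bool.and_eq_true] at he ha
    obtain ⟨g₁, h₁⟩ := ih₁ he.1 ha.1
    obtain ⟨g₂, h₂⟩ := ih₂ he.2 ha.2
    exact ⟨_, fun M s h => (Int.natAbs_sub_le _ _).trans_lt (hadd (h₁ M s h) (h₂ M s h))⟩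
  | mul e₁ e₂ _ _ => simp [Expr.additive] at ha
  | div e₁ e₂ ih₁ _ =>
    simp only [Expr.clean, Expr.additive, Bool.and_eq_true] at he ha
    obtain ⟨g₁, h₁⟩ := ih₁ he.1 ha
    exact ⟨g₁, fun M s h => (Int.natAbs_ediv_le_natAbs _ _).trans_lt (h₁ M s h)⟩

/-- `C` bounds the growth of the numbers and, up to a quadratic factor, the cost of every
elementary step of the program. -/
def Program.StepBound (C : ℕ) : Program → Prop
  | .skip => 1 ≤ C
  | .assign _ e => (∀ M s, Bounded M s → (e.eval s).natAbs < 2 ^ (M + C)) ∧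
      ∀ M s, Bounded M s → e.cost s + bitLength (e.eval s) + 1 ≤ C * (M + 1) ^ 2
  | .store k m e =>
      (2 ≤ k ∧ k ≤ 5 ∨ ∀ M s, Bounded M s → (e.eval s).natAbs < 2 ^ (M + C)) ∧
      ∀ M s, Bounded M s →
        m.cost s + e.cost s + bitLength (m.eval s) + bitLength (e.eval s) + 1 ≤ C * (M + 1) ^ 2
  | .seq c₁ c₂ => c₁.StepBound C ∧ c₂.StepBound C
  | .ite e c₁ c₂ => (∀ M s, Bounded M s → e.cost s + 1 ≤ C * (M + 1) ^ 2) ∧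
      c₁.StepBound C ∧ c₂.StepBound C
  | .while e c => (∀ M s, Bounded M s → e.cost s + 1 ≤ C * (M + 1) ^ 2) ∧ c.StepBound C

theorem Program.StepBound.mono {C C' : ℕ} {c : Program} (h : c.StepBound C) (hC : C ≤ C') :
    c.StepBound C' := by
  have hG : ∀ {x M : ℕ}, x < 2 ^ (M + C) → x < 2 ^ (M + C') := fun h =>
    h.trans_le (Nat.pow_le_pow_right two_pos (by omega))
  have hQ : ∀ {x M : ℕ}, x ≤ C * (M + 1) ^ 2 → x ≤ C' * (M + 1) ^ 2 := fun h =>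
    h.trans (Nat.mul_le_mul_right _ hC)
  induction c with
  | skip => exact le_trans (show 1 ≤ C from h) hC
  | assign k e => exact ⟨fun M s hs => hG (h.1 M s hs), fun M s hs => hQ (h.2 M s hs)⟩
  | store k m e => exact ⟨h.1.imp_right fun h M s hs => hG (h M s hs),
      fun M s hs => hQ (h.2 M s hs)⟩
  | seq c₁ c₂ ih₁ ih₂ => exact ⟨ih₁ h.1, ih₂ h.2⟩
  | ite e c₁ c₂ ih₁ ih₂ => exact ⟨fun M s hs => hQ (h.1 M s hs), ih₁ h.2.1, ih₂ h.2.2⟩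
  | _ e c ih => exact ⟨fun M s hs => hQ (h.1 M s hs), ih h.2⟩

theorem Expr.exists_cost_bound (e : Expr) (he : e.clean = true) :
    ∃ C : ℕ, ∀ M s, Bounded M s → e.cost s + bitLength (e.eval s) + 1 ≤ C * (M + 1) ^ 2 := by
  obtain ⟨C, hC⟩ := e.exists_bound he
  refine ⟨C + C + 2, fun M s h => ?_⟩
  obtain ⟨h₁, h₂⟩ := hC M s h
  have e₁ := bitLength_le h₁
  have e₄ : (M + 1) ≤ (M + 1) ^ 2 := Nat.le_self_pow two_ne_zero _
  have e₅ := Nat.mul_le_mul_left C e₄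
  have e₆ : 1 ≤ (M + 1) ^ 2 := Nat.one_le_pow _ _ (by omega)
  nlinarith

theorem Program.exists_stepBound (c : Program) (hc : c.tame = true) : ∃ C, c.StepBound C := by
  have hG : ∀ {x M g : ℕ} (C : ℕ), x < 2 ^ (M + g) → x < 2 ^ (M + (C + g)) := fun C h =>
    h.trans_le (Nat.pow_le_pow_right two_pos (by omega))
  have hQ : ∀ {x M C : ℕ} (g : ℕ), x ≤ C * (M + 1) ^ 2 → x ≤ (C + g) * (M + 1) ^ 2 := fun g h =>
    h.trans (Nat.mul_le_mul_right _ (by omega))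
  induction c with
  | skip => exact ⟨1, le_refl 1⟩
  | assign k e =>
    simp only [Program.tame, Bool.and_eq_true] at hc
    obtain ⟨C, hC⟩ := e.exists_cost_bound hc.1
    obtain ⟨g, hg⟩ := e.exists_bound_of_additive hc.1 hc.2
    exact ⟨C + g, fun M s hs => hG C (hg M s hs), fun M s hs => hQ g (hC M s hs)⟩
  | store k m e =>
    simp only [Program.tame, Bool.and_eq_true, Bool.or_eq_true, decide_eq_true_eq] at hc
    obtain ⟨C₁, h₁⟩ := m.exists_cost_bound hc.1.1
    obtain ⟨C₂, h₂⟩ := e.exists_cost_bound hc.1.2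
    have h₃ : ∀ M s, Bounded M s →
        m.cost s + e.cost s + bitLength (m.eval s) + bitLength (e.eval s) + 1 ≤
          (C₁ + C₂) * (M + 1) ^ 2 := by
      intro M s hs
      have := h₁ M s hs
      have := h₂ M s hs
      rw [add_mul]
      omega
    rcases hc.2 with h | h
    · exact ⟨C₁ + C₂, Or.inl h, h₃⟩
    · obtain ⟨g, hg⟩ := e.exists_bound_of_additive hc.1.2 h
      exact ⟨C₁ + C₂ + g, Or.inr fun M s hs => hG _ (hg M s hs), fun M s hs => hQ g (h₃ M s hs)⟩
  | seq c₁ c₂ ih₁ ih₂ =>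
    simp only [Program.tame, Bool.and_eq_true] at hc
    obtain ⟨C₁, h₁⟩ := ih₁ hc.1
    obtain ⟨C₂, h₂⟩ := ih₂ hc.2
    exact ⟨C₁ + C₂, h₁.mono (by omega), h₂.mono (by omega)⟩
  | ite e c₁ c₂ ih₁ ih₂ =>
    simp only [Program.tame, Bool.and_eq_true] at hc
    obtain ⟨C, h⟩ := e.exists_cost_bound hc.1.1
    obtain ⟨C₁, h₁⟩ := ih₁ hc.1.2
    obtain ⟨C₂, h₂⟩ := ih₂ hc.2
    refine ⟨C + (C₁ + C₂), fun M s hs => hQ _ ?_, h₁.mono (by omega), h₂.mono (by omega)⟩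
    exact le_trans (by omega) (h M s hs)
  | _ e c ih =>
    simp only [Program.tame, Bool.and_eq_true] at hc
    obtain ⟨C, h⟩ := e.exists_cost_bound hc.1
    obtain ⟨C₁, h₁⟩ := ih hc.2
    refine ⟨C + C₁, fun M s hs => hQ _ ?_, h₁.mono (by omega)⟩
    exact le_trans (by omega) (h M s hs)

/-- In `N` steps the numbers in the memory grow by at most `C * N` bits. -/
theorem Program.StepBound.exec {C N : ℕ} {c : Program} {s s' : State} (hr : Run c s s' N)
    (hc : c.StepBound C) (M : ℕ) (hs : Bounded M s) :
    Bounded (M + C * N) s' ∧ ∃ t, Exec c s s' t ∧ t ≤ C * N * (M + C * N + 1) ^ 2 := by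
  have hone : ∀ {x M : ℕ}, x ≤ C * (M + 1) ^ 2 → x ≤ C * 1 * (M + C * 1 + 1) ^ 2 := fun h =>
    h.trans (Nat.mul_le_mul (by omega) (Nat.pow_le_pow_left (by omega) 2))
  have hite : ∀ {x t M N : ℕ}, x ≤ C * (M + 1) ^ 2 →
      t ≤ C * N * (M + C * N + 1) ^ 2 →
      x + t ≤ C * (1 + N) * (M + C * (1 + N) + 1) ^ 2 := by
    intro x t M N hx ht
    have h₁ : M + C * N + 1 ≤ M + C * (1 + N) + 1 := by rw [mul_add]; omega
    have h₂ : M + 1 ≤ M + C * (1 + N) + 1 := by omega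
    calc x + t ≤ C * (M + C * (1 + N) + 1) ^ 2 + C * N * (M + C * (1 + N) + 1) ^ 2 :=
          Nat.add_le_add (hx.trans (Nat.mul_le_mul_left _ (Nat.pow_le_pow_left h₂ 2)))
            (ht.trans (Nat.mul_le_mul_left _ (Nat.pow_le_pow_left h₁ 2)))
      _ = _ := by ring
  have hseq : ∀ {t₁ t₂ M N₁ N₂ : ℕ}, t₁ ≤ C * N₁ * (M + C * N₁ + 1) ^ 2 →
      t₂ ≤ C * N₂ * (M + C * N₁ + C * N₂ + 1) ^ 2 →
      t₁ + t₂ ≤ C * (N₁ + N₂) * (M + C * (N₁ + N₂) + 1) ^ 2 := by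
    intro t₁ t₂ M N₁ N₂ h₁ h₂
    have h₃ : M + C * N₁ + 1 ≤ M + C * (N₁ + N₂) + 1 := by rw [mul_add]; omega
    calc t₁ + t₂ ≤ C * N₁ * (M + C * (N₁ + N₂) + 1) ^ 2 + C * N₂ * (M + C * (N₁ + N₂) + 1) ^ 2 :=
          Nat.add_le_add (h₁.trans (Nat.mul_le_mul_left _ (Nat.pow_le_pow_left h₃ 2)))
            (h₂.trans (by rw [mul_add C N₁ N₂, add_assoc M]))
      _ = _ := by ring
  induction hr generalizing M with
  | skip s =>
    refine ⟨hs.mono (by omega), 1, .skip s, hone (M := M) ?_⟩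
    exact Nat.mul_pos hc (by positivity)
  | assign s k e =>
    refine ⟨⟨fun j => ?_, fun j m hj => ?_⟩, _, .assign s k e, hone (hc.2 M s hs)⟩
    · rw [State.var_setVar, mul_one]
      split
      · exact hc.1 M s hs
      · exact (hs.mono (by omega)).1 j
    · exact (hs.mono (by omega)).2 j m hj
  | store s k m e =>
    refine ⟨⟨fun j => ?_, fun j i hj => ?_⟩, _, .store s k m e, hone (hc.2 M s hs)⟩
    · exact (hs.mono (by omega)).1 j
    · rw [State.arr_setArr, mul_one]
      have h := (hs.mono (show M ≤ M + C by omega)).2 j i hj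
      split
      · rename_i hjk
        rw [Function.update_apply]
        split
        · exact hc.1.resolve_left (by omega) M s hs
        · exact hjk ▸ h
      · exact h
  | seq _ _ ih₁ ih₂ =>
    obtain ⟨b₁, t₁, e₁, h₁⟩ := ih₁ hc.1 M hs
    obtain ⟨b₂, t₂, e₂, h₂⟩ := ih₂ hc.2 _ b₁
    exact ⟨b₂.mono (by rw [mul_add, add_assoc]), _, .seq e₁ e₂, hseq h₁ h₂⟩
  | ite_true he _ ih =>
    obtain ⟨b, t, e, h⟩ := ih hc.2.1 M hs
    exact ⟨b.mono (by rw [mul_add]; omega), _, .ite_true he e, hite (hc.1 M _ hs) h⟩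
  | ite_false he _ ih =>
    obtain ⟨b, t, e, h⟩ := ih hc.2.2 M hs
    exact ⟨b.mono (by rw [mul_add]; omega), _, .ite_false he e, hite (hc.1 M _ hs) h⟩
  | while_true he _ _ ih₁ ih₂ =>
    obtain ⟨b₁, t₁, e₁, h₁⟩ := ih₁ hc.2 M hs
    obtain ⟨b₂, t₂, e₂, h₂⟩ := ih₂ hc _ b₁
    refine ⟨b₂.mono (by rw [mul_add, mul_add]; omega), _, .while_true he e₁ e₂, ?_⟩
    rw [add_assoc (_ + 1), add_assoc 1]
    exact hite (hc.1 M _ hs) (hseq h₁ h₂)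
  | while_false he =>
    exact ⟨hs.mono (by omega), _, .while_false he, hone (hc.1 M _ hs)⟩

theorem sum_lt_two_pow {ι : Type*} (t : Finset ι) (f g : ι → ℕ) (h : ∀ i ∈ t, f i < 2 ^ g i) :
    ∑ i ∈ t, f i < 2 ^ ∑ i ∈ t, g i := by
  classical
  induction t using Finset.induction_on with
  | empty => simp
  | insert a t ha ih =>
    rw [Finset.sum_insert ha, Finset.sum_insert ha]
    exact add_lt_two_pow (h a (by simp)) (ih fun i hi => h i (by simp [hi]))

theorem bounded_initialState {n : ℕ} (u : Profile n) :
    Bounded (inputSize u) (initialState u) := by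
  have key : ∀ (f : Fin n → Fin n → ℤ) (m : ℤ),
      (∀ i j, bitLength (f i j) ≤ bitLength (u i j).num + bitLength ((u i j).den : ℤ)) →
      (∑ i : Fin n, ∑ j : Fin n, if m = (i : ℤ) * n + j then f i j else 0).natAbs <
        2 ^ inputSize u := by
    intro f m hf
    have h : (∑ i : Fin n, ∑ j : Fin n, if m = (i : ℤ) * n + j then f i j else 0).natAbs ≤
        ∑ i : Fin n, ∑ j : Fin n, (f i j).natAbs := by
      refine (Int.natAbs_sum_le _ _).trans (Finset.sum_le_sum fun i _ => ?_)
      refine (Int.natAbs_sum_le _ _).trans (Finset.sum_le_sum fun j _ => ?_)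
      split <;> simp
    refine h.trans_lt ((sum_lt_two_pow _ _ _ fun i _ => sum_lt_two_pow _ _ _ fun j _ =>
      natAbs_lt_two_pow_bitLength (f i j)).trans_le (Nat.pow_le_pow_right two_pos ?_))
    refine le_trans (Finset.sum_le_sum fun i _ => Finset.sum_le_sum fun j _ => hf i j) ?_
    exact Nat.le_add_left _ _
  refine ⟨fun k => ?_, fun k m _ => ?_⟩
  · by_cases hk : k = 0
    · simp only [initialState, hk, if_true]
      exact (natAbs_lt_two_pow_bitLength _).trans_le
        (Nat.pow_le_pow_right two_pos (Nat.le_add_right _ _))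
    · simp [initialState, hk]
  · simp only [initialState]
    split
    · exact key _ m fun i j => Nat.le_add_right _ _
    · split
      · exact key (fun i j => ((u i j).den : ℤ)) m fun i j => Nat.le_add_left _ _
      · simp

theorem polynomial_eval_mono (T : Polynomial ℕ) : Monotone fun n => T.eval n := by
  intro m n hmn
  simp only [Polynomial.eval_eq_sum_range]
  exact Finset.sum_le_sum fun i _ => Nat.mul_le_mul_left _ (Nat.pow_le_pow_left hmn i)

theorem le_inputSize {n : ℕ} (u : Profile n) : n ≤ inputSize u := by
  rcases Nat.eq_zero_or_pos n with h | h
  · omega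
  · refine le_trans ?_ (Nat.le_add_left _ _)
    have : ∀ i : Fin n, 1 ≤ ∑ j : Fin n,
        (bitLength (u i j).num + bitLength ((u i j).den : ℤ)) := by
      intro i
      refine le_trans ?_ (Finset.single_le_sum (fun _ _ => Nat.zero_le _)
        (Finset.mem_univ (⟨0, h⟩ : Fin n)))
      unfold bitLength
      omega
    calc n = ∑ i : Fin n, 1 := by simp
      _ ≤ _ := Finset.sum_le_sum fun i _ => this i

/-- The runs of a tame program whose number of steps is polynomial in `n` have a bit cost that is
polynomial in the bit length of the input. -/
theorem exists_poly_cost (c : Program) (hc : c.tame = true) (T : Polynomial ℕ) :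
    ∃ P : Polynomial ℕ, ∀ (n : ℕ) (u : Profile n) (s : State) (N : ℕ), N ≤ T.eval n →
      Run c (initialState u) s N → ∃ t, Exec c (initialState u) s t ∧ t ≤ P.eval (inputSize u) := by
  obtain ⟨C, hC⟩ := c.exists_stepBound hc
  refine ⟨Polynomial.C C * T * (Polynomial.X + Polynomial.C C * T + 1) ^ 2,
    fun n u s N hN hr => ?_⟩
  obtain ⟨-, t, ht, hle⟩ := hC.exec hr _ (bounded_initialState u)
  refine ⟨t, ht, hle.trans ?_⟩
  have h : N ≤ T.eval (inputSize u) := hN.trans (polynomial_eval_mono T (le_inputSize u))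
  simp only [Polynomial.eval_mul, Polynomial.eval_pow, Polynomial.eval_add, Polynomial.eval_C,
    Polynomial.eval_X, Polynomial.eval_one]
  gcongr

end RAM

/-! ### Egalitarian outcomes -/

section Egalitarian

variable {A G : Type*} [Fintype A] [Fintype G]

open scoped Classical in
/-- The outcome of the egalitarian rule for agents with dichotomous preferences: agent `i` likes
the items `j` with `D i j` and gets a total amount `r i` of them. If `r i < 1`, then these items
all have the price `1 / r i`, no item that agent `i` likes is cheaper, and the rest of the bundle
consists of free items. -/
structure IsEgalitarian (D : A → G → Prop) (x : A → G → ℝ) (p : G → ℝ) (r : A → ℝ) : Prop where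
  matching : IsFractionalPerfectMatching x
  price_nonneg : ∀ j, 0 ≤ p j
  share_pos : ∀ i, 0 < r i
  share_le : ∀ i, r i ≤ 1
  share_eq : ∀ i, ∑ j with D i j, x i j = r i
  free : ∀ i j, r i = 1 → 0 < x i j → D i j ∧ p j = 0
  price : ∀ i j, r i < 1 → 0 < x i j → D i j ∧ p j = 1 / r i ∨ ¬ D i j ∧ p j = 0
  cheapest : ∀ i j, r i < 1 → D i j → 1 / r i ≤ p j

/-- The items that agent `i` values most. -/
def Likes {K : Type*} [LE K] (u : A → G → K) (i : A) (j : G) : Prop := ∀ j', u i j' ≤ u i j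

open scoped Classical in
/-- Agent `i` has (at most) two utility levels, `hi` for the items that it likes and `lo` for the
others. If the levels coincide, then all items are liked. -/
def IsDichotomous (u : A → G → ℝ) (i : A) : Prop :=
  ∃ lo hi : ℝ, lo ≤ hi ∧ (hi = lo → ∀ j, Likes u i j) ∧
    ∀ j, u i j = if Likes u i j then hi else lo

omit [Fintype A] in
theorem isDichotomous_of_two_values {u : A → G → ℝ} {i : A} {a b : ℝ}
    (h : ∀ j, u i j = a ∨ u i j = b) : IsDichotomous u i := by
  classical
  wlog hab : a ≤ b generalizing a b
  · exact this (fun j => (h j).symm) (le_of_not_ge hab)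
  by_cases hb : ∃ j, u i j = b
  · obtain ⟨j₀, hj₀⟩ := hb
    refine ⟨a, b, hab, fun hba j j' => ?_, fun j => ?_⟩
    · rcases h j with e | e <;> rcases h j' with e' | e' <;> rw [e, e'] <;> linarith
    · by_cases hj : Likes u i j
      · have := hj j₀
        rw [if_pos hj]
        rcases h j with e | e <;> linarith
      · rw [if_neg hj]
        refine (h j).resolve_right fun e => hj fun j' => ?_
        rcases h j' with e' | e' <;> linarith
  · have ha : ∀ j, u i j = a := fun j => (h j).resolve_right fun e => hb ⟨j, e⟩
    have hl : ∀ j, Likes u i j := fun j j' => by rw [ha j, ha j']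
    exact ⟨a, a, le_rfl, fun _ => hl, fun j => by rw [if_pos (hl j), ha j]⟩

open scoped Classical in
theorem dotProduct_of_two_levels {u : G → ℝ} {L : G → Prop} {lo hi : ℝ}
    (h : ∀ j, u j = if L j then hi else lo) (y : G → ℝ) :
    u ⬝ᵥ y = lo * ∑ j, y j + (hi - lo) * ∑ j with L j, y j := by
  rw [dotProduct, Finset.mul_sum, Finset.mul_sum, Finset.sum_filter, ← Finset.sum_add_distrib]
  refine Finset.sum_congr rfl fun j _ => ?_
  rw [h]
  split <;> ring

namespace IsEgalitarian

variable {D : A → G → Prop} {x : A → G → ℝ} {p : G → ℝ} {r : A → ℝ}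

open scoped Classical in
theorem liked_le_one {y : G → ℝ} (L : G → Prop) (h0 : ∀ j, 0 ≤ y j) (h1 : ∑ j, y j = 1) :
    ∑ j with L j, y j ≤ 1 :=
  h1 ▸ Finset.sum_le_sum_of_subset_of_nonneg (Finset.filter_subset _ _) fun j _ _ => h0 j

open scoped Classical in
/-- An agent with `r i < 1` pays at least `1 / r i` for each unit of an item that it likes. -/
theorem liked_le_spend (h : IsEgalitarian D x p r) {i : A} (hr : r i < 1) {y : G → ℝ}
    (h0 : ∀ j, 0 ≤ y j) : ∑ j with D i j, y j ≤ r i * (p ⬝ᵥ y) := by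
  rw [dotProduct, Finset.mul_sum, Finset.sum_filter]
  refine Finset.sum_le_sum fun j _ => ?_
  have h2 := h.share_pos i
  split
  · rename_i hD
    have h1 := h.cheapest i j hr hD
    rw [div_le_iff₀ h2] at h1
    nlinarith [h0 j]
  · exact mul_nonneg h2.le (mul_nonneg (h.price_nonneg j) (h0 j))

open scoped Classical in
theorem spend_eq_one (h : IsEgalitarian D x p r) {i : A} (hr : r i < 1) : p ⬝ᵥ x i = 1 := by
  have h2 := h.share_pos i
  have : r i * (p ⬝ᵥ x i) = ∑ j with D i j, x i j := by
    rw [dotProduct, Finset.mul_sum, Finset.sum_filter]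
    refine Finset.sum_congr rfl fun j _ => ?_
    rcases (h.matching.nonneg i j).eq_or_lt with h0 | h0
    · simp [← h0]
    · rcases h.price i j hr h0 with ⟨hD, hp⟩ | ⟨hD, hp⟩
      · rw [if_pos hD, hp]
        field_simp
      · rw [if_neg hD, hp]
        ring
  rw [h.share_eq i] at this
  exact mul_left_cancel₀ h2.ne' (by linarith)

theorem spend_eq_zero (h : IsEgalitarian D x p r) {i : A} (hr : r i = 1) : p ⬝ᵥ x i = 0 := by
  refine Finset.sum_eq_zero fun j _ => ?_
  rcases (h.matching.nonneg i j).eq_or_lt with h0 | h0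
  · simp [← h0]
  · simp [(h.free i j hr h0).2]

/-- An egalitarian outcome is an HZ equilibrium. -/
theorem isHZEquilibrium {u : A → G → ℝ} (hu : ∀ i, IsDichotomous u i)
    (h : IsEgalitarian (Likes u) x p r) : IsHZEquilibrium u x p := by
  classical
  refine ⟨h.matching, h.price_nonneg, fun i => ?_, fun i y h0 h1 hy => ?_⟩
  · rcases (h.share_le i).eq_or_lt with hr | hr
    · rw [h.spend_eq_zero hr]
      exact zero_le_one
    · exact (h.spend_eq_one hr).le
  · obtain ⟨lo, hi, hlh, hall, hu⟩ := hu i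
    rw [dotProduct_of_two_levels hu, dotProduct_of_two_levels hu, h1, h.matching.agent_matched i,
      h.share_eq i]
    have hpy : 0 ≤ p ⬝ᵥ y := Finset.sum_nonneg fun j _ => mul_nonneg (h.price_nonneg j) (h0 j)
    rcases (h.share_le i).eq_or_lt with hr | hr
    · refine ⟨?_, fun _ => by rw [h.spend_eq_zero hr]; exact hpy⟩
      have := liked_le_one (Likes u i) h0 h1
      rw [hr]
      nlinarith
    · have hle := h.liked_le_spend hr h0
      have hpos := h.share_pos i
      have hle' : ∑ j with Likes u i j, y j ≤ r i := hle.trans (by nlinarith)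
      refine ⟨by nlinarith, fun heq => ?_⟩
      rw [h.spend_eq_one hr]
      have hge : r i ≤ ∑ j with Likes u i j, y j := by
        rcases hlh.eq_or_lt with e | e
        · rw [Finset.filter_true_of_mem fun j _ => hall e.symm j, h1]
          exact hr.le
        · nlinarith
      nlinarith

/-- The unit bundles of price at most `1` under `p` are those that earn at least `1` under the
payments `(c + 1 - p) / c`. -/
theorem _root_.IsHZEquilibrium.isHZEarningsEquilibrium {u : A → G → ℝ} {x : A → G → ℝ}
    {p q : G → ℝ} (h : IsHZEquilibrium u x p) {c : ℝ} (hc : 0 < c) (hp : ∀ j, p j ≤ c)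
    (hq : ∀ j, q j = (c + 1 - p j) / c) : IsHZEarningsEquilibrium u x q := by
  have hdot : ∀ y : G → ℝ, ∑ j, y j = 1 → c * (q ⬝ᵥ y) = c + 1 - p ⬝ᵥ y := by
    intro y hy
    have : c * (q ⬝ᵥ y) = ∑ j, ((c + 1) * y j - p j * y j) := by
      rw [dotProduct, Finset.mul_sum]
      refine Finset.sum_congr rfl fun j _ => ?_
      rw [hq]
      field_simp
    rw [this, Finset.sum_sub_distrib, ← Finset.mul_sum, hy, dotProduct, mul_one]
  refine ⟨h.matching, fun j => ?_, fun i => ?_, fun i y h0 h1 hy => ?_⟩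
  · rw [hq]
    have := hp j
    exact div_nonneg (by linarith) hc.le
  · have h1 := hdot _ (h.matching.agent_matched i)
    have h2 := h.budget i
    by_contra! h3
    nlinarith
  · have e1 := hdot _ (h.matching.agent_matched i)
    have e2 := hdot y h1
    obtain ⟨o1, o2⟩ := h.optimal i y h0 h1 (by nlinarith)
    refine ⟨o1, fun heq => ?_⟩
    have := o2 heq
    by_contra! h3
    nlinarith

section Strategyproof

variable {D' : A → G → Prop} {x' : A → G → ℝ} {p' : G → ℝ} {r' : A → ℝ} {i : A}

theorem sum_le_of_others {X Y : A → ℝ} {c : ℝ} (hX : ∑ h, X h = c) (hY : ∑ h, Y h = c)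
    (hle : ∀ h, h ≠ i → X h ≤ Y h) : Y i ≤ X i := by
  classical
  have h1 := Finset.add_sum_erase Finset.univ X (Finset.mem_univ i)
  have h2 := Finset.add_sum_erase Finset.univ Y (Finset.mem_univ i)
  have h3 : ∑ h ∈ Finset.univ.erase i, X h ≤ ∑ h ∈ Finset.univ.erase i, Y h :=
    Finset.sum_le_sum fun h hh => hle h (Finset.ne_of_mem_erase hh)
  linarith

theorem sum_item_set (hx : IsFractionalPerfectMatching x) (T : Finset G) :
    ∑ h, ∑ j ∈ T, x h j = T.card := by
  rw [Finset.sum_comm]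
  simp [hx.item_matched]

/-- The items that are bought at a price of at least `1 / r i > 1` go to agents that like them
and whose share is at most `r i`. -/
theorem share_le_of_expensive (h : IsEgalitarian D x p r) {k : A} {j : G}
    (hj : 1 / r i ≤ p j) (hx : 0 < x k j) : D k j ∧ r k ≤ r i := by
  have hpos : 0 < p j := lt_of_lt_of_le (one_div_pos.2 (h.share_pos i)) hj
  rcases (h.share_le k).eq_or_lt with hk | hk
  · exact absurd (h.free k j hk hx).2 hpos.ne'
  · rcases h.price k j hk hx with ⟨hD, hp⟩ | ⟨-, hp⟩
    · exact ⟨hD, by rwa [hp, one_div_le_one_div (h.share_pos i) (h.share_pos k)] at hj⟩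
    · exact absurd hp hpos.ne'

open scoped Classical in
/-- The key step: in passing from one market to another one with different preferences of agent
`i` only, agent `i` does not get more of an item that it likes. -/
theorem liked_le_share (h : IsEgalitarian D x p r) (h' : IsEgalitarian D' x' p' r')
    (hD : ∀ k, k ≠ i → D' k = D k) : ∑ j with D i j, x' i j ≤ r i := by
  rcases (h.share_le i).eq_or_lt with hi | hi
  · exact hi ▸ liked_le_one _ (h'.matching.nonneg i) (h'.matching.agent_matched i)
  have hipos := h.share_pos i
  -- Agents with a share of at most `r i` like expensive items only.
  have hexp : ∀ k j, r k ≤ r i → D k j → 1 / r i ≤ p j := fun k j hk hj =>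
    (one_div_le_one_div_of_le (h.share_pos k) hk).trans (h.cheapest k j (hk.trans_lt hi) hj)
  have hshare : ∀ k, r k ≤ r i → ∀ T : Finset G, (∀ j ∈ T, 1 / r i ≤ p j) →
      ∑ j ∈ T, x k j ≤ r k := by
    intro k hk T hT
    rw [← h.share_eq k]
    calc ∑ j ∈ T, x k j ≤ ∑ j ∈ T with D k j, x k j := by
          rw [Finset.sum_filter]
          refine Finset.sum_le_sum fun j hj => ?_
          rcases (h.matching.nonneg k j).eq_or_lt with h0 | h0
          · simp [← h0]
          · rw [if_pos (h.share_le_of_expensive (hT j hj) h0).1]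
      _ ≤ _ := Finset.sum_le_sum_of_subset_of_nonneg
          (Finset.filter_subset_filter _ (Finset.subset_univ T)) fun j _ _ => h.matching.nonneg k j
  -- Expensive items that the misreport of `i` makes free: their number is an integer below the
  -- number of their owners, so the owners other than `i` absorb all of them.
  have hfree : ∀ j, 1 / r i ≤ p j → p' j = 0 → x' i j = 0 := by
    set T : Finset G := Finset.univ.filter fun j => 1 / r i ≤ p j ∧ p' j = 0 with hT
    set S : Finset A := Finset.univ.filter fun k => ∃ j ∈ T, 0 < x k j with hS
    have hTmem : ∀ j ∈ T, 1 / r i ≤ p j ∧ p' j = 0 := fun j hj => (Finset.mem_filter.1 hj).2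
    have hSr : ∀ k ∈ S, r k ≤ r i := by
      intro k hk
      obtain ⟨j, hj, hx⟩ := (Finset.mem_filter.1 hk).2
      exact (h.share_le_of_expensive (hTmem j hj).1 hx).2
    have hnot : ∀ k, k ∉ S → ∑ j ∈ T, x k j = 0 := by
      intro k hk
      refine Finset.sum_eq_zero fun j hj => ?_
      by_contra h0
      exact hk (Finset.mem_filter.2 ⟨Finset.mem_univ _, j, hj,
        (h.matching.nonneg k j).lt_of_ne' h0⟩)
    have hfull : ∀ k ∈ S.erase i, ∑ j ∈ T, x' k j = 1 := by
      intro k hk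
      obtain ⟨hki, hkS⟩ := Finset.mem_erase.1 hk
      obtain ⟨j, hj, hx⟩ := (Finset.mem_filter.1 hkS).2
      have hDj : D' k j := by
        rw [hD k hki]
        exact (h.share_le_of_expensive (hTmem j hj).1 hx).1
      have hk1 : r' k = 1 := by
        by_contra hne
        have := h'.cheapest k j ((h'.share_le k).lt_of_ne hne) hDj
        rw [(hTmem j hj).2] at this
        exact absurd this (not_le.2 (one_div_pos.2 (h'.share_pos k)))
      rw [← h'.matching.agent_matched k]
      refine Finset.sum_subset (Finset.subset_univ T) fun j' _ hj' => ?_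
      by_contra h0
      obtain ⟨hD', hp'⟩ := h'.free k j' hk1 ((h'.matching.nonneg k j').lt_of_ne' h0)
      rw [hD k hki] at hD'
      exact hj' (Finset.mem_filter.2 ⟨Finset.mem_univ _, hexp k j' (hSr k hkS) hD', hp'⟩)
    have hcard : (T.card : ℝ) ≤ r i * S.card := by
      rw [← sum_item_set h.matching T, ← Finset.sum_subset (Finset.subset_univ S)
        fun k _ hk => hnot k hk, mul_comm, ← nsmul_eq_mul]
      exact Finset.sum_le_card_nsmul _ _ _ fun k hk =>
        (hshare k (hSr k hk) T fun j hj => (hTmem j hj).1).trans (hSr k hk)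
    have hle : T.card ≤ (S.erase i).card := by
      rcases S.eq_empty_or_nonempty with he | hne
      · rw [he] at hcard
        have : (T.card : ℝ) ≤ 0 := by simpa using hcard
        have : T.card ≤ 0 := by exact_mod_cast this
        omega
      · have hSpos : (0 : ℝ) < S.card := by exact_mod_cast hne.card_pos
        have : (T.card : ℝ) < S.card := by nlinarith
        have h2 : T.card < S.card := by exact_mod_cast this
        have := Finset.pred_card_le_card_erase (s := S) (a := i)
        omega
    have hsum : ∑ j ∈ T, x' i j ≤ 0 := by
      have h1 := Finset.add_sum_erase Finset.univ (fun k => ∑ j ∈ T, x' k j) (Finset.mem_univ i)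
      have h2 := sum_item_set h'.matching T
      have h3 : ((S.erase i).card : ℝ) ≤ ∑ k ∈ Finset.univ.erase i, ∑ j ∈ T, x' k j := by
        rw [Finset.cast_card, ← Finset.sum_congr rfl hfull]
        exact Finset.sum_le_sum_of_subset_of_nonneg
          (Finset.erase_subset_erase _ (Finset.subset_univ S)) fun k _ _ =>
          Finset.sum_nonneg fun j _ => h'.matching.nonneg k j
      have h4 : (T.card : ℝ) ≤ (S.erase i).card := by exact_mod_cast hle
      linarith
    intro j hj hj'
    have hjT : j ∈ T := Finset.mem_filter.2 ⟨Finset.mem_univ _, hj, hj'⟩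
    exact le_antisymm ((Finset.single_le_sum (fun j _ => h'.matching.nonneg i j) hjT).trans hsum)
      (h'.matching.nonneg i j)
  rcases (h'.share_le i).eq_or_lt with hi' | hi'
  · refine le_trans (le_of_eq (Finset.sum_eq_zero fun j hj => ?_)) hipos.le
    by_contra h0
    have hp := (h'.free i j hi' ((h'.matching.nonneg i j).lt_of_ne' h0)).2
    exact h0 (hfree j (h.cheapest i j hi (Finset.mem_filter.1 hj).2) hp)
  -- The items that `i` buys have the price `1 / r' i`.
  have hbuy : ∀ j, D i j → 0 < x' i j → D' i j ∧ p' j = 1 / r' i := by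
    intro j hj hx
    rcases h'.price i j hi' hx with hp | ⟨-, hp⟩
    · exact hp
    · exact absurd (hfree j (h.cheapest i j hi hj) hp) hx.ne'
  rcases le_or_gt (r' i) (r i) with hle | hlt
  · refine le_trans ?_ hle
    rw [← h'.share_eq i, Finset.sum_filter, Finset.sum_filter]
    refine Finset.sum_le_sum fun j _ => ?_
    rcases (h'.matching.nonneg i j).eq_or_lt with h0 | h0
    · simp [← h0]
    · split
      · rename_i hj
        rw [if_pos (hbuy j hj h0).1]
      · split
        · exact h0.le
        · exact le_rfl
  · -- All expensive items whose price drops below `1 / r i`: their owners other than `i` get at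
    -- least as much of them as before.
    set T : Finset G := Finset.univ.filter fun j => 1 / r i ≤ p j ∧ p' j < 1 / r i with hT
    have hTmem : ∀ j ∈ T, 1 / r i ≤ p j ∧ p' j < 1 / r i := fun j hj => (Finset.mem_filter.1 hj).2
    have hothers : ∀ k, k ≠ i → ∑ j ∈ T, x k j ≤ ∑ j ∈ T, x' k j := by
      intro k hki
      by_cases hk : ∃ j ∈ T, 0 < x k j
      · obtain ⟨j, hj, hx⟩ := hk
        obtain ⟨hDj, hkr⟩ := h.share_le_of_expensive (hTmem j hj).1 hx
        refine (hshare k hkr T fun j hj => (hTmem j hj).1).trans (hkr.trans ?_)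
        have hDj' : D' k j := by rwa [hD k hki]
        have hge : r i ≤ r' k := by
          rcases (h'.share_le k).eq_or_lt with hk' | hk'
          · rw [hk']
            exact hi.le
          · have := (h'.cheapest k j hk' hDj').trans_lt (hTmem j hj).2
            exact (lt_of_one_div_lt_one_div (h'.share_pos k) this).le
        have hsub : ∀ j', D' k j' → 0 < x' k j' → j' ∈ T := by
          intro j' hj' hx'
          refine Finset.mem_filter.2 ⟨Finset.mem_univ _, hexp k j' hkr (by rwa [← hD k hki]), ?_⟩
          rcases (h'.share_le k).eq_or_lt with hk' | hk'
          · rw [(h'.free k j' hk' hx').2]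
            exact one_div_pos.2 hipos
          · rcases h'.price k j' hk' hx' with ⟨-, hp⟩ | ⟨hn, -⟩
            · rw [hp]
              exact (h'.cheapest k j hk' hDj').trans_lt (hTmem j hj).2
            · exact absurd hj' hn
        refine hge.trans ?_
        rw [← h'.share_eq k, ← Finset.sum_filter_add_sum_filter_not
          (Finset.univ.filter fun j => D' k j) (fun j => j ∈ T)]
        have hz : ∑ j ∈ (Finset.univ.filter fun j => D' k j) with j ∉ T, x' k j = 0 := by
          refine Finset.sum_eq_zero fun j' hj' => ?_
          simp only [Finset.mem_filter, Finset.mem_univ, true_and] at hj'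
          by_contra h0
          exact hj'.2 (hsub j' hj'.1 ((h'.matching.nonneg k j').lt_of_ne' h0))
        rw [hz, add_zero]
        refine Finset.sum_le_sum_of_subset_of_nonneg (fun j' hj' => (Finset.mem_filter.1 hj').2)
          fun j' _ _ => h'.matching.nonneg k j'
      · rw [Finset.sum_eq_zero fun j hj => ?_]
        · exact Finset.sum_nonneg fun j _ => h'.matching.nonneg k j
        · by_contra h0
          exact hk ⟨j, hj, (h.matching.nonneg k j).lt_of_ne' h0⟩
    have hiT : ∑ j ∈ T, x' i j ≤ ∑ j ∈ T, x i j :=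
      sum_le_of_others (sum_item_set h.matching T) (sum_item_set h'.matching T) hothers
    refine le_trans ?_ (hiT.trans (hshare i le_rfl T fun j hj => (hTmem j hj).1))
    rw [Finset.sum_filter, ← Finset.sum_subset (Finset.subset_univ T)]
    · refine Finset.sum_le_sum fun j _ => ?_
      split
      · exact le_rfl
      · exact h'.matching.nonneg i j
    · intro j _ hj
      split
      · rename_i hDj
        by_contra h0
        have hx := (h'.matching.nonneg i j).lt_of_ne' h0
        refine hj (Finset.mem_filter.2 ⟨Finset.mem_univ _, h.cheapest i j hi hDj, ?_⟩)
        rw [(hbuy j hDj hx).2]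
        exact one_div_lt_one_div_of_lt hipos hlt
      · rfl

/-- Misreporting does not help in egalitarian outcomes: for dichotomous utilities only the amount
of liked items matters. -/
theorem dotProduct_le {u u' : A → G → ℝ} (hu : IsDichotomous u i)
    (h : IsEgalitarian (Likes u) x p r) (h' : IsEgalitarian (Likes u') x' p' r')
    (huu : ∀ k, k ≠ i → u' k = u k) : u i ⬝ᵥ x' i ≤ u i ⬝ᵥ x i := by
  classical
  obtain ⟨lo, hi, hlh, -, hu⟩ := hu
  rw [dotProduct_of_two_levels hu, dotProduct_of_two_levels hu, h.matching.agent_matched i,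
    h'.matching.agent_matched i, h.share_eq i]
  have := h.liked_le_share h' (i := i) fun k hk => by
    ext j
    simp only [Likes, huu k hk]
  nlinarith

end Strategyproof

end IsEgalitarian

end Egalitarian

/-! ### Matchings of copies of agents with copies of items -/

/-! Every agent has `a` copies and every item `b` copies; copy `k` belongs to agent `k / a`, and copy
`d` to item `d / b`. -/

section Copies

open Finset

open scoped Classical in
/-- The items (below `n`) that some agent in `S` is linked to. -/
noncomputable def nbr (n : ℕ) (E : ℕ → ℕ → Prop) (S : Finset ℕ) : Finset ℕ :=
  (range n).filter fun j => ∃ i ∈ S, E i j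

theorem mem_nbr {n : ℕ} {E : ℕ → ℕ → Prop} {S : Finset ℕ} {j : ℕ} :
    j ∈ nbr n E S ↔ j < n ∧ ∃ i ∈ S, E i j := by
  simp [nbr]

/-- The copies of the elements of `T`, each of the numbers below `n` having `a` copies. -/
def copies (n a : ℕ) (T : Finset ℕ) : Finset ℕ := (range (n * a)).filter fun k => k / a ∈ T

theorem mem_copies {n a : ℕ} {T : Finset ℕ} {k : ℕ} :
    k ∈ copies n a T ↔ k < n * a ∧ k / a ∈ T := by
  simp [copies]

theorem card_copies {n a : ℕ} {T : Finset ℕ} (ha : 0 < a) (hT : T ⊆ range n) :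
    (copies n a T).card = a * T.card := by
  rw [card_eq_sum_card_fiberwise (f := fun k => k / a) (t := T)
    fun k hk => (mem_copies.1 hk).2, mul_comm, ← smul_eq_mul, ← sum_const]
  refine sum_congr rfl fun t ht => ?_
  have : (copies n a T).filter (fun k => k / a = t) = Ico (t * a) (t * a + a) := by
    ext k
    have h1 : t < n := mem_range.1 (hT ht)
    have h2 : t * a + a ≤ n * a := by
      rw [← Nat.succ_mul]
      exact Nat.mul_le_mul_right a h1
    rw [mem_filter, mem_copies, mem_Ico, Nat.div_eq_iff ha]
    constructor
    · rintro ⟨-, h3, h4⟩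
      omega
    · rintro ⟨h3, h4⟩
      refine ⟨⟨by omega, ?_⟩, by omega, by omega⟩
      rwa [(Nat.div_eq_iff ha).2 ⟨by omega, by omega⟩]
  rw [this]
  simp

/-- A partial matching of item copies with copies of agents in `R` along `E`, with prices of the
item copies such that each agent copy has an item copy that is cheapest for it up to one unit;
`mate d = -1` means that `d` is unmatched. Only matched copies have positive prices. -/
structure IsPriceMatching (n a b : ℕ) (R : Finset ℕ) (E : ℕ → ℕ → Prop) (mate price : ℕ → ℤ) :
    Prop where
  price_nonneg : ∀ d < n * b, 0 ≤ price d
  price_le : ∀ d < n * b, price d ≤ n * b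
  mate_eq : ∀ d < n * b, mate d = -1 ∨ ∃ k : ℕ, mate d = k ∧ k < n * a ∧ k / a ∈ R ∧
    E (k / a) (d / b) ∧ ∀ d' < n * b, E (k / a) (d' / b) → price d ≤ price d' + 1
  inj : ∀ d < n * b, ∀ d' < n * b, mate d ≠ -1 → mate d = mate d' → d = d'
  pos : ∀ d < n * b, 0 < price d → mate d ≠ -1

open scoped Classical in
/-- The item copies that are matched to agents in `S`. -/
noncomputable def matchedTo (n a b : ℕ) (mate : ℕ → ℤ) (S : Finset ℕ) : Finset ℕ :=
  (range (n * b)).filter fun d => ∃ k : ℕ, mate d = k ∧ k / a ∈ S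

theorem mem_matchedTo {n a b : ℕ} {mate : ℕ → ℤ} {S : Finset ℕ} {d : ℕ} :
    d ∈ matchedTo n a b mate S ↔ d < n * b ∧ ∃ k : ℕ, mate d = k ∧ k / a ∈ S := by
  simp [matchedTo]

namespace IsPriceMatching

variable {n a b : ℕ} {R S : Finset ℕ} {E : ℕ → ℕ → Prop} {mate price : ℕ → ℤ}

theorem div_lt {d : ℕ} (hd : d < n * b) : d / b < n :=
  Nat.div_lt_of_lt_mul (by rwa [mul_comm])

theorem spec (h : IsPriceMatching n a b R E mate price) {d k : ℕ} (hd : d < n * b)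
    (hk : mate d = k) : k < n * a ∧ k / a ∈ R ∧ E (k / a) (d / b) ∧
      ∀ d' < n * b, E (k / a) (d' / b) → price d ≤ price d' + 1 := by
  rcases h.mate_eq d hd with h' | ⟨k', hk', h'⟩
  · omega
  · have : k = k' := by omega
    exact this ▸ h'

/-- The agent copy `k` takes the item copy `d₀` that is cheapest for it, and the price of `d₀`
increases by one. -/
theorem update (h : IsPriceMatching n a b R E mate price) {k d₀ : ℕ} (hk : k < n * a)
    (hkR : k / a ∈ R) (hE : E (k / a) (d₀ / b)) (hlt : price d₀ < n * b)
    (hmin : ∀ d < n * b, E (k / a) (d / b) → price d₀ ≤ price d)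
    (hfree : ∀ d < n * b, mate d ≠ k) {mate' price' : ℕ → ℤ}
    (hm : ∀ d, mate' d = if d = d₀ then (k : ℤ) else mate d)
    (hp : ∀ d, price' d = if d = d₀ then price d₀ + 1 else price d) :
    IsPriceMatching n a b R E mate' price' := by
  have hge : ∀ d, price d ≤ price' d := fun d => by
    rw [hp]
    split
    · rename_i hd
      rw [hd]
      omega
    · exact le_rfl
  refine ⟨fun d hd => (h.price_nonneg d hd).trans (hge d), fun d hd => ?_, fun d hd => ?_,
    fun d hd d' hd' hne heq => ?_, fun d hd hpos => ?_⟩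
  · rw [hp]
    split
    · omega
    · exact h.price_le d hd
  · rw [hm, hp]
    split
    · refine Or.inr ⟨k, rfl, hk, hkR, by rwa [‹d = d₀›], fun d' hd' hE' => ?_⟩
      have := hmin d' hd' hE'
      have := hge d'
      omega
    · refine (h.mate_eq d hd).imp_right ?_
      rintro ⟨k', hk', h1, h2, h3, h4⟩
      exact ⟨k', hk', h1, h2, h3, fun d' hd' hE' => (h4 d' hd' hE').trans
        (by have := hge d'; omega)⟩
  · rw [hm] at hne
    rw [hm, hm] at heq
    split at heq <;> split at heq
    · omega
    · exact absurd heq.symm (hfree d' hd')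
    · exact absurd heq (hfree d hd)
    · rw [if_neg ‹_›] at hne
      exact h.inj d hd d' hd' hne heq
  · rw [hm]
    rw [hp] at hpos
    split
    · omega
    · rw [if_neg ‹_›] at hpos
      exact h.pos d hd hpos

theorem empty (R : Finset ℕ) (E : ℕ → ℕ → Prop) (hm : ∀ d < n * b, mate d = -1)
    (hp : ∀ d < n * b, price d = 0) : IsPriceMatching n a b R E mate price where
  price_nonneg d hd := (hp d hd).ge
  price_le d hd := by rw [hp d hd]; positivity
  mate_eq d hd := Or.inl (hm d hd)
  inj d hd _ _ hne := absurd (hm d hd) hne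
  pos d hd hpos := absurd (hp d hd) hpos.ne'

/-- If the prices do not take the value `t` and an unmatched agent copy only has links to item
copies of prices above `t`, then the agents all of whose links lead to prices above `t` want more
than they can get. -/
theorem violator (h : IsPriceMatching n a b R E mate price) (ha : 0 < a) (hb : 0 < b)
    (hR : R ⊆ range n) {k₀ : ℕ} (hk₀ : k₀ < n * a) (hkR : k₀ / a ∈ R)
    (hfree : ∀ d < n * b, mate d ≠ k₀) {t : ℤ} (ht : 0 ≤ t)
    (hgt : ∀ d < n * b, E (k₀ / a) (d / b) → t < price d) (hempty : ∀ d < n * b, price d ≠ t)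
    (hS : ∀ i, i ∈ S ↔ i ∈ R ∧ ∀ d < n * b, E i (d / b) → t < price d) :
    k₀ / a ∈ S ∧ b * (nbr n E S).card < a * S.card := by
  have hk₀S : k₀ / a ∈ S := (hS _).2 ⟨hkR, hgt⟩
  refine ⟨hk₀S, ?_⟩
  have hSn : S ⊆ range n := fun i hi => hR ((hS i).1 hi).1
  set J := (range (n * b)).filter fun d => t < price d with hJ
  have hJmem : ∀ {d}, d ∈ J ↔ d < n * b ∧ t < price d := fun {d} => by simp [hJ]
  have h1 : b * (nbr n E S).card ≤ J.card := by
    rw [← card_copies hb fun j hj => mem_range.2 (mem_nbr.1 hj).1]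
    refine card_le_card fun d hd => ?_
    obtain ⟨hd, hdn⟩ := mem_copies.1 hd
    obtain ⟨-, i, hi, hE⟩ := mem_nbr.1 hdn
    exact hJmem.2 ⟨hd, ((hS i).1 hi).2 d hd hE⟩
  have hmate : ∀ d ∈ J, ∃ k : ℕ, mate d = k ∧ k ∈ (copies n a S).erase k₀ := by
    intro d hd
    obtain ⟨hd, hp⟩ := hJmem.1 hd
    rcases h.mate_eq d hd with h' | ⟨k, hk, hkn, hkR, -, hmin⟩
    · exact absurd h' (h.pos d hd (by omega))
    · refine ⟨k, hk, mem_erase.2 ⟨?_, mem_copies.2 ⟨hkn, (hS _).2 ⟨hkR, fun d' hd' hE => ?_⟩⟩⟩⟩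
      · rintro rfl
        exact hfree d hd hk
      · have := hmin d' hd' hE
        have := hempty d' hd'
        omega
  have h2 : J.card ≤ ((copies n a S).erase k₀).card := by
    refine card_le_card_of_injOn (fun d => (mate d).toNat) (fun d hd => ?_)
      fun d hd d' hd' heq => ?_
    · obtain ⟨k, hk, hkS⟩ := hmate d hd
      simp only [hk, Int.toNat_natCast]
      exact hkS
    · obtain ⟨k, hk, -⟩ := hmate d hd
      obtain ⟨k', hk', -⟩ := hmate d' hd'
      simp only [hk, hk', Int.toNat_natCast] at heq
      exact h.inj d (hJmem.1 hd).1 d' (hJmem.1 hd').1 (by omega) (by rw [hk, hk', heq])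
  have hmem : k₀ ∈ copies n a S := mem_copies.2 ⟨hk₀, hk₀S⟩
  have h3 := card_erase_add_one hmem
  rw [card_copies ha hSn] at h3
  omega

/-- The matching covers all copies of agents in `R`. -/
def Complete (n a b : ℕ) (R : Finset ℕ) (mate : ℕ → ℤ) : Prop :=
  ∀ k < n * a, k / a ∈ R → ∃ d < n * b, mate d = k

theorem card_matchedTo (h : IsPriceMatching n a b R E mate price) (hc : Complete n a b R mate)
    (ha : 0 < a) (hR : R ⊆ range n) (hS : S ⊆ R) :
    (matchedTo n a b mate S).card = a * S.card := by
  rw [← card_copies ha (hS.trans hR)]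
  refine card_bij (fun d _ => (mate d).toNat) (fun d hd => ?_) (fun d hd d' hd' heq => ?_)
    fun k hk => ?_
  · obtain ⟨hd, k, hk, hkS⟩ := mem_matchedTo.1 hd
    simpa [hk, mem_copies, hkS] using (h.spec hd hk).1
  · obtain ⟨hd, k, hk, hkS⟩ := mem_matchedTo.1 hd
    obtain ⟨hd', k', hk', hkS'⟩ := mem_matchedTo.1 hd'
    simp only [hk, hk', Int.toNat_natCast] at heq
    exact h.inj d hd d' hd' (by omega) (by rw [hk, hk', heq])
  · obtain ⟨hk, hkS⟩ := mem_copies.1 hk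
    obtain ⟨d, hd, hdk⟩ := hc k hk (hS hkS)
    exact ⟨d, mem_matchedTo.2 ⟨hd, k, hdk, hkS⟩, by simp [hdk]⟩

theorem matchedTo_subset (h : IsPriceMatching n a b R E mate price) :
    matchedTo n a b mate S ⊆ copies n b (nbr n E S) := by
  intro d hd
  obtain ⟨hd, k, hk, hkS⟩ := mem_matchedTo.1 hd
  exact mem_copies.2 ⟨hd, mem_nbr.2 ⟨div_lt hd, _, hkS, (h.spec hd hk).2.2.1⟩⟩

theorem nbr_subset : nbr n E S ⊆ range n := fun _ hj => mem_range.2 (mem_nbr.1 hj).1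

/-- A complete matching proves Hall's condition. -/
theorem hall (h : IsPriceMatching n a b R E mate price) (hc : Complete n a b R mate)
    (ha : 0 < a) (hb : 0 < b) (hR : R ⊆ range n) (hS : S ⊆ R) :
    a * S.card ≤ b * (nbr n E S).card := by
  rw [← h.card_matchedTo hc ha hR hS, ← card_copies hb nbr_subset]
  exact card_le_card h.matchedTo_subset

open scoped Classical in
/-- The number of copies of item `j` that are matched to copies of agent `i`, for `i ∈ S`. -/
noncomputable def amount (n a b : ℕ) (mate : ℕ → ℤ) (S : Finset ℕ) (i j : ℕ) : ℕ :=
  ((range (n * b)).filter fun d => ∃ k : ℕ, mate d = k ∧ k / a ∈ S ∧ k / a = i ∧ d / b = j).card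

theorem amount_eq_zero_of_notMem {i j : ℕ} (hi : i ∉ S) : amount n a b mate S i j = 0 := by
  classical
  rw [amount, card_eq_zero, filter_eq_empty_iff]
  rintro d - ⟨k, -, hk, rfl, -⟩
  exact hi hk

theorem exists_of_amount_ne_zero {i j : ℕ} (h : amount n a b mate S i j ≠ 0) :
    ∃ d < n * b, ∃ k : ℕ, mate d = k ∧ k / a ∈ S ∧ k / a = i ∧ d / b = j := by
  obtain ⟨d, hd⟩ := card_ne_zero.1 h
  exact ⟨d, by simpa using hd⟩

theorem sum_amount_agent (h : IsPriceMatching n a b R E mate price) (hc : Complete n a b R mate)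
    (ha : 0 < a) (hR : R ⊆ range n) (hS : S ⊆ R) {i : ℕ} (hi : i ∈ S) :
    ∑ j ∈ range n, amount n a b mate S i j = a := by
  classical
  have h1 := h.card_matchedTo hc ha hR (singleton_subset_iff.2 (hS hi))
  rw [card_singleton, mul_one] at h1
  refine Eq.trans ?_ h1
  rw [card_eq_sum_card_fiberwise (f := fun d => d / b) (t := range n)
    fun d hd => by simpa using div_lt (mem_matchedTo.1 hd).1]
  refine sum_congr rfl fun j _ => ?_
  rw [amount, matchedTo, filter_filter]
  refine congrArg card (filter_congr fun d _ => ?_)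
  constructor
  · rintro ⟨k, hk, -, hki, hdj⟩
    exact ⟨⟨k, hk, mem_singleton.2 hki⟩, hdj⟩
  · rintro ⟨⟨k, hk, hki⟩, hdj⟩
    rw [mem_singleton] at hki
    exact ⟨k, hk, hki ▸ hi, hki, hdj⟩

theorem sum_amount_item (h : IsPriceMatching n a b R E mate price) (hR : R ⊆ range n) {j : ℕ} :
    ∑ i ∈ range n, amount n a b mate S i j =
      ((matchedTo n a b mate S).filter fun d => d / b = j).card := by
  classical
  rw [card_eq_sum_card_fiberwise (f := fun d => (mate d).toNat / a) (t := range n)]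
  · refine sum_congr rfl fun i _ => ?_
    rw [amount, matchedTo, filter_filter, filter_filter]
    refine congrArg card (filter_congr fun d _ => ?_)
    constructor
    · rintro ⟨k, hk, hkS, hki, hdj⟩
      exact ⟨⟨k, hk, hkS⟩, hdj, by simpa [hk] using hki⟩
    · rintro ⟨⟨k, hk, hkS⟩, hdj, hki⟩
      exact ⟨k, hk, hkS, by simpa [hk] using hki, hdj⟩
  · intro d hd
    obtain ⟨hd, k, hk, hkS⟩ := mem_matchedTo.1 (mem_filter.1 hd).1
    simpa [hk] using hR (h.spec hd hk).2.1

/-- The set `S` of agents in `R` may be served with the share `a / b`: either `a / b < 1` is the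
number of linked items per agent in `S`, or `S = R` and every agent is to get a whole item. -/
def Candidate (n : ℕ) (R : Finset ℕ) (E : ℕ → ℕ → Prop) (S : Finset ℕ) (a b : ℕ) : Prop :=
  S ⊆ R ∧ S.Nonempty ∧ 0 < a ∧ b ≤ n ∧
    (a = 1 ∧ b = 1 ∧ S = R ∨ a < b ∧ a = (nbr n E S).card ∧ b = S.card)

open scoped Classical in
/-- If a copy of item `j` is matched to an agent in a candidate set, then all its copies are: for
`a / b < 1`, the `a * b` copies of the agents in `S` use up all copies of the `a` items that `S` is
linked to. -/
theorem sum_amount_item_of_mem (h : IsPriceMatching n a b R E mate price)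
    (hc : Complete n a b R mate) (hR : R ⊆ range n) (hS : Candidate n R E S a b) {j : ℕ}
    (hj : ∃ d ∈ matchedTo n a b mate S, d / b = j) :
    ∑ i ∈ range n, amount n a b mate S i j = b := by
  obtain ⟨hSR, hne, ha, hbn, hcase⟩ := hS
  obtain ⟨d₀, hd₀, hdj⟩ := hj
  have hd₀' := (mem_matchedTo.1 hd₀).1
  have hb : 0 < b := by
    rcases Nat.eq_zero_or_pos b with rfl | hb
    · simp at hd₀'
    · exact hb
  have hjn : j < n := hdj ▸ div_lt hd₀'
  rw [h.sum_amount_item hR]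
  have hcop : (copies n b {j}).card = b := by
    rw [card_copies hb (by simpa using hjn), card_singleton, mul_one]
  suffices hsub : copies n b {j} ⊆ matchedTo n a b mate S by
    refine Eq.trans ?_ hcop
    refine congrArg card (Finset.ext fun d => ?_)
    rw [mem_filter, mem_copies, mem_singleton]
    constructor
    · rintro ⟨h1, h2⟩
      exact ⟨(mem_matchedTo.1 h1).1, h2⟩
    · rintro ⟨h1, h2⟩
      exact ⟨hsub (mem_copies.2 ⟨h1, mem_singleton.2 h2⟩), h2⟩
  rcases hcase with ⟨-, rfl, -⟩ | ⟨-, haN, hbS⟩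
  · intro d hd
    have := (mem_copies.1 hd).2
    rw [mem_singleton, Nat.div_one] at this
    rw [Nat.div_one] at hdj
    rwa [this, ← hdj]
  · have heq : matchedTo n a b mate S = copies n b (nbr n E S) := by
      refine eq_of_subset_of_card_le h.matchedTo_subset ?_
      rw [card_copies hb nbr_subset, h.card_matchedTo hc ha hR hSR, ← haN, ← hbS, mul_comm]
    rw [heq] at hd₀ ⊢
    intro d hd
    obtain ⟨h1, h2⟩ := mem_copies.1 hd
    refine mem_copies.2 ⟨h1, ?_⟩
    rw [mem_singleton.1 h2, ← hdj]
    exact (mem_copies.1 hd₀).2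

end IsPriceMatching

/-- The outcome for the agents that are already served (those with `rb i ≠ 0`), and Hall's
condition for the remaining ones. A served agent `i` has the share `ra i / rb i`, a sold item `j`
(one with `pb j ≠ 0`) has the price `pb j / pa j` (or `0` if this is `1`), and agent `i` gets `W i j / rb i` of it. The
shares served so far are at most `la / lb`, and the agents in `R` can all get that much. -/
structure PartialOutcome (n : ℕ) (D : ℕ → ℕ → Prop) (ra rb pa pb : ℕ → ℤ) (W : ℕ → ℕ → ℤ)
    (R : Finset ℕ) (E : ℕ → ℕ → Prop) (la lb : ℕ) : Prop where
  mem_remaining : ∀ i, i ∈ R ↔ i < n ∧ rb i = 0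
  link : ∀ i j, E i j ↔ D i j ∧ pb j = 0
  unserved : ∀ i < n, rb i = 0 → ∀ j < n, W i j = 0
  served : ∀ i < n, rb i ≠ 0 → 0 < ra i ∧ ra i ≤ rb i ∧ ∑ j ∈ range n, W i j = ra i ∧
    (∀ j < n, W i j ≠ 0 → D i j ∧ pa j = ra i ∧ pb j = rb i) ∧
    (ra i < rb i → ∀ j < n, D i j → pb j ≠ 0 ∧ pa j * rb i ≤ ra i * pb j)
  nonneg : ∀ i < n, ∀ j < n, 0 ≤ W i j
  unsold : ∀ j < n, pb j = 0 → pa j = 0 ∧ ∀ i < n, W i j = 0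
  sold : ∀ j < n, pb j ≠ 0 → 0 < pa j ∧ pa j ≤ pb j ∧ pb j ≤ n ∧
    ∑ i ∈ range n, W i j = pb j ∧ pa j * lb ≤ la * pb j
  la_pos : 0 < la
  lb_pos : 0 < lb
  hall : ∀ T ⊆ R, la * T.card ≤ lb * (nbr n E T).card

namespace PartialOutcome

open IsPriceMatching

variable {n : ℕ} {D : ℕ → ℕ → Prop} {ra rb pa pb : ℕ → ℤ} {W : ℕ → ℕ → ℤ} {R : Finset ℕ}
  {E : ℕ → ℕ → Prop} {la lb : ℕ}

theorem subset_range (h : PartialOutcome n D ra rb pa pb W R E la lb) : R ⊆ range n :=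
  fun i hi => mem_range.2 ((h.mem_remaining i).1 hi).1

theorem initial (hD : ∀ i < n, ∃ j < n, D i j) :
    PartialOutcome n D (fun _ => 0) (fun _ => 0) (fun _ => 0) (fun _ => 0) (fun _ _ => 0)
      (range n) (fun i j => D i j ∧ (0 : ℤ) = 0) 1 (n + 1) where
  mem_remaining i := by simp
  link i j := Iff.rfl
  unserved := by simp
  served := by simp
  nonneg := by simp
  unsold := by simp
  sold := by simp
  la_pos := one_pos
  lb_pos := Nat.succ_pos n
  hall T hT := by
    rcases T.eq_empty_or_nonempty with rfl | ⟨i, hi⟩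
    · simp
    · obtain ⟨j, hj, hij⟩ := hD i (mem_range.1 (hT hi))
      have h1 : 0 < (nbr n (fun i j => D i j ∧ (0 : ℤ) = 0) T).card :=
        card_pos.2 ⟨j, mem_nbr.2 ⟨hj, i, hi, hij, rfl⟩⟩
      have h2 := card_le_card hT
      rw [card_range] at h2
      nlinarith

/-- A set that violates Hall's condition for the share `a / b` is a candidate with a smaller
share. -/
theorem candidate (h : PartialOutcome n D ra rb pa pb W R E la lb) {S S' : Finset ℕ} {a b : ℕ}
    (hS : Candidate n R E S a b) (hS' : S' ⊆ R) (hne : S'.Nonempty)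
    (hlt : b * (nbr n E S').card < a * S'.card) :
    Candidate n R E S' (nbr n E S').card S'.card := by
  have hle : a ≤ b := by
    rcases hS.2.2.2.2 with ⟨rfl, rfl, -⟩ | ⟨hab, -⟩ <;> omega
  have hpos : 0 < (nbr n E S').card := by
    by_contra h0
    have h1 := h.hall S' hS'
    have h2 := Nat.mul_pos h.la_pos hne.card_pos
    have h3 : (nbr n E S').card = 0 := by omega
    rw [h3] at h1
    omega
  have hcard : S'.card ≤ n := by
    simpa using card_le_card (hS'.trans h.subset_range)
  exact ⟨hS', hne, hpos, hcard, Or.inr ⟨by nlinarith, rfl, rfl⟩⟩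

open scoped Classical in
/-- Serving a candidate along a complete matching. By Hall's condition for `S`, the share `a / b` is
at least `la / lb`, so the items sold before are not cheaper than `b / a`. By Hall's condition for
the unions of `S` with sets of other agents, these can still get the share `a / b`. -/
theorem serve (h : PartialOutcome n D ra rb pa pb W R E la lb) {S : Finset ℕ} {a b : ℕ}
    (hS : Candidate n R E S a b) {mate price : ℕ → ℤ}
    (hm : IsPriceMatching n a b R E mate price) (hc : Complete n a b R mate)
    {ra' rb' pa' pb' : ℕ → ℤ} {W' : ℕ → ℕ → ℤ} {R' : Finset ℕ} {E' : ℕ → ℕ → Prop}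
    (hra : ∀ i < n, ra' i = if i ∈ S then (a : ℤ) else ra i)
    (hrb : ∀ i < n, rb' i = if i ∈ S then (b : ℤ) else rb i)
    (hpa : ∀ j < n, pa' j = if ∃ d ∈ matchedTo n a b mate S, d / b = j then (a : ℤ) else pa j)
    (hpb : ∀ j < n, pb' j = if ∃ d ∈ matchedTo n a b mate S, d / b = j then (b : ℤ) else pb j)
    (hW : ∀ i < n, ∀ j < n, W' i j = W i j + amount n a b mate S i j)
    (hR' : ∀ i, i ∈ R' ↔ i < n ∧ rb' i = 0) (hE' : ∀ i j, E' i j ↔ D i j ∧ pb' j = 0) :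
    PartialOutcome n D ra' rb' pa' pb' W' R' E' a b := by
  have hSR := hS.1
  have hRn := h.subset_range
  have ha : 0 < a := hS.2.2.1
  have hab : a ≤ b := by
    rcases hS.2.2.2.2 with ⟨rfl, rfl, -⟩ | ⟨hab, -⟩ <;> omega
  have hb : 0 < b := by omega
  have hbn := hS.2.2.2.1
  have hbz : (b : ℤ) ≠ 0 := by omega
  have hSn : ∀ i ∈ S, i < n := fun i hi => mem_range.1 (hRn (hSR hi))
  have hSrb : ∀ i ∈ S, rb i = 0 := fun i hi => ((h.mem_remaining i).1 (hSR hi)).2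
  have hR'S : ∀ i, i ∈ R' ↔ i ∈ R ∧ i ∉ S := by
    intro i
    rw [hR', h.mem_remaining]
    constructor
    · rintro ⟨hi, h0⟩
      rw [hrb i hi] at h0
      split at h0
      · omega
      · exact ⟨⟨hi, h0⟩, ‹_›⟩
    · rintro ⟨⟨hi, h0⟩, hiS⟩
      exact ⟨hi, by rw [hrb i hi, if_neg hiS, h0]⟩
  -- The newly sold items.
  set F : ℕ → Prop := fun j => ∃ d ∈ matchedTo n a b mate S, d / b = j with hF
  have hFspec : ∀ j, F j → j < n ∧ pb j = 0 ∧ ∃ i ∈ S, D i j := by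
    rintro j ⟨d, hd, rfl⟩
    obtain ⟨hd, k, hk, hkS⟩ := mem_matchedTo.1 hd
    obtain ⟨hD, h0⟩ := (h.link _ _).1 (hm.spec hd hk).2.2.1
    exact ⟨div_lt hd, h0, _, hkS, hD⟩
  have hamF : ∀ i j, amount n a b mate S i j ≠ 0 → i ∈ S ∧ D i j ∧ F j := by
    intro i j hij
    obtain ⟨d, hd, k, hk, hkS, rfl, rfl⟩ := exists_of_amount_ne_zero hij
    exact ⟨hkS, ((h.link _ _).1 (hm.spec hd hk).2.2.1).1, d, mem_matchedTo.2 ⟨hd, k, hk, hkS⟩, rfl⟩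
  have hamS : ∀ i j, i ∉ S → amount n a b mate S i j = 0 := fun i j hi =>
    amount_eq_zero_of_notMem hi
  have htight : a < b → ∀ i ∈ S, ∀ j < n, D i j → pb j = 0 → F j := by
    intro hlt i hi j hj hD h0
    rcases hS.2.2.2.2 with ⟨rfl, rfl, -⟩ | ⟨-, haN, hbS⟩
    · omega
    · have heq : matchedTo n a b mate S = copies n b (nbr n E S) := by
        refine eq_of_subset_of_card_le hm.matchedTo_subset ?_
        rw [card_copies hb nbr_subset, hm.card_matchedTo hc ha hRn hSR, ← haN, ← hbS, mul_comm]
      refine ⟨j * b, ?_, Nat.mul_div_cancel _ hb⟩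
      rw [heq, mem_copies, Nat.mul_div_cancel _ hb, mem_nbr]
      exact ⟨Nat.mul_lt_mul_of_pos_right hj hb, hj, i, hi, (h.link i j).2 ⟨hD, h0⟩⟩
  refine ⟨hR', hE', fun i hi h0 j hj => ?_, fun i hi h0 => ?_, fun i hi j hj => ?_,
    fun j hj h0 => ?_, fun j hj h0 => ?_, ha, hb, fun T hT => ?_⟩
  · rw [hrb i hi] at h0
    split at h0
    · omega
    · rw [hW i hi j hj, h.unserved i hi h0 j hj, hamS i j ‹_›]
      rfl
  · have hpF : ∀ j < n, pb j ≠ 0 → ¬ F j := fun j _ h1 h2 => h1 (hFspec j h2).2.1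
    by_cases hiS : i ∈ S
    · rw [hra i hi, hrb i hi, if_pos hiS, if_pos hiS]
      have hW0 : ∀ j < n, W i j = 0 := h.unserved i hi (hSrb i hiS)
      refine ⟨by omega, by omega, ?_, fun j hj hne => ?_, fun hlt j hj hD => ?_⟩
      · rw [← hm.sum_amount_agent hc ha hRn hSR hiS, Nat.cast_sum]
        refine sum_congr rfl fun j hj => ?_
        rw [hW i hi j (mem_range.1 hj), hW0 j (mem_range.1 hj), zero_add]
      · rw [hW i hi j hj, hW0 j hj, zero_add] at hne
        obtain ⟨-, hD, hFj⟩ := hamF i j (by exact_mod_cast hne)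
        rw [hpa j hj, hpb j hj, if_pos hFj, if_pos hFj]
        exact ⟨hD, rfl, rfl⟩
      · have hlt' : a < b := by exact_mod_cast hlt
        by_cases h1 : pb j = 0
        · have hFj := htight hlt' i hiS j hj hD h1
          rw [hpa j hj, hpb j hj, if_pos hFj, if_pos hFj]
          exact ⟨hbz, le_rfl⟩
        · rw [hpa j hj, hpb j hj, if_neg (hpF j hj h1), if_neg (hpF j hj h1)]
          refine ⟨h1, ?_⟩
          obtain ⟨hp1, hp2, -, -, hp3⟩ := h.sold j hj h1
          -- Hall's condition for `S` says `la / lb ≤ a / b`.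
          have hla : la * b ≤ lb * a := by
            rcases hS.2.2.2.2 with ⟨rfl, rfl, -⟩ | ⟨-, haN, hbS⟩
            · omega
            · rw [haN, hbS]
              exact h.hall S hSR
          have hla' : (la : ℤ) * b ≤ lb * a := by exact_mod_cast hla
          have hlb : (0 : ℤ) < lb := by exact_mod_cast h.lb_pos
          have hpbpos : 0 < pb j := by omega
          have h2 : pa j * b * lb ≤ a * pb j * lb := by
            nlinarith [mul_le_mul_of_nonneg_right hp3 (Int.natCast_nonneg b),
              mul_le_mul_of_nonneg_right hla' hpbpos.le]
          exact le_of_mul_le_mul_right h2 hlb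
    · have hrbi : rb i ≠ 0 := by rwa [hrb i hi, if_neg hiS] at h0
      obtain ⟨h1, h2, h3, h4, h5⟩ := h.served i hi hrbi
      have hW' : ∀ j < n, W' i j = W i j := fun j hj => by
        rw [hW i hi j hj, hamS i j hiS]
        simp
      rw [hra i hi, hrb i hi, if_neg hiS, if_neg hiS]
      refine ⟨h1, h2, ?_, fun j hj hne => ?_, fun hlt j hj hD => ?_⟩
      · rw [← h3]
        exact sum_congr rfl fun j hj => hW' j (mem_range.1 hj)
      · obtain ⟨h6, h7, h8⟩ := h4 j hj (by rwa [hW' j hj] at hne)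
        have hnF := hpF j hj (by omega)
        rw [hpa j hj, hpb j hj, if_neg hnF, if_neg hnF]
        exact ⟨h6, h7, h8⟩
      · obtain ⟨h6, h7⟩ := h5 hlt j hj hD
        have hnF := hpF j hj h6
        rw [hpa j hj, hpb j hj, if_neg hnF, if_neg hnF]
        exact ⟨h6, h7⟩
  · rw [hW i hi j hj]
    have := h.nonneg i hi j hj
    omega
  · rw [hpb j hj] at h0
    split at h0
    · omega
    · rename_i hFj
      obtain ⟨h1, h2⟩ := h.unsold j hj h0
      refine ⟨by rw [hpa j hj, if_neg hFj, h1], fun i hi => ?_⟩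
      have : amount n a b mate S i j = 0 := by
        by_contra hne
        exact hFj (hamF i j hne).2.2
      rw [hW i hi j hj, h2 i hi, this]
      rfl
  · by_cases hFj : F j
    · rw [hpa j hj, hpb j hj, if_pos hFj, if_pos hFj]
      refine ⟨by omega, by omega, by omega, ?_, le_rfl⟩
      rw [← hm.sum_amount_item_of_mem hc hRn hS hFj, Nat.cast_sum]
      refine sum_congr rfl fun i hi => ?_
      rw [hW i (mem_range.1 hi) j hj, (h.unsold j hj (hFspec j hFj).2.1).2 i (mem_range.1 hi),
        zero_add]
    · rw [hpb j hj, if_neg hFj] at h0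
      obtain ⟨h1, h2, h3, h4, h5⟩ := h.sold j hj h0
      rw [hpa j hj, hpb j hj, if_neg hFj, if_neg hFj]
      refine ⟨h1, h2, h3, ?_, ?_⟩
      · rw [← h4]
        refine sum_congr rfl fun i hi => ?_
        have : amount n a b mate S i j = 0 := by
          by_contra hne
          exact hFj (hamF i j hne).2.2
        rw [hW i (mem_range.1 hi) j hj, this]
        simp
      · rcases hS.2.2.2.2 with ⟨rfl, rfl, -⟩ | ⟨-, haN, hbS⟩
        · simpa using h2
        · have hla : la * b ≤ lb * a := by
            rw [haN, hbS]
            exact h.hall S hSR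
          have hla' : (la : ℤ) * b ≤ lb * a := by exact_mod_cast hla
          have hlb : (0 : ℤ) < lb := by exact_mod_cast h.lb_pos
          have hpbpos : 0 < pb j := by omega
          have h2 : pa j * b * lb ≤ a * pb j * lb := by
            nlinarith [mul_le_mul_of_nonneg_right h5 (Int.natCast_nonneg b),
              mul_le_mul_of_nonneg_right hla' hpbpos.le]
          exact le_of_mul_le_mul_right h2 hlb
  · rcases hS.2.2.2.2 with ⟨-, -, hSR'⟩ | ⟨hlt, haN, hbS⟩
    · have : T = ∅ := by
        refine eq_empty_of_forall_notMem fun i hi => ?_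
        have := (hR'S i).1 (hT hi)
        exact this.2 (hSR' ▸ this.1)
      simp [this]
    · -- The new neighbours of `T` are those neighbours of `T ∪ S` that `S` leaves over.
      have hTR : T ⊆ R := fun i hi => ((hR'S i).1 (hT hi)).1
      have hdisj : Disjoint T S := disjoint_left.2 fun i hi => ((hR'S i).1 (hT hi)).2
      have h1 := hm.hall hc ha hb hRn (union_subset hTR hSR)
      have h2 : nbr n E (T ∪ S) ⊆ nbr n E' T ∪ nbr n E S := by
        intro j hj
        obtain ⟨hjn, i, hi, hE⟩ := mem_nbr.1 hj
        rw [mem_union]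
        by_cases hjS : j ∈ nbr n E S
        · exact Or.inr hjS
        · left
          have hiT : i ∈ T := (mem_union.1 hi).resolve_right fun hiS =>
            hjS (mem_nbr.2 ⟨hjn, i, hiS, hE⟩)
          obtain ⟨hD, h0⟩ := (h.link i j).1 hE
          refine mem_nbr.2 ⟨hjn, i, hiT, (hE' i j).2 ⟨hD, ?_⟩⟩
          rw [hpb j hjn, if_neg, h0]
          rintro ⟨d, hd, rfl⟩
          exact hjS (mem_copies.1 (hm.matchedTo_subset hd)).2
      have h3 := (card_le_card h2).trans (card_union_le _ _)
      rw [card_union_of_disjoint hdisj, ← hbS] at h1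
      rw [← haN] at h3
      nlinarith

end PartialOutcome

end Copies

/-! ### The outcome when all agents are served -/

section Final

open Finset

namespace PartialOutcome

variable {n : ℕ} {D : ℕ → ℕ → Prop} {ra rb pa pb : ℕ → ℤ} {W : ℕ → ℕ → ℤ}
  {E : ℕ → ℕ → Prop} {la lb : ℕ}

/-- When all agents are served, every agent `i` with `ra i < rb i` still lacks an amount
`1 - ra i / rb i`. The unsold items, `m` in number, make up for this: every agent gets the same
fraction `(1 - ra i / rb i) / m` of each of them. -/
theorem isEgalitarian (h : PartialOutcome n D ra rb pa pb W ∅ E la lb)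
    {x : Fin n → Fin n → ℝ} {p : Fin n → ℝ} {m : ℕ}
    (hm : m = ((range n).filter fun j => pb j = 0).card)
    (hx : ∀ i j : Fin n, x i j = if pb j = 0 then ((rb i - ra i : ℤ) : ℝ) / ((rb i : ℝ) * m)
      else (W i j : ℝ) / rb i)
    (hp : ∀ j : Fin n, p j = if pa j < pb j then (pb j : ℝ) / pa j else 0) :
    IsEgalitarian (fun i j : Fin n => D i j) x p fun i => (ra i : ℝ) / rb i := by
  classical
  have hrb : ∀ i : Fin n, rb i ≠ 0 := fun i h0 =>
    absurd ((h.mem_remaining i).2 ⟨i.2, h0⟩) (notMem_empty _)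
  have hra0 : ∀ i : Fin n, (0 : ℝ) < ra i := fun i => by
    exact_mod_cast (h.served i i.2 (hrb i)).1
  have hrab : ∀ i : Fin n, (ra i : ℝ) ≤ rb i := fun i => by
    exact_mod_cast (h.served i i.2 (hrb i)).2.1
  have hrb0 : ∀ i : Fin n, (0 : ℝ) < rb i := fun i => (hra0 i).trans_le (hrab i)
  have hW0 : ∀ i j : Fin n, (0 : ℝ) ≤ W i j := fun i j => by
    exact_mod_cast h.nonneg i i.2 j j.2
  have hrow : ∀ i : Fin n, ∑ j : Fin n, (W i j : ℝ) / rb i = (ra i : ℝ) / rb i := by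
    intro i
    rw [← sum_div, Fin.sum_univ_eq_sum_range (fun j => (W i j : ℝ)) n]
    congr 1
    exact_mod_cast (h.served i i.2 (hrb i)).2.2.1
  have hWz : ∀ i j : Fin n, pb j = 0 → W i j = 0 := fun i j h0 =>
    (h.unsold j j.2 h0).2 i i.2
  have hxW : ∀ i j : Fin n, x i j = (W i j : ℝ) / rb i +
      if pb j = 0 then (1 - (ra i : ℝ) / rb i) / m else 0 := by
    intro i j
    rw [hx]
    split
    · rename_i h0
      rw [hWz i j h0]
      have := (hrb0 i).ne'
      push_cast
      rcases eq_or_ne (m : ℝ) 0 with hm0 | hm0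
      · simp [hm0]
      · field_simp
        ring
    · ring
  have hcol : ∀ j : Fin n, pb j ≠ 0 → ∑ i : Fin n, (W i j : ℝ) / rb i = 1 := by
    intro j hj
    obtain ⟨h1, h2, -, h3, -⟩ := h.sold j j.2 hj
    have : ∀ i : Fin n, (W i j : ℝ) / rb i = (W i j : ℝ) / pb j := by
      intro i
      by_cases h0 : W i j = 0
      · simp [h0]
      · rw [((h.served i i.2 (hrb i)).2.2.2.1 j j.2 h0).2.2]
    rw [sum_congr rfl fun i _ => this i, ← sum_div,
      Fin.sum_univ_eq_sum_range (fun i => (W i j : ℝ)) n, div_eq_one_iff_eq]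
    · exact_mod_cast h3
    · exact_mod_cast hj
  have hmcard : (m : ℝ) = ∑ j : Fin n, if pb j = 0 then (1 : ℝ) else 0 := by
    rw [Fin.sum_univ_eq_sum_range (fun j => if pb j = 0 then (1 : ℝ) else 0) n, hm,
      ← sum_filter, sum_const, nsmul_eq_mul, mul_one]
  -- Double counting: the agents lack as much in total as there are unsold items.
  have hlack : (m : ℝ) = ∑ i : Fin n, (1 - (ra i : ℝ) / rb i) := by
    have h1 : ∑ j : Fin n, ∑ i : Fin n, (W i j : ℝ) / rb i =
        ∑ j : Fin n, (1 - if pb j = 0 then (1 : ℝ) else 0) := by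
      refine sum_congr rfl fun j _ => ?_
      split
      · rename_i h0
        rw [sub_self]
        exact sum_eq_zero fun i _ => by rw [hWz i j h0]; simp
      · rename_i h0
        rw [hcol j h0, sub_zero]
    rw [sum_comm, sum_congr rfl fun i _ => hrow i, sum_sub_distrib, ← hmcard] at h1
    rw [sum_sub_distrib]
    linarith
  have hle1 : ∀ i : Fin n, (ra i : ℝ) / rb i ≤ 1 := fun i => (div_le_one (hrb0 i)).2 (hrab i)
  have hm1 : ∀ i : Fin n, (1 - (ra i : ℝ) / rb i) / m * m = 1 - (ra i : ℝ) / rb i := by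
    intro i
    rcases eq_or_ne (m : ℝ) 0 with hm0 | hm0
    · rw [hm0] at hlack
      have := (sum_eq_zero_iff_of_nonneg fun i _ => sub_nonneg.2 (hle1 i)).1 hlack.symm i
        (mem_univ i)
      rw [this]
      simp
    · exact div_mul_cancel₀ _ hm0
  have hprice : ∀ i j : Fin n, W i j ≠ 0 → D i j ∧
      p j = if ra i < rb i then 1 / ((ra i : ℝ) / rb i) else 0 := by
    intro i j hne
    obtain ⟨h1, h2, h3⟩ := (h.served i i.2 (hrb i)).2.2.2.1 j j.2 hne
    exact ⟨h1, by rw [hp, h2, h3, one_div_div]⟩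
  have hlt_iff : ∀ i : Fin n, (ra i : ℝ) / rb i < 1 ↔ ra i < rb i := fun i => by
    rw [div_lt_one (hrb0 i)]
    exact_mod_cast Iff.rfl
  have hunsold : ∀ i j : Fin n, ra i < rb i → D i j → pb j ≠ 0 := fun i j hlt hD =>
    ((h.served i i.2 (hrb i)).2.2.2.2 hlt j j.2 hD).1
  refine ⟨⟨fun i j => ?_, fun i => ?_, fun j => ?_⟩, fun j => ?_, fun i => ?_, hle1, fun i => ?_,
    fun i j hi hxij => ?_, fun i j hi hxij => ?_, fun i j hi hD => ?_⟩
  · rw [hxW]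
    refine add_nonneg (div_nonneg (hW0 i j) (hrb0 i).le) ?_
    split
    · exact div_nonneg (sub_nonneg.2 (hle1 i)) (Nat.cast_nonneg _)
    · exact le_rfl
  · rw [sum_congr rfl fun j _ => hxW i j, sum_add_distrib, hrow]
    have : ∑ j : Fin n, (if pb j = 0 then (1 - (ra i : ℝ) / rb i) / m else 0) =
        (1 - (ra i : ℝ) / rb i) / m * m := by
      nth_rewrite 3 [hmcard]
      rw [mul_sum]
      exact sum_congr rfl fun j _ => by split <;> simp
    rw [this, hm1]
    ring
  · by_cases h0 : pb j = 0
    · have hmpos : (m : ℝ) ≠ 0 := by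
        have : 0 < m := by
          rw [hm]
          exact card_pos.2 ⟨j, by simp [h0]⟩
        positivity
      have : ∀ i : Fin n, x i j = (1 - (ra i : ℝ) / rb i) / m := fun i => by
        rw [hxW, hWz i j h0, if_pos h0]
        simp
      rw [sum_congr rfl fun i _ => this i, ← sum_div, ← hlack, div_self hmpos]
    · rw [← hcol j h0]
      refine sum_congr rfl fun i _ => ?_
      rw [hxW, if_neg h0, add_zero]
  · rw [hp]
    split
    · rename_i hlt
      have h0 : pb j ≠ 0 := fun h0 => by
        have := (h.unsold j j.2 h0).1
        omega
      obtain ⟨h1, h2, -⟩ := h.sold j j.2 h0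
      have h3 : (0 : ℝ) ≤ pb j := by exact_mod_cast (by omega : (0 : ℤ) ≤ pb j)
      have h4 : (0 : ℝ) ≤ pa j := by exact_mod_cast h1.le
      exact div_nonneg h3 h4
    · exact le_rfl
  · exact div_pos (hra0 i) (hrb0 i)
  · rw [← hrow i, sum_filter]
    refine sum_congr rfl fun j _ => ?_
    split
    · rename_i hD
      rw [hxW]
      split
      · rename_i h0
        have : ¬ ra i < rb i := fun hlt => hunsold i j hlt hD h0
        have h1 : ra i = rb i := by
          have := (h.served i i.2 (hrb i)).2.1
          omega
        rw [h1, div_self (hrb0 i).ne']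
        simp
      · rw [add_zero]
    · rename_i hD
      have : W i j = 0 := by
        by_contra hne
        exact hD (hprice i j hne).1
      rw [this]
      simp
  · have hnlt : ¬ ra i < rb i := fun hlt => ((hlt_iff i).2 hlt).ne hi
    have hne : W i j ≠ 0 := by
      intro h0
      rw [hxW, h0, hi] at hxij
      simp at hxij
    obtain ⟨h1, h2⟩ := hprice i j hne
    exact ⟨h1, by rw [h2, if_neg hnlt]⟩
  · have hlt := (hlt_iff i).1 hi
    by_cases hne : W i j = 0
    · have h0 : pb j = 0 := by
        by_contra h0
        rw [hxW, hne, if_neg h0] at hxij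
        simp at hxij
      refine Or.inr ⟨fun hD => hunsold i j hlt hD h0, ?_⟩
      rw [hp, h0, (h.unsold j j.2 h0).1, if_neg (lt_irrefl _)]
    · obtain ⟨h1, h2⟩ := hprice i j hne
      exact Or.inl ⟨h1, by rw [h2, if_pos hlt]⟩
  · have hlt := (hlt_iff i).1 hi
    obtain ⟨h0, hle⟩ := (h.served i i.2 (hrb i)).2.2.2.2 hlt j j.2 hD
    obtain ⟨h1, h2, -⟩ := h.sold j j.2 h0
    have hra' := (h.served i i.2 (hrb i)).1
    have hltj : pa j < pb j := by
      by_contra hge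
      have : pa j = pb j := by omega
      rw [this] at hle
      nlinarith
    rw [hp, if_pos hltj, one_div_div, div_le_div_iff₀ (hra0 i) (by exact_mod_cast h1)]
    have : rb i * pa j ≤ pb j * ra i := by linarith
    exact_mod_cast this

theorem price_le {p : Fin n → ℝ} {R : Finset ℕ} (h : PartialOutcome n D ra rb pa pb W R E la lb)
    (hp : ∀ j : Fin n, p j = if pa j < pb j then (pb j : ℝ) / pa j else 0) (j : Fin n) :
    p j ≤ n := by
  rw [hp]
  split
  · rename_i hlt
    have h0 : pb j ≠ 0 := fun h0 => by
      have := (h.unsold j j.2 h0).1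
      omega
    obtain ⟨h1, h2, h3, -⟩ := h.sold j j.2 h0
    have h4 : (1 : ℝ) ≤ pa j := by exact_mod_cast h1
    have h5 : (pb j : ℝ) ≤ n := by exact_mod_cast h3
    rw [div_le_iff₀ (by linarith)]
    nlinarith [Nat.cast_nonneg (α := ℝ) n]
  · exact Nat.cast_nonneg _

end PartialOutcome

end Final

namespace RAM

/-! ### The program -/

section Prog

/-! The names of the variables and arrays. In the current round, agents have `a` and items `b`
copies; `na = n * a` and `nb = n * b` are variables of their own, as products must not be stored.
The rounds result in the share `ra i / rb i` of agent `i` (not yet served if `rb i = 0`),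
the price `pb j / pa j` of item `j` (unsold if `pb j = 0`; a price of `1` is replaced by `0` in the
end), and the number `W[i, j]` of copies of
item `j` that agent `i` has got. -/

notation "v_n" => (0 : ℕ)
notation "v_i" => (1 : ℕ)
notation "v_j" => (2 : ℕ)
notation "v_l" => (3 : ℕ)
notation "v_a" => (4 : ℕ)
notation "v_b" => (5 : ℕ)
notation "v_na" => (6 : ℕ)
notation "v_nb" => (7 : ℕ)
notation "v_cur" => (8 : ℕ)
notation "v_nxt" => (9 : ℕ)
notation "v_best" => (10 : ℕ)
notation "v_arg" => (11 : ℕ)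
notation "v_viol" => (12 : ℕ)
notation "v_lev" => (13 : ℕ)
notation "v_flag" => (14 : ℕ)
notation "v_left" => (15 : ℕ)
notation "v_free" => (16 : ℕ)
notation "v_d" => (17 : ℕ)
notation "v_old" => (18 : ℕ)
notation "v_t" => (19 : ℕ)
notation "v_cb" => (20 : ℕ)
notation "v_ca" => (21 : ℕ)
notation "v_cnb" => (22 : ℕ)
notation "v_cna" => (23 : ℕ)
notation "a_num" => (0 : ℕ)
notation "a_den" => (1 : ℕ)
notation "a_like" => (6 : ℕ)
notation "a_mate" => (7 : ℕ)
notation "a_price" => (8 : ℕ)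
notation "a_S" => (9 : ℕ)
notation "a_ra" => (11 : ℕ)
notation "a_rb" => (12 : ℕ)
notation "a_pa" => (13 : ℕ)
notation "a_pb" => (14 : ℕ)
notation "a_W" => (15 : ℕ)

/-- The index of the entry `(i, j)` of a matrix. -/
def entry (i j : Expr) : Expr := .add (.mul i (.var v_n)) j

/-- `like[i, j] := 1` if `u i j` is maximal in its row, and `0` otherwise. -/
def findLikes : Program :=
  forLoop v_i v_n (forLoop v_j v_n (.seq
    (.store a_like (entry (.var v_i) (.var v_j)) (.const 1))
    (forLoop v_l v_n (.ite
      (.sub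
        (.mul (.read a_num (entry (.var v_i) (.var v_l)))
          (.read a_den (entry (.var v_i) (.var v_j))))
        (.mul (.read a_num (entry (.var v_i) (.var v_j)))
          (.read a_den (entry (.var v_i) (.var v_l)))))
      (.store a_like (entry (.var v_i) (.var v_j)) (.const 0))
      .skip))))

/-- Positive if agent `i` likes item `j` and `j` is not sold yet. -/
def linked (i j : Expr) : Expr := .sub (.read a_like (entry i j)) (.read a_pb j)

/-- The item of the item copy `d`. -/
def itemOf : Expr := .div (.var v_d) (.var v_b)

/-- Remove all item copies from their owners (the mate `-1` means that there is none) and set their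
prices to `0`. -/
def clearMatching : Program :=
  forLoop v_d v_nb (.seq (.store a_mate (.var v_d) (.const (-1)))
    (.store a_price (.var v_d) (.const 0)))

/-- Find a cheapest item copy for the agent copy `cur`, if there is one of price less than
`nb`. -/
def scan : Program :=
  .seq (.assign v_best (.var v_nb)) (forLoop v_d v_nb
    (.ite (linked (.div (.var v_cur) (.var v_a)) itemOf)
      (.ite (.sub (.var v_best) (.read a_price (.var v_d)))
        (.seq (.assign v_best (.read a_price (.var v_d))) (.assign v_arg (.var v_d)))
        .skip)
      .skip))

/-- Turn to the next agent copy that had no turn so far. -/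
def nextCopy : Program :=
  .seq (.assign v_cur (.var v_nxt)) (.assign v_nxt (.add (.var v_nxt) (.const 1)))

/-- The agent copy `cur` takes the item copy that it has found and raises its price; the agent
copy that had it before becomes the current one. If the price would exceed `nb`, the auction is
broken off. -/
def bid : Program :=
  .ite (.sub (.var v_nb) (.var v_best))
    (.seq (.assign v_old (.read a_mate (.var v_arg)))
      (.seq (.store a_mate (.var v_arg) (.var v_cur))
        (.seq (.store a_price (.var v_arg) (.add (.var v_best) (.const 1)))
          (.ite (.add (.var v_old) (.const 1)) (.assign v_cur (.var v_old)) nextCopy))))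
    (.seq (.assign v_viol (.const 1)) (.assign v_cur (.var v_na)))

/-- The copies of agents that are already served are passed over. -/
def auctionStep : Program :=
  .ite (.read a_rb (.div (.var v_cur) (.var v_a))) nextCopy (.seq scan bid)

/-- Match the copies of the remaining agents with copies of items; `viol := 1` if this fails. -/
def auction : Program :=
  .seq clearMatching (.seq (.assign v_cur (.const 0)) (.seq (.assign v_nxt (.const 1))
    (.seq (.assign v_viol (.const 0))
      (.while (.sub (.var v_na) (.var v_cur)) auctionStep))))

/-- Find a number `lev ≤ nb` that is not a price. Equality of a price and `t` is tested by
`0 < 1 - (price - t) ^ 2`. -/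
def findLevel : Program :=
  .seq (.assign v_lev (.var v_nb)) (forLoop v_t v_nb
    (.seq (.assign v_flag (.const 1))
      (.seq
        (forLoop v_d v_nb (.ite
          (.sub (.const 1) (.mul (.sub (.read a_price (.var v_d)) (.var v_t))
            (.sub (.read a_price (.var v_d)) (.var v_t))))
          (.assign v_flag (.const 0)) .skip))
        (.ite (.var v_flag) (.assign v_lev (.var v_t)) .skip))))

/-- Compute the set `S` of the remaining agents all of whose links lead to prices above `lev`,
the number `cb` of its elements, and `cnb = n * cb`. -/
def findS : Program :=
  .seq (.assign v_cb (.const 0)) (.seq (.assign v_cnb (.const 0))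
    (forLoop v_i v_n
      (.seq (.ite (.read a_rb (.var v_i)) (.store a_S (.var v_i) (.const 0))
          (.store a_S (.var v_i) (.const 1)))
        (.seq
          (forLoop v_d v_nb (.ite (linked (.var v_i) itemOf)
            (.ite (.sub (.add (.var v_lev) (.const 1)) (.read a_price (.var v_d)))
              (.store a_S (.var v_i) (.const 0)) .skip)
            .skip))
          (.ite (.read a_S (.var v_i))
            (.seq (.assign v_cb (.add (.var v_cb) (.const 1)))
              (.assign v_cnb (.add (.var v_cnb) (.var v_n))))
            .skip)))))

/-- Compute the number `ca` of the items that the agents in `S` are linked to, and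
`cna = n * ca`. -/
def countNbr : Program :=
  .seq (.assign v_ca (.const 0)) (.seq (.assign v_cna (.const 0))
    (forLoop v_j v_n
      (.seq (.assign v_flag (.const 0))
        (.seq
          (forLoop v_i v_n (.ite (.read a_S (.var v_i))
            (.ite (linked (.var v_i) (.var v_j)) (.assign v_flag (.const 1)) .skip)
            .skip))
          (.ite (.var v_flag)
            (.seq (.assign v_ca (.add (.var v_ca) (.const 1)))
              (.assign v_cna (.add (.var v_cna) (.var v_n))))
            .skip)))))

/-- Make `ca / cb` the new share `a / b`. -/
def setShare : Program :=
  .seq (.assign v_a (.var v_ca)) (.seq (.assign v_b (.var v_cb))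
    (.seq (.assign v_na (.var v_cna)) (.assign v_nb (.var v_cnb))))

/-- The agent of the agent copy that is matched to the item copy `d`. -/
def agentOf : Expr := .div (.read a_mate (.var v_d)) (.var v_a)

/-- Hand out the item copy `d` if it is matched to an agent in `S`. -/
def handOutCopy : Program :=
  .ite (.add (.read a_mate (.var v_d)) (.const 1))
    (.ite (.read a_S agentOf)
      (.seq (.store a_W (entry agentOf itemOf)
          (.add (.read a_W (entry agentOf itemOf)) (.const 1)))
        (.seq (.store a_pa itemOf (.var v_a)) (.store a_pb itemOf (.var v_b))))
      .skip)
    .skip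

/-- Hand out the item copies that are matched to the agents in `S`. -/
def handOut : Program := forLoop v_d v_nb handOutCopy

/-- Remove `S` from the remaining agents, and let `S` be the set of all agents that remain. -/
def retire : Program :=
  forLoop v_i v_n (.ite (.read a_S (.var v_i))
    (.seq (.store a_ra (.var v_i) (.var v_a))
      (.seq (.store a_rb (.var v_i) (.var v_b))
        (.seq (.assign v_left (.sub (.var v_left) (.const 1)))
          (.store a_S (.var v_i) (.const 0)))))
    (.ite (.read a_rb (.var v_i)) .skip (.store a_S (.var v_i) (.const 1))))

/-- The share is `1 / 1` as long as Hall's condition is not known to fail. -/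
def resetShare : Program :=
  .seq (.assign v_a (.const 1)) (.seq (.assign v_b (.const 1))
    (.seq (.assign v_na (.var v_n)) (.assign v_nb (.var v_n))))

/-- Try to match the copies of the remaining agents. On failure, replace `S` by a set that violates
Hall's condition; on success, serve `S`. -/
def mainStep : Program :=
  .seq auction (.ite (.var v_viol)
    (.seq findLevel (.seq findS (.seq countNbr setShare)))
    (.seq handOut (.seq retire resetShare)))

def start : Program :=
  .seq (.assign v_left (.var v_n)) (.seq
    (forLoop v_i v_n (.store a_S (.var v_i) (.const 1))) resetShare)

/-- Serve all agents. -/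
def decompose : Program :=
  .seq findLikes (.seq start (.while (.var v_left) mainStep))

/-- Count the unsold items. -/
def countFree : Program :=
  .seq (.assign v_free (.const 0)) (forLoop v_j v_n
    (.ite (.read a_pb (.var v_j)) .skip
      (.assign v_free (.add (.var v_free) (.const 1)))))

/-- Sold items are divided as the copies are; of each of the `free` unsold items, agent `i` gets the
amount `(1 - ra i / rb i) / free`. -/
def writeAllocation : Program :=
  forLoop v_i v_n (forLoop v_j v_n (.ite (.read a_pb (.var v_j))
    (.seq (.store 2 (entry (.var v_i) (.var v_j))
        (.read a_W (entry (.var v_i) (.var v_j))))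
      (.store 3 (entry (.var v_i) (.var v_j)) (.read a_rb (.var v_i))))
    (.seq (.store 2 (entry (.var v_i) (.var v_j))
        (.sub (.read a_rb (.var v_i)) (.read a_ra (.var v_i))))
      (.store 3 (entry (.var v_i) (.var v_j))
        (.mul (.read a_rb (.var v_i)) (.var v_free))))))

/-- The prices of sold items that are above `1`; all other items are free. -/
def writePrices : Program :=
  forLoop v_j v_n (.ite (.sub (.read a_pb (.var v_j)) (.read a_pa (.var v_j)))
    (.seq (.store 4 (.var v_j) (.read a_pb (.var v_j)))
      (.store 5 (.var v_j) (.read a_pa (.var v_j))))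
    (.seq (.store 4 (.var v_j) (.const 0)) (.store 5 (.var v_j) (.const 1))))

/-- The payments `(n + 1 - p j) / n` for the prices `p j` of `writePrices`. -/
def writePayments : Program :=
  forLoop v_j v_n (.ite (.sub (.read a_pb (.var v_j)) (.read a_pa (.var v_j)))
    (.seq (.store 4 (.var v_j) (.sub
        (.mul (.add (.var v_n) (.const 1)) (.read a_pa (.var v_j))) (.read a_pb (.var v_j))))
      (.store 5 (.var v_j) (.mul (.var v_n) (.read a_pa (.var v_j)))))
    (.seq (.store 4 (.var v_j) (.add (.var v_n) (.const 1))) (.store 5 (.var v_j) (.var v_n))))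

def allocate : Program := .seq decompose (.seq countFree writeAllocation)

def priceProgram : Program := .seq allocate writePrices

def paymentProgram : Program := .seq allocate writePayments

theorem tame_priceProgram : priceProgram.tame = true := rfl

theorem tame_paymentProgram : paymentProgram.tame = true := rfl

end Prog

end RAM

namespace RAM

/-! ### Correctness of the auction -/

section Auction

theorem clearMatching_spec {s : State} {N : ℕ} (h : s.var v_nb = N) :
    Reach clearMatching s (N * 4 + 2) fun s' =>
      ∀ d : ℕ, d < N → s'.arr a_mate d = -1 ∧ s'.arr a_price d = 0 := by
  refine Reach.for_ N 2 (fun m s' => ∀ d : ℕ, d < m → s'.arr a_mate d = -1 ∧ s'.arr a_price d = 0)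
    (by decide) rfl rfl h (fun _ _ _ h => h) (by simp) ?_
  intro m hm s' _ hv ih
  refine Reach.out rfl le_rfl ?_
  intro d hd
  rcases eq_or_ne d m with rfl | hne
  · simp [Program.out, Expr.eval, hv]
  · simpa [Program.out, Expr.eval, hv, Function.update_apply, hne] using ih d (by omega)

/-- The expression `linked` decides the relation `E`. -/
def Decides (n : ℕ) (E : ℕ → ℕ → Prop) (s : State) : Prop :=
  ∀ i : ℕ, i < n → ∀ j : ℕ, j < n →
    (0 < s.arr a_like ((i : ℤ) * n + j) - s.arr a_pb j ↔ E i j)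

theorem Decides.congr {n : ℕ} {E : ℕ → ℕ → Prop} {s s' : State} (h : Decides n E s)
    (h₁ : s'.arr a_like = s.arr a_like) (h₂ : s'.arr a_pb = s.arr a_pb) : Decides n E s' := by
  unfold Decides
  rw [h₁, h₂]
  exact h

theorem eval_linked_pos {n b i d : ℕ} {E : ℕ → ℕ → Prop} {s : State} {e : Expr}
    (h : Decides n E s) (hn : s.var v_n = n) (hb : s.var v_b = b) (hd : s.var v_d = d)
    (he : e.eval s = i) (hi : i < n) (hdb : d < n * b) :
    0 < (linked e itemOf).eval s ↔ E i (d / b) := by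
  rw [← h i hi (d / b) (IsPriceMatching.div_lt hdb)]
  simp only [linked, entry, itemOf, Expr.eval, he, hn, hb, hd, Int.natCast_ediv]

/-- The parameters of the auction, and the current agent copy `k`. -/
structure Params (n a b k : ℕ) (s : State) : Prop where
  n_eq : s.var v_n = n
  a_eq : s.var v_a = a
  b_eq : s.var v_b = b
  nb_eq : s.var v_nb = (n * b : ℕ)
  cur_eq : s.var v_cur = k

/-- Either no item copy that the agent copy `k` is linked to is cheaper than `n * b`, or the
variable `arg` holds a cheapest one and `best` its price. -/
theorem scan_spec {n a b k : ℕ} {E : ℕ → ℕ → Prop} {s : State} (h : Params n a b k s)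
    (hE : Decides n E s) (hk : k / a < n) :
    Reach scan s (n * b * 8 + 3) fun s' =>
      (s'.var v_best = (n * b : ℕ) ∧
        ∀ d : ℕ, d < n * b → E (k / a) (d / b) → (n * b : ℕ) ≤ s'.arr a_price d) ∨
      ∃ d : ℕ, d < n * b ∧ s'.var v_arg = d ∧ E (k / a) (d / b) ∧
        s'.var v_best = s'.arr a_price d ∧ s'.arr a_price d < (n * b : ℕ) ∧
        ∀ d' : ℕ, d' < n * b → E (k / a) (d' / b) → s'.arr a_price d ≤ s'.arr a_price d' := by
  refine (Reach.seq (P := fun s' => s' = s.setVar v_best (n * b : ℕ)) (N₁ := 1)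
    (Reach.assign (by simp [Expr.eval, h.nb_eq])) ?_ (N₂ := n * b * 8 + 2)).mono (by omega)
    (fun _ _ h => h)
  rintro _ - rfl
  refine Reach.for_ (n * b) 6 (fun m s' => (s'.var v_best = (n * b : ℕ) ∧
        ∀ d : ℕ, d < m → E (k / a) (d / b) → (n * b : ℕ) ≤ s'.arr a_price d) ∨
      ∃ d : ℕ, d < m ∧ s'.var v_arg = d ∧ E (k / a) (d / b) ∧
        s'.var v_best = s'.arr a_price d ∧ s'.arr a_price d < (n * b : ℕ) ∧
        ∀ d' : ℕ, d' < m → E (k / a) (d' / b) → s'.arr a_price d ≤ s'.arr a_price d')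
    (by decide) rfl rfl h.nb_eq (fun _ _ _ h => h) (Or.inl (by simp)) ?_
  intro m hm s' hs hv ih
  have hlink := eval_linked_pos (hE.congr (hs.arr a_like rfl) (hs.arr a_pb rfl))
    ((hs.var v_n rfl).trans h.n_eq) ((hs.var v_b rfl).trans h.b_eq) hv (i := k / a)
    (e := .div (.var v_cur) (.var v_a))
    (by simp [Expr.eval, hs.var v_cur rfl, hs.var v_a rfl, h.cur_eq, h.a_eq]) hk hm
  have hstep : ∀ {d : ℕ}, d < m + 1 → d ≠ m → d < m := fun h h' => by omega
  refine Reach.out rfl le_rfl ?_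
  rw [Program.out]
  split
  · rename_i hpos
    have hEm := hlink.1 hpos
    simp only [Program.out, Expr.eval, hv]
    split
    · rename_i hlt
      right
      refine ⟨m, by omega, by simp [hv], hEm, by simp [hv], ?_, fun d' hd' hE' => ?_⟩
      · simp only [State.arr_setVar]
        rcases ih with ⟨hb, -⟩ | ⟨d, -, -, -, hb, hlt', -⟩ <;> omega
      · simp only [State.arr_setVar]
        rcases eq_or_ne d' m with rfl | hne
        · exact le_rfl
        · rcases ih with ⟨hb, hall⟩ | ⟨d, -, -, -, hb, -, hall⟩
          · have := hall d' (hstep hd' hne) hE'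
            omega
          · have := hall d' (hstep hd' hne) hE'
            omega
    · rename_i hge
      rcases ih with ⟨hb, hall⟩ | ⟨d, h1, h2, h3, h4, h5, hall⟩
      · refine Or.inl ⟨hb, fun d hd hEd => ?_⟩
        rcases eq_or_ne d m with rfl | hne
        · omega
        · exact hall d (hstep hd hne) hEd
      · refine Or.inr ⟨d, by omega, h2, h3, h4, h5, fun d' hd' hEd => ?_⟩
        rcases eq_or_ne d' m with rfl | hne
        · omega
        · exact hall d' (hstep hd' hne) hEd
  · rename_i hpos
    have hEm : ¬ E (k / a) (m / b) := fun hE => hpos (hlink.2 hE)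
    simp only [Program.out]
    rcases ih with ⟨hb, hall⟩ | ⟨d, h1, h2, h3, h4, h5, hall⟩
    · refine Or.inl ⟨hb, fun d hd hEd => ?_⟩
      rcases eq_or_ne d m with rfl | hne
      · exact absurd hEd hEm
      · exact hall d (hstep hd hne) hEd
    · refine Or.inr ⟨d, by omega, h2, h3, h4, h5, fun d' hd' hEd => ?_⟩
      rcases eq_or_ne d' m with rfl | hne
      · exact absurd hEd hEm
      · exact hall d' (hstep hd' hne) hEd

/-- The matching stored in the memory is a matching with prices. -/
abbrev StoresMatching (n a b : ℕ) (R : Finset ℕ) (E : ℕ → ℕ → Prop) (s : State) : Prop :=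
  IsPriceMatching n a b R E (fun d => s.arr a_mate d) (fun d => s.arr a_price d)

/-- The auction has been broken off: some agent copy `k` is unmatched, and no item copy that it is
linked to is cheaper than `n * b`. -/
def Blocked (n a b : ℕ) (R : Finset ℕ) (E : ℕ → ℕ → Prop) (s : State) : Prop :=
  s.var v_viol = 1 ∧ ∃ k : ℕ, k < n * a ∧ k / a ∈ R ∧
    (∀ d : ℕ, d < n * b → s.arr a_mate d ≠ k) ∧
    ∀ d : ℕ, d < n * b → E (k / a) (d / b) → (n * b : ℕ) ≤ s.arr a_price d

/-- The auction is going on: the agent copies below `t` except for the current one, `k`, have been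
matched as far as they belong to agents in `R`, and the others are unmatched. -/
def Running (n a b : ℕ) (R : Finset ℕ) (s : State) (k t : ℕ) : Prop :=
  s.var v_viol = 0 ∧ s.var v_cur = k ∧ s.var v_nxt = t ∧ k < t ∧
    (t ≤ n * a ∨ k = n * a ∧ t = n * a + 1) ∧
    (∀ d : ℕ, d < n * b → ∀ k' : ℕ, s.arr a_mate d = k' → k' < t) ∧
    (∀ d : ℕ, d < n * b → s.arr a_mate d ≠ k) ∧
    ∀ k' : ℕ, k' < t → k' < n * a → k' ≠ k → k' / a ∈ R →
      ∃ d : ℕ, d < n * b ∧ s.arr a_mate d = k'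

/-- The number of steps that the auction can still take: every bid increases a price, and prices
are bounded by `n * b`; other steps turn to a new agent copy or break off the auction. -/
def auctionMeasure (n a b : ℕ) (s : State) : ℕ :=
  (n * a + 2 - (s.var v_nxt).toNat) +
    ∑ d ∈ Finset.range (n * b), (n * b + 1 - (s.arr a_price d).toNat) + (1 - (s.var v_viol).toNat)

theorem auctionStep_spec {n a b : ℕ} {R : Finset ℕ} {E : ℕ → ℕ → Prop} {s : State}
    (hn : s.var v_n = n) (ha : s.var v_a = a) (hb : s.var v_b = b)
    (hna : s.var v_na = (n * a : ℕ)) (hnb : s.var v_nb = (n * b : ℕ)) (hE : Decides n E s)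
    (hrb : ∀ i : ℕ, i < n → (s.arr a_rb i ≤ 0 ↔ i ∈ R))
    (hm : StoresMatching n a b R E s)
    (hrun : Blocked n a b R E s ∧ s.var v_cur = (n * a : ℕ) ∨ ∃ k t, Running n a b R s k t)
    (hpos : 0 < (Expr.sub (.var v_na) (.var v_cur)).eval s) :
    Reach auctionStep s (n * b * 8 + 20) fun s' =>
      (StoresMatching n a b R E s' ∧ (Blocked n a b R E s' ∧ s'.var v_cur = (n * a : ℕ) ∨
        ∃ k t, Running n a b R s' k t)) ∧
      auctionMeasure n a b s' < auctionMeasure n a b s := by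
  simp only [Expr.eval, hna] at hpos
  obtain ⟨k, t, hviol, hcur, hnxt, hkt, ht, hfresh, hfree, hcov⟩ :=
    hrun.resolve_left fun h => by have := h.2; omega
  have hkn : k < n * a := by omega
  have htn : t ≤ n * a := by omega
  have hka : k / a < n := IsPriceMatching.div_lt hkn
  have hcura : (Expr.div (.var v_cur) (.var v_a)).eval s = (k / a : ℕ) := by
    simp [Expr.eval, hcur, ha]
  refine (Reach.ite (N := n * b * 8 + 19) (fun hpos => ?_) fun hpos => ?_).mono le_rfl
    fun _ _ h => h
  · have hkR : k / a ∉ R := by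
      rw [← hrb _ hka, not_le]
      simpa [Expr.eval, hcur, ha] using hpos
    refine Reach.out rfl (by simp [nextCopy, Program.size]) ?_
    simp only [nextCopy, Program.out, Expr.eval, hnxt]
    refine ⟨⟨hm, Or.inr ⟨t, t + 1, by simpa using hviol, by simp, by simp [hnxt], by omega, by omega,
      fun d hd k' hk' => (hfresh d hd k' hk').trans (by omega),
      fun d hd hdt => lt_irrefl t (hfresh d hd t hdt), fun k' h1 h2 h3 h4 => ?_⟩⟩, ?_⟩
    · rcases eq_or_ne k' k with rfl | hne
      · exact absurd h4 hkR
      · exact hcov k' (by omega) h2 hne h4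
    · simp only [auctionMeasure, State.var_setVar, State.arr_setVar]
      simp [hnxt, hviol]
      omega
  · have hkR : k / a ∈ R := by
      rw [← hrb _ hka]
      simpa [Expr.eval, hcur, ha] using hpos
    refine (Reach.seq (scan_spec ⟨hn, ha, hb, hnb, hcur⟩ hE hka) (N₂ := 16) ?_).mono
      (by omega) fun _ _ h => h
    intro s₁ hs₁ hscan
    have hmate : s₁.arr a_mate = s.arr a_mate := hs₁.arr _ rfl
    have hprice : s₁.arr a_price = s.arr a_price := hs₁.arr _ rfl
    have hviol₁ : s₁.var v_viol = 0 := (hs₁.var _ rfl).trans hviol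
    have hcur₁ : s₁.var v_cur = k := (hs₁.var _ rfl).trans hcur
    have hnxt₁ : s₁.var v_nxt = t := (hs₁.var _ rfl).trans hnxt
    have hnb₁ : s₁.var v_nb = (n * b : ℕ) := (hs₁.var _ rfl).trans hnb
    have hna₁ : s₁.var v_na = (n * a : ℕ) := (hs₁.var _ rfl).trans hna
    rw [hprice] at hscan
    refine Reach.out rfl (by decide) ?_
    rcases hscan with ⟨hbest, hall⟩ | ⟨d₀, hd₀, harg, hEd, hbest, hlt, hmin⟩
    · have hout : bid.out s₁ = (s₁.setVar v_viol 1).setVar v_cur (n * a : ℕ) := by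
        simp [bid, Program.out, Expr.eval, hbest, hnb₁, hna₁]
      rw [hout]
      refine ⟨⟨?_, Or.inl ⟨⟨by simp, k, hkn, hkR, ?_, ?_⟩, by simp⟩⟩, ?_⟩
      · simpa [StoresMatching, hmate, hprice] using hm
      · simpa [hmate] using hfree
      · simpa [hprice] using hall
      · simp [auctionMeasure, hnxt₁, hprice, hviol, hnxt]
    · obtain ⟨o, ho⟩ : ∃ o, s.arr a_mate d₀ = o := ⟨_, rfl⟩
      have hpd : 0 ≤ s.arr a_price d₀ := hm.price_nonneg d₀ hd₀
      -- The memory after the bid, before the next agent copy is chosen.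
      set s₂ : State := ((s₁.setVar v_old o).setArr a_mate d₀ k).setArr a_price d₀
        (s.arr a_price d₀ + 1) with hs₂
      have hout : bid.out s₁ = if 0 < o + 1 then s₂.setVar v_cur o else
          (s₂.setVar v_cur t).setVar v_nxt (t + 1) := by
        rw [bid, Program.out, if_pos (by simp only [Expr.eval, hbest, hnb₁]; omega)]
        simp [Program.out, Expr.eval, hbest, harg, hmate, ho, hcur₁, nextCopy, hnxt₁, hs₂]
      have hm₂ : ∀ d : ℕ, s₂.arr a_mate d = if d = d₀ then (k : ℤ) else s.arr a_mate d := by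
        intro d
        simp [hs₂, Function.update_apply, hmate]
      have hp₂ : ∀ d : ℕ, s₂.arr a_price d =
          if d = d₀ then s.arr a_price d₀ + 1 else s.arr a_price d := by
        intro d
        simp [hs₂, Function.update_apply, hprice]
      have hstore : StoresMatching n a b R E s₂ :=
        hm.update hkn hkR hEd (by exact_mod_cast hlt) hmin hfree hm₂ hp₂
      have hsum : ∑ d ∈ Finset.range (n * b), (n * b + 1 - (s₂.arr a_price d).toNat) <
          ∑ d ∈ Finset.range (n * b), (n * b + 1 - (s.arr a_price d).toNat) := by
        refine Finset.sum_lt_sum (fun d _ => ?_) ⟨d₀, Finset.mem_range.2 hd₀, ?_⟩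
        · rw [hp₂]
          split
          · rename_i hd
            rw [hd]
            omega
          · exact le_rfl
        · rw [hp₂, if_pos rfl]
          omega
      have hfresh₂ : ∀ d : ℕ, d < n * b → ∀ k' : ℕ, s₂.arr a_mate d = k' → k' < t := by
        intro d hd k' hk'
        rw [hm₂] at hk'
        split at hk'
        · omega
        · exact hfresh d hd k' hk'
      rw [hout]
      rcases hm.mate_eq d₀ hd₀ with hnone | ⟨k₁, hk₁, hk₁n, -⟩
      · have hov : o = -1 := ho.symm.trans hnone
        rw [if_neg (by omega)]
        refine ⟨⟨hstore, Or.inr ⟨t, t + 1, by simpa [hs₂] using hviol₁, by simp, by simp, by omega,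
          by omega, fun d hd k' hk' => (hfresh₂ d hd k' hk').trans (by omega),
          fun d hd hdt => lt_irrefl t (hfresh₂ d hd t hdt), fun k' h1 h2 h3 h4 => ?_⟩⟩, ?_⟩
        · rcases eq_or_ne k' k with rfl | hne
          · exact ⟨d₀, hd₀, by simpa using hm₂ d₀⟩
          · obtain ⟨d, hd, hdk⟩ := hcov k' (by omega) h2 hne h4
            refine ⟨d, hd, ?_⟩
            have : d ≠ d₀ := by
              rintro rfl
              rw [ho] at hdk
              omega
            exact (hm₂ d).trans (by rw [if_neg this, hdk])
        · have hv2 : s₂.var v_viol = s.var v_viol := by simp [hs₂, hviol, hviol₁]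
          simp only [auctionMeasure, State.var_setVar, State.arr_setVar]
          simp only [hv2, hnxt]
          norm_num
          omega
      · have hov : o = k₁ := ho.symm.trans hk₁
        rw [if_pos (by omega)]
        have hk₁t : k₁ < t := hfresh d₀ hd₀ k₁ hk₁
        refine ⟨⟨hstore, Or.inr ⟨k₁, t, by simpa [hs₂] using hviol₁, by simp [hov],
          by simpa [hs₂] using hnxt₁, hk₁t, by omega, hfresh₂, fun d hd hdk => ?_,
          fun k' h1 h2 h3 h4 => ?_⟩⟩, ?_⟩
        · have hdk' := (hm₂ d).symm.trans hdk
          split at hdk'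
          · exact hfree d₀ hd₀ (by omega)
          · rename_i hne
            exact hne (hm.inj d hd d₀ hd₀ (by omega) (by omega))
        · rcases eq_or_ne k' k with rfl | hne
          · exact ⟨d₀, hd₀, by simpa using hm₂ d₀⟩
          · obtain ⟨d, hd, hdk⟩ := hcov k' (by omega) h2 hne h4
            refine ⟨d, hd, ?_⟩
            have : d ≠ d₀ := by
              rintro rfl
              omega
            exact (hm₂ d).trans (by rw [if_neg this, hdk])
        · have hv2 : s₂.var v_viol = s.var v_viol := by simp [hs₂, hviol, hviol₁]
          have hv3 : s₂.var v_nxt = s.var v_nxt := by simp [hs₂, hnxt, hnxt₁]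
          simp only [auctionMeasure, State.var_setVar, State.arr_setVar]
          norm_num
          rw [hv2, hv3]
          omega

end Auction

end RAM

namespace RAM

section Auction

/-- A bound for the number of steps of an auction with at most `q` agent copies and `q` item copies.
The step bounds are stated over any commutative semiring, so that they can also be read as
polynomials. -/
def auctionBound {K : Type*} [CommSemiring K] (q : K) : K :=
  q * 4 + 6 + (q + 3 + q * (q + 1)) * (q * 8 + 21)

theorem auction_spec {n a b : ℕ} {R : Finset ℕ} {E : ℕ → ℕ → Prop} {s : State}
    (hn : s.var v_n = n) (ha : s.var v_a = a) (hb : s.var v_b = b)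
    (hna : s.var v_na = (n * a : ℕ)) (hnb : s.var v_nb = (n * b : ℕ)) (hE : Decides n E s)
    (hrb : ∀ i : ℕ, i < n → (s.arr a_rb i ≤ 0 ↔ i ∈ R)) (han : a ≤ n) (hbn : b ≤ n) :
    Reach auction s (auctionBound (n * n)) fun s' => StoresMatching n a b R E s' ∧
      (Blocked n a b R E s' ∨ s'.var v_viol = 0 ∧
        IsPriceMatching.Complete n a b R fun d => s'.arr a_mate d) := by
  refine Reach.mono (Reach.seq (clearMatching_spec hnb) (N₂ := 4 +
    (n * a + 3 + n * b * (n * b + 1)) * (n * b * 8 + 21)) ?_) ?_ fun _ _ h => h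
  swap
  · have h1 : n * a ≤ n * n := Nat.mul_le_mul_left n han
    have h2 : n * b ≤ n * n := Nat.mul_le_mul_left n hbn
    unfold auctionBound
    calc n * b * 4 + 2 + (4 + (n * a + 3 + n * b * (n * b + 1)) * (n * b * 8 + 21)) =
          n * b * 4 + 6 + (n * a + 3 + n * b * (n * b + 1)) * (n * b * 8 + 21) := by ring
      _ ≤ _ := by gcongr
  intro s₁ hs₁ hclear
  refine Reach.mono (Reach.seq (Reach.assign rfl) (N₂ := 3 + (n * a + 3 + n * b * (n * b + 1)) *
    (n * b * 8 + 21)) (P := fun s' => s' = s₁.setVar v_cur 0) ?_) (by omega) fun _ _ h => h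
  rintro _ - rfl
  refine Reach.mono (Reach.seq (Reach.assign rfl) (N₂ := 2 + (n * a + 3 + n * b * (n * b + 1)) *
    (n * b * 8 + 21)) (P := fun s' => s' = (s₁.setVar v_cur 0).setVar v_nxt 1) ?_)
    (by omega) fun _ _ h => h
  rintro _ - rfl
  refine Reach.mono (Reach.seq (Reach.assign rfl) (N₂ := 1 + (n * a + 3 + n * b * (n * b + 1)) *
    (n * b * 8 + 21)) (P := fun s' => s' = ((s₁.setVar v_cur 0).setVar v_nxt 1).setVar v_viol 0)
    ?_) (by omega) fun _ _ h => h
  rintro _ - rfl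
  set s₂ : State := ((s₁.setVar v_cur 0).setVar v_nxt 1).setVar v_viol 0 with hs₂
  have hmeasure : auctionMeasure n a b s₂ ≤ n * a + 3 + n * b * (n * b + 1) := by
    have : ∑ d ∈ Finset.range (n * b), (n * b + 1 - (s₂.arr a_price d).toNat) ≤
        ∑ d ∈ Finset.range (n * b), (n * b + 1) := Finset.sum_le_sum fun d _ => Nat.sub_le _ _
    simp only [Finset.sum_const, Finset.card_range, smul_eq_mul] at this
    unfold auctionMeasure
    omega
  refine Reach.mono (Reach.while_ (fun s' => StoresMatching n a b R E s' ∧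
    (Blocked n a b R E s' ∧ s'.var v_cur = (n * a : ℕ) ∨ ∃ k t, Running n a b R s' k t))
    (auctionMeasure n a b) (n * b * 8 + 20) ?_ ?_) ?_ ?_
  · rintro s' hs' ⟨hm, hrun⟩ hpos
    refine auctionStep_spec ?_ ?_ ?_ ?_ ?_ ?_ ?_ hm hrun hpos
    · exact (hs'.var v_n rfl).trans ((hs₁.var v_n rfl).trans hn)
    · exact (hs'.var v_a rfl).trans ((hs₁.var v_a rfl).trans ha)
    · exact (hs'.var v_b rfl).trans ((hs₁.var v_b rfl).trans hb)
    · exact (hs'.var v_na rfl).trans ((hs₁.var v_na rfl).trans hna)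
    · exact (hs'.var v_nb rfl).trans ((hs₁.var v_nb rfl).trans hnb)
    · exact hE.congr ((hs'.arr a_like rfl).trans (hs₁.arr a_like rfl))
        ((hs'.arr a_pb rfl).trans (hs₁.arr a_pb rfl))
    · intro i hi
      rw [hs'.arr a_rb rfl, hs₂]
      simp only [State.arr_setVar]
      rw [hs₁.arr a_rb rfl]
      exact hrb i hi
  · refine ⟨.empty R E (fun d hd => (hclear d hd).1) fun d hd => (hclear d hd).2,
      Or.inr ⟨0, 1, by simp [hs₂], by simp [hs₂], by simp [hs₂], one_pos, by omega,
      fun d hd k' hk' => ?_, fun d hd hd0 => ?_, fun k' h1 h2 h3 => by omega⟩⟩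
    · have := (hclear d hd).1.symm.trans hk'
      omega
    · have := (hclear d hd).1.symm.trans hd0
      omega
  · have := Nat.mul_le_mul_right (n * b * 8 + 21) hmeasure
    rw [add_comm]
    exact Nat.add_le_add_left this 1
  · rintro s' hs' ⟨⟨hm, hrun⟩, hle⟩
    refine ⟨hm, ?_⟩
    rcases hrun with ⟨hbl, -⟩ | ⟨k, t, hviol, hcur, hnxt, hkt, ht, hfresh, hfree, hcov⟩
    · exact Or.inl hbl
    · have hna' : s'.var v_na = (n * a : ℕ) :=
        (hs'.var v_na rfl).trans ((hs₁.var v_na rfl).trans hna)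
      simp only [Expr.eval, hna', hcur] at hle
      exact Or.inr ⟨hviol, fun k' hk' hk'R => hcov k' (by omega) hk' (by omega) hk'R⟩

end Auction

/-! ### Correctness of the search for a candidate -/

section Search

/-- One of the `N + 1` numbers up to `N` is not among the `N` prices. -/
theorem findLevel_spec {s : State} {N : ℕ} (hnb : s.var v_nb = N) :
    Reach findLevel s (N * (N * 5 + 8) + 3) fun s' =>
      ∃ t : ℕ, t ≤ N ∧ s'.var v_lev = t ∧ ∀ d : ℕ, d < N → s'.arr a_price d ≠ t := by
  refine Reach.mono (Reach.seq (Reach.assign (by simp [Expr.eval, hnb]))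
    (N₂ := N * (N * 5 + 6 + 2) + 2)
    (P := fun s' => s' = s.setVar v_lev N) ?_) (by ring_nf; omega) fun _ _ h => h
  rintro _ - rfl
  refine Reach.imp (Reach.for_ N (N * 5 + 6) (fun m s' =>
      (∃ t : ℕ, t < m ∧ s'.var v_lev = t ∧ ∀ d : ℕ, d < N → s'.arr a_price d ≠ t) ∨
      (s'.var v_lev = N ∧ ∀ t : ℕ, t < m → ∃ d : ℕ, d < N ∧ s'.arr a_price d = t))
    (by decide) rfl rfl hnb (fun _ _ _ h => h) (Or.inr (by simp)) ?_) ?_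
  · intro m hm s' hs hv ih
    refine Reach.mono (Reach.seq (Reach.assign rfl) (N₂ := N * 5 + 5)
      (P := fun s'' => s'' = s'.setVar v_flag 1) ?_) (by omega) fun _ _ h => h
    rintro _ - rfl
    refine Reach.mono (Reach.seq (N₂ := 3) (Reach.for_ N 3 (fun l s'' =>
      (s''.var v_flag = 1 ∧ ∀ d : ℕ, d < l → s''.arr a_price d ≠ m) ∨
      (s''.var v_flag = 0 ∧ ∃ d : ℕ, d < l ∧ s''.arr a_price d = m)) (by decide) rfl rfl
      (by simpa using (hs.var v_nb rfl).trans hnb) (fun _ _ _ h => h) (Or.inl (by simp)) ?_)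
      ?_) (by omega) fun _ _ h => h
    · intro l hl s₁ hs₁ hv₁ ih₁
      have ht : s₁.var v_t = m := (hs₁.var v_t rfl).trans hv
      refine Reach.out rfl (by decide) ?_
      rw [Program.out]
      have hiff : 0 < 1 - (s₁.arr a_price l - m) * (s₁.arr a_price l - m) ↔
          s₁.arr a_price l = m := by
        constructor
        · intro h
          by_contra hne
          have : s₁.arr a_price l - m ≠ 0 := sub_ne_zero.2 hne
          have := mul_self_pos.2 this
          omega
        · intro h
          simp [h]
      simp only [Expr.eval, hv₁, ht, hiff]
      split
      · rename_i heq
        exact Or.inr ⟨by simp [Program.out, Expr.eval], l, by omega, heq⟩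
      · rename_i hne
        simp only [Program.out]
        rcases ih₁ with ⟨h1, h2⟩ | ⟨h1, d, hd, h2⟩
        · refine Or.inl ⟨h1, fun d hd => ?_⟩
          rcases eq_or_ne d l with rfl | hdl
          · exact hne
          · exact h2 d (by omega)
        · exact Or.inr ⟨h1, d, by omega, h2⟩
    · intro s₁ hs₁ hflag
      have hlev : s₁.var v_lev = s'.var v_lev := hs₁.var v_lev rfl
      have hprice : s₁.arr a_price = s'.arr a_price := hs₁.arr a_price rfl
      have ht : s₁.var v_t = m := (hs₁.var v_t rfl).trans hv
      refine Reach.out rfl (by decide) ?_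
      rcases hflag with ⟨h1, h2⟩ | ⟨h1, d, hd, h2⟩
      · simp only [Program.out, Expr.eval, h1, ht]
        exact Or.inl ⟨m, by omega, by simp, h2⟩
      · simp only [Program.out, Expr.eval, h1, lt_irrefl, if_false, hlev, hprice]
        rcases ih with ⟨t, h3, h4⟩ | ⟨h3, h4⟩
        · exact Or.inl ⟨t, by omega, h4⟩
        · refine Or.inr ⟨h3, fun t ht' => ?_⟩
          rcases eq_or_ne t m with rfl | hne
          · exact ⟨d, hd, hprice ▸ h2⟩
          · exact h4 t (by omega)
  · rintro s' - (⟨t, h1, h2, h3⟩ | ⟨h1, h2⟩)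
    · exact ⟨t, h1.le, h2, h3⟩
    · -- All numbers below `N` are prices, hence all prices are below `N`.
      refine ⟨N, le_rfl, h1, fun d hd hdN => ?_⟩
      choose! f hf hf' using h2
      have hinj : Set.InjOn f (Finset.range N : Set ℕ) := by
        intro t ht t' ht' heq
        have h3 := hf' t (by simpa using ht)
        have h4 := hf' t' (by simpa using ht')
        rw [heq, h4] at h3
        exact_mod_cast h3.symm
      have himg : (Finset.range N).image f = Finset.range N := by
        refine Finset.eq_of_subset_of_card_le (fun d hd => ?_) ?_
        · obtain ⟨t, ht, rfl⟩ := Finset.mem_image.1 hd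
          exact Finset.mem_range.2 (hf t (Finset.mem_range.1 ht))
        · rw [Finset.card_image_of_injOn hinj]
      have hd' : d ∈ (Finset.range N).image f := by rw [himg]; exact Finset.mem_range.2 hd
      obtain ⟨t, ht, rfl⟩ := Finset.mem_image.1 hd'
      rw [Finset.mem_range] at ht
      have := hf' t ht
      omega

theorem card_filter_lt_succ (S : Finset ℕ) (m : ℕ) :
    (S.filter (· < m + 1)).card = (S.filter (· < m)).card + if m ∈ S then 1 else 0 := by
  split
  · rename_i hm
    rw [← Finset.card_insert_of_notMem (a := m) (s := S.filter (· < m)) (by simp)]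
    congr 1
    ext i
    simp only [Finset.mem_filter, Finset.mem_insert]
    constructor
    · rintro ⟨h1, h2⟩
      rcases eq_or_ne i m with h | h
      · exact Or.inl h
      · exact Or.inr ⟨h1, by omega⟩
    · rintro (rfl | ⟨h1, h2⟩)
      · exact ⟨hm, by omega⟩
      · exact ⟨h1, by omega⟩
  · rename_i hm
    rw [add_zero]
    congr 1
    refine Finset.filter_congr fun i hi => ?_
    have : i ≠ m := by
      rintro rfl
      exact hm hi
    omega

theorem filter_lt_eq_self {S : Finset ℕ} {n : ℕ} (h : S ⊆ Finset.range n) :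
    S.filter (· < n) = S :=
  Finset.filter_true_of_mem fun _ hi => Finset.mem_range.1 (h hi)

theorem findS_spec {n b t : ℕ} {R S : Finset ℕ} {E : ℕ → ℕ → Prop} {s : State}
    (hn : s.var v_n = n) (hb : s.var v_b = b) (hnb : s.var v_nb = (n * b : ℕ))
    (ht : s.var v_lev = t) (hE : Decides n E s)
    (hrb : ∀ i : ℕ, i < n → (s.arr a_rb i ≤ 0 ↔ i ∈ R)) (hR : R ⊆ Finset.range n)
    (hS : ∀ i, i ∈ S ↔ i ∈ R ∧ ∀ d < n * b, E i (d / b) → (t : ℤ) < s.arr a_price d) :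
    Reach findS s (n * (n * b * 7 + 13) + 4) fun s' =>
      (∀ i : ℕ, i < n → s'.arr a_S i = if i ∈ S then 1 else 0) ∧
        s'.var v_cb = S.card ∧ s'.var v_cnb = (n * S.card : ℕ) := by
  classical
  have hSn : S ⊆ Finset.range n := fun i hi => hR ((hS i).1 hi).1
  refine Reach.mono (Reach.seq (Reach.assign rfl) (N₂ := n * (n * b * 7 + 13) + 3)
    (P := fun s' => s' = s.setVar v_cb 0) ?_) (by omega) fun _ _ h => h
  rintro _ - rfl
  refine Reach.mono (Reach.seq (Reach.assign rfl) (N₂ := n * (n * b * 7 + 11 + 2) + 2)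
    (P := fun s' => s' = (s.setVar v_cb 0).setVar v_cnb 0) ?_) (by ring_nf; omega)
    fun _ _ h => h
  rintro _ - rfl
  refine Reach.imp (Reach.for_ n (n * b * 7 + 11) (fun m s' =>
      (∀ i : ℕ, i < m → s'.arr a_S i = if i ∈ S then 1 else 0) ∧
        s'.var v_cb = (S.filter (· < m)).card ∧ s'.var v_cnb = (n * (S.filter (· < m)).card : ℕ))
    (by decide) rfl rfl hn (fun _ _ _ h => h) (by simp) ?_) ?_
  · intro m hm s' hs hv ih
    have hn' : s'.var v_n = n := (hs.var v_n rfl).trans hn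
    have hb' : s'.var v_b = b := (hs.var v_b rfl).trans hb
    have hnb' : s'.var v_nb = (n * b : ℕ) := (hs.var v_nb rfl).trans hnb
    have ht' : s'.var v_lev = t := (hs.var v_lev rfl).trans ht
    have hE' : Decides n E s' := hE.congr (hs.arr a_like rfl) (hs.arr a_pb rfl)
    have hprice' : s'.arr a_price = s.arr a_price := hs.arr a_price rfl
    refine Reach.mono (Reach.seq (N₁ := 3) (N₂ := n * b * 7 + 8) (P := fun s₁ =>
      s₁ = s'.setArr a_S m (if m ∈ R then 1 else 0)) (Reach.out rfl (by decide) ?_) ?_)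
      (by omega) fun _ _ h => h
    · have : s'.arr a_rb m ≤ 0 ↔ m ∈ R := by
        rw [hs.arr a_rb rfl]
        exact hrb m hm
      simp only [Program.out, Expr.eval, hv]
      by_cases hmR : m ∈ R
      · rw [if_neg (not_lt.2 (this.2 hmR)), if_pos hmR]
      · rw [if_pos (not_le.1 fun h => hmR (this.1 h)), if_neg hmR]
    rintro _ - rfl
    refine Reach.mono (Reach.seq (N₂ := 4) (Reach.for_ (n * b) 5 (fun l s₁ =>
      (∀ i : ℕ, i < m → s₁.arr a_S i = if i ∈ S then 1 else 0) ∧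
      s₁.arr a_S m = if m ∈ R ∧ ∀ d < l, E m (d / b) → (t : ℤ) < s.arr a_price d then 1 else 0)
      (by decide) rfl rfl hnb' (fun _ _ _ h => h) ?_ ?_) ?_) (by ring_nf; omega)
      fun _ _ h => h
    · refine ⟨fun i hi => ?_, by simp⟩
      have : i ≠ m := by omega
      simpa [Function.update_apply, this] using ih.1 i hi
    · intro l hl s₁ hs₁ hv₁ ih₁
      have hi₁ : s₁.var v_i = m := (hs₁.var v_i rfl).trans hv
      have hlev₁ : s₁.var v_lev = t := (hs₁.var v_lev rfl).trans ht'
      have hprice₁ : s₁.arr a_price = s.arr a_price := (hs₁.arr a_price rfl).trans hprice'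
      have hlink := eval_linked_pos (e := .var v_i) (hE'.congr (hs₁.arr a_like rfl)
        (hs₁.arr a_pb rfl)) ((hs₁.var v_n rfl).trans hn') ((hs₁.var v_b rfl).trans hb') hv₁ hi₁
        hm hl
      refine Reach.out rfl (by decide) ?_
      have hsucc : (∀ d < l + 1, E m (d / b) → (t : ℤ) < s.arr a_price d) ↔
          (∀ d < l, E m (d / b) → (t : ℤ) < s.arr a_price d) ∧
            (E m (l / b) → (t : ℤ) < s.arr a_price l) := by
        constructor
        · exact fun h => ⟨fun d hd => h d (by omega), h l (by omega)⟩
        · rintro ⟨h1, h2⟩ d hd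
          rcases eq_or_ne d l with rfl | hne
          · exact h2
          · exact h1 d (by omega)
      simp only [hsucc]
      rw [Program.out]
      by_cases hEl : E m (l / b)
      · rw [if_pos (hlink.2 hEl)]
        simp only [Program.out, Expr.eval, hlev₁, hprice₁, hv₁, hi₁]
        by_cases hle : s.arr a_price l ≤ t
        · rw [if_pos (by omega)]
          refine ⟨fun i hi => ?_, ?_⟩
          · have : i ≠ m := by omega
            simpa [Function.update_apply, this] using ih₁.1 i hi
          · have : ¬ (m ∈ R ∧ (∀ d < l, E m (d / b) → (t : ℤ) < s.arr a_price d) ∧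
                (E m (l / b) → (t : ℤ) < s.arr a_price l)) := fun h => absurd (h.2.2 hEl) (by omega)
            rw [if_neg this]
            simp
        · rw [if_neg (by omega)]
          refine ⟨ih₁.1, ih₁.2.trans ?_⟩
          have h2 : E m (l / b) → (t : ℤ) < s.arr a_price l := fun _ => by omega
          exact if_congr ⟨fun h => ⟨h.1, h.2, h2⟩, fun h => ⟨h.1, h.2.1⟩⟩ rfl rfl
      · rw [if_neg fun h => hEl (hlink.1 h)]
        refine ⟨ih₁.1, ih₁.2.trans ?_⟩
        have h2 : E m (l / b) → (t : ℤ) < s.arr a_price l := fun h => absurd h hEl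
        exact if_congr ⟨fun h => ⟨h.1, h.2, h2⟩, fun h => ⟨h.1, h.2.1⟩⟩ rfl rfl
    · intro s₁ hs₁ h₁
      have hi₁ : s₁.var v_i = m := (hs₁.var v_i rfl).trans hv
      have hn₁ : s₁.var v_n = n := (hs₁.var v_n rfl).trans hn'
      have hcb₁ : s₁.var v_cb = (S.filter (· < m)).card := (hs₁.var v_cb rfl).trans ih.2.1
      have hcnb₁ : s₁.var v_cnb = (n * (S.filter (· < m)).card : ℕ) :=
        (hs₁.var v_cnb rfl).trans ih.2.2
      have hmS : s₁.arr a_S m = if m ∈ S then 1 else 0 := by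
        rw [h₁.2]
        simp only [hS]
      have hall : ∀ i : ℕ, i < m + 1 → s₁.arr a_S i = if i ∈ S then 1 else 0 := by
        intro i hi
        rcases eq_or_ne i m with rfl | hne
        · exact hmS
        · exact h₁.1 i (by omega)
      refine Reach.out rfl (by decide) ?_
      rw [card_filter_lt_succ]
      simp only [Program.out, Expr.eval, hi₁, hmS]
      by_cases hm' : m ∈ S
      · rw [if_pos (by simp [hm']), if_pos hm']
        refine ⟨hall, by simp [hcb₁], ?_⟩
        simp [hcnb₁, hn₁]
        ring
      · rw [if_neg (by simp [hm']), if_neg hm', add_zero]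
        exact ⟨hall, hcb₁, hcnb₁⟩
  · intro s' _ h
    rwa [filter_lt_eq_self hSn] at h

theorem countNbr_spec {n : ℕ} {S : Finset ℕ} {E : ℕ → ℕ → Prop} {s : State}
    (hn : s.var v_n = n) (hE : Decides n E s) (hSn : S ⊆ Finset.range n)
    (hS : ∀ i : ℕ, i < n → s.arr a_S i = if i ∈ S then 1 else 0) :
    Reach countNbr s (n * (n * 7 + 9) + 4) fun s' =>
      s'.var v_ca = (nbr n E S).card ∧ s'.var v_cna = (n * (nbr n E S).card : ℕ) := by
  classical
  refine Reach.mono (Reach.seq (Reach.assign rfl) (N₂ := n * (n * 7 + 9) + 3)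
    (P := fun s' => s' = s.setVar v_ca 0) ?_) (by omega) fun _ _ h => h
  rintro _ - rfl
  refine Reach.mono (Reach.seq (Reach.assign rfl) (N₂ := n * (n * 7 + 7 + 2) + 2)
    (P := fun s' => s' = (s.setVar v_ca 0).setVar v_cna 0) ?_) (by ring_nf; omega)
    fun _ _ h => h
  rintro _ - rfl
  refine Reach.imp (Reach.for_ n (n * 7 + 7) (fun m s' =>
      s'.var v_ca = ((nbr n E S).filter (· < m)).card ∧
        s'.var v_cna = (n * ((nbr n E S).filter (· < m)).card : ℕ))
    (by decide) rfl rfl hn (fun _ _ _ h => h) (by simp) ?_) ?_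
  · intro m hm s' hs hv ih
    have hn' : s'.var v_n = n := (hs.var v_n rfl).trans hn
    refine Reach.mono (Reach.seq (Reach.assign rfl) (N₂ := n * 7 + 6)
      (P := fun s'' => s'' = s'.setVar v_flag 0) ?_) (by omega) fun _ _ h => h
    rintro _ - rfl
    refine Reach.mono (Reach.seq (N₂ := 4) (Reach.for_ n 5 (fun l s₁ =>
      s₁.var v_flag = if ∃ i < l, i ∈ S ∧ E i m then 1 else 0) (by decide) rfl rfl
      hn' (fun _ _ _ h => h) (by simp) ?_) ?_) (by omega) fun _ _ h => h
    · intro l hl s₁ hs₁ hv₁ ih₁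
      have hn₁ : s₁.var v_n = n := (hs₁.var v_n rfl).trans hn'
      have hj₁ : s₁.var v_j = m := (hs₁.var v_j rfl).trans hv
      have hS₁ : s₁.arr a_S l = if l ∈ S then 1 else 0 := by
        rw [hs₁.arr a_S rfl]
        simp only [State.arr_setVar]
        rw [hs.arr a_S rfl]
        exact hS l hl
      have hlink : 0 < (linked (.var v_i) (.var v_j)).eval s₁ ↔ E l m := by
        rw [← (hE.congr ((hs₁.arr a_like rfl).trans (hs.arr a_like rfl))
          ((hs₁.arr a_pb rfl).trans (hs.arr a_pb rfl))) l hl m hm]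
        simp only [linked, entry, Expr.eval, hv₁, hn₁, hj₁]
      have hsucc : (∃ i < l + 1, i ∈ S ∧ E i m) ↔ (∃ i < l, i ∈ S ∧ E i m) ∨ l ∈ S ∧ E l m := by
        constructor
        · rintro ⟨i, hi, h⟩
          rcases eq_or_ne i l with rfl | hne
          · exact Or.inr h
          · exact Or.inl ⟨i, by omega, h⟩
        · rintro (⟨i, hi, h⟩ | h)
          · exact ⟨i, by omega, h⟩
          · exact ⟨l, by omega, h⟩
      refine Reach.out rfl (by decide) ?_
      simp only [hsucc]
      by_cases hlS : l ∈ S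
      · by_cases hEl : E l m
        · rw [Program.out, if_pos (by simp [Expr.eval, hv₁, hS₁, hlS]), Program.out,
            if_pos (hlink.2 hEl)]
          simp [Program.out, Expr.eval, hlS, hEl]
        · rw [Program.out, if_pos (by simp [Expr.eval, hv₁, hS₁, hlS]), Program.out,
            if_neg fun h => hEl (hlink.1 h)]
          simpa [Program.out, hEl] using ih₁
      · rw [Program.out, if_neg (by simp [Expr.eval, hv₁, hS₁, hlS])]
        simpa [Program.out, hlS] using ih₁
    · intro s₁ hs₁ h₁
      have hn₁ : s₁.var v_n = n := (hs₁.var v_n rfl).trans hn'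
      have hca₁ : s₁.var v_ca = ((nbr n E S).filter (· < m)).card :=
        (hs₁.var v_ca rfl).trans ih.1
      have hcna₁ : s₁.var v_cna = (n * ((nbr n E S).filter (· < m)).card : ℕ) :=
        (hs₁.var v_cna rfl).trans ih.2
      have hiff : (∃ i < n, i ∈ S ∧ E i m) ↔ m ∈ nbr n E S := by
        rw [mem_nbr]
        constructor
        · rintro ⟨i, -, h1, h2⟩
          exact ⟨hm, i, h1, h2⟩
        · rintro ⟨-, i, h1, h2⟩
          exact ⟨i, Finset.mem_range.1 (hSn h1), h1, h2⟩
      simp only [hiff] at h₁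
      refine Reach.out rfl (by decide) ?_
      rw [card_filter_lt_succ]
      simp only [Program.out, Expr.eval, h₁]
      by_cases hm' : m ∈ nbr n E S
      · rw [if_pos (by simp [hm']), if_pos hm']
        refine ⟨by simp [hca₁], ?_⟩
        simp [hcna₁, hn₁]
        ring
      · rw [if_neg (by simp [hm']), if_neg hm', add_zero]
        exact ⟨hca₁, hcna₁⟩
  · intro s' _ h
    rwa [filter_lt_eq_self IsPriceMatching.nbr_subset] at h

end Search

end RAM

namespace RAM

/-! ### Correctness of the main loop -/

section Main

open Finset

theorem entry_inj {n i j i' j' : ℕ} (hj : j < n) (hj' : j' < n) :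
    (i : ℤ) * n + j = (i' : ℤ) * n + j' ↔ i = i' ∧ j = j' := by
  constructor
  · intro h
    have h : i * n + j = i' * n + j' := by exact_mod_cast h
    have h1 : (i * n + j) % n = j := by rw [Nat.mul_add_mod', Nat.mod_eq_of_lt hj]
    have h2 : (i' * n + j') % n = j' := by rw [Nat.mul_add_mod', Nat.mod_eq_of_lt hj']
    have h3 : j = j' := by rw [← h1, ← h2, h]
    refine ⟨?_, h3⟩
    have h4 : i * n = i' * n := by omega
    exact Nat.eq_of_mul_eq_mul_right (by omega) h4
  · rintro ⟨rfl, rfl⟩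
    rfl

open scoped Classical in
theorem handOut_spec {n a b : ℕ} {R S : Finset ℕ} {E : ℕ → ℕ → Prop} {s : State}
    (hn : s.var v_n = n) (ha : s.var v_a = a) (hb : s.var v_b = b)
    (hnb : s.var v_nb = (n * b : ℕ)) (hm : StoresMatching n a b R E s)
    (hS : ∀ i : ℕ, i < n → s.arr a_S i = if i ∈ S then 1 else 0) :
    Reach handOut s (n * b * 9 + 2) fun s' =>
      (∀ j : ℕ, j < n → s'.arr a_pa j = if ∃ d ∈ matchedTo n a b (fun d => s.arr a_mate d) S,
        d / b = j then (a : ℤ) else s.arr a_pa j) ∧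
      (∀ j : ℕ, j < n → s'.arr a_pb j = if ∃ d ∈ matchedTo n a b (fun d => s.arr a_mate d) S,
        d / b = j then (b : ℤ) else s.arr a_pb j) ∧
      ∀ i : ℕ, i < n → ∀ j : ℕ, j < n → s'.arr a_W ((i : ℤ) * n + j) =
        s.arr a_W ((i : ℤ) * n + j) +
          IsPriceMatching.amount n a b (fun d => s.arr a_mate d) S i j := by
  let P : ℕ → Prop := fun d => ∃ k : ℕ, s.arr a_mate d = k ∧ k / a ∈ S
  let Q : ℕ → ℕ → ℕ → Prop := fun i j d =>
    ∃ k : ℕ, s.arr a_mate d = k ∧ k / a ∈ S ∧ k / a = i ∧ d / b = j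
  refine Reach.imp (Reach.for_ (n * b) 7 (fun m s' =>
      (∀ j : ℕ, j < n → s'.arr a_pa j = if ∃ d < m, P d ∧ d / b = j then (a : ℤ)
        else s.arr a_pa j) ∧
      (∀ j : ℕ, j < n → s'.arr a_pb j = if ∃ d < m, P d ∧ d / b = j then (b : ℤ)
        else s.arr a_pb j) ∧
      ∀ i : ℕ, i < n → ∀ j : ℕ, j < n → s'.arr a_W ((i : ℤ) * n + j) =
        s.arr a_W ((i : ℤ) * n + j) + (((range m).filter (Q i j)).card : ℤ))
    (by decide) rfl rfl hnb (fun _ _ _ h => h) (by simp) ?_) ?_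
  · intro m hm' s' hs hv ih
    have hmb : m / b < n := IsPriceMatching.div_lt hm'
    have hn' : s'.var v_n = n := (hs.var v_n rfl).trans hn
    have ha' : s'.var v_a = a := (hs.var v_a rfl).trans ha
    have hb' : s'.var v_b = b := (hs.var v_b rfl).trans hb
    have hmate' : s'.arr a_mate = s.arr a_mate := hs.arr a_mate rfl
    have hS' : s'.arr a_S = s.arr a_S := hs.arr a_S rfl
    have hP : ∀ j, (∃ d < m + 1, P d ∧ d / b = j) ↔ (∃ d < m, P d ∧ d / b = j) ∨
        P m ∧ m / b = j := by
      intro j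
      constructor
      · rintro ⟨d, hd, h⟩
        rcases eq_or_ne d m with rfl | hne
        · exact Or.inr h
        · exact Or.inl ⟨d, by omega, h⟩
      · rintro (⟨d, hd, h⟩ | h)
        · exact ⟨d, by omega, h⟩
        · exact ⟨m, by omega, h⟩
    have hQ : ∀ i j, ((range (m + 1)).filter (Q i j)).card =
        ((range m).filter (Q i j)).card + if Q i j m then 1 else 0 := by
      intro i j
      rw [range_add_one, filter_insert]
      split
      · rw [card_insert_of_notMem (by simp)]
      · rfl
    refine Reach.out rfl (by decide) ?_
    simp only [hP, hQ]
    by_cases hPm : P m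
    · obtain ⟨k, hk, hkS⟩ := hPm
      have hkn : k / a < n := IsPriceMatching.div_lt (hm.spec hm' hk).1
      have hPm : P m := ⟨k, hk, hkS⟩
      have hQm : ∀ i j, Q i j m ↔ i = k / a ∧ j = m / b := by
        intro i j
        constructor
        · rintro ⟨k', hk', -, h1, h2⟩
          have : k' = k := by omega
          subst this
          exact ⟨h1.symm, h2.symm⟩
        · rintro ⟨rfl, rfl⟩
          exact ⟨k, hk, hkS, rfl, rfl⟩
      have hagent : agentOf.eval s' = (k / a : ℕ) := by
        simp [agentOf, Expr.eval, hmate', hv, hk, ha']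
      have hitem : itemOf.eval s' = (m / b : ℕ) := by
        simp [itemOf, Expr.eval, hv, hb']
      have hent : (entry agentOf itemOf).eval s' = ((k / a : ℕ) : ℤ) * n + (m / b : ℕ) := by
        rw [entry, Expr.eval, Expr.eval, hagent, hitem, Expr.eval, hn']
      have hout : handOutCopy.out s' = ((s'.setArr a_W (((k / a : ℕ) : ℤ) * n + (m / b : ℕ))
          (s'.arr a_W (((k / a : ℕ) : ℤ) * n + (m / b : ℕ)) + 1)).setArr a_pa (m / b : ℕ) a).setArr
          a_pb (m / b : ℕ) b := by
        have h1 : 0 < (Expr.add (.read a_mate (.var v_d)) (.const 1)).eval s' := by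
          simp only [Expr.eval, hv, hmate', hk]
          omega
        have h2 : 0 < (Expr.read a_S agentOf).eval s' := by
          rw [Expr.eval, hagent, hS', hS _ hkn, if_pos hkS]
          exact one_pos
        rw [handOutCopy, Program.out, if_pos h1, Program.out, if_pos h2]
        change ((s'.setArr a_W ((entry agentOf itemOf).eval s')
          (s'.arr a_W ((entry agentOf itemOf).eval s') + 1)).setArr a_pa (itemOf.eval s')
          (s'.var v_a)).setArr a_pb (itemOf.eval s') (s'.var v_b) = _
        rw [hent, hitem, ha', hb']
      rw [hout]
      refine ⟨fun j hj => ?_, fun j hj => ?_, fun i hi j hj => ?_⟩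
      · by_cases hjm : m / b = j
        · rw [if_pos (Or.inr ⟨hPm, hjm⟩)]
          simp [hjm]
        · have hjm' : (j : ℤ) ≠ (m : ℤ) / b := by
            rw [← Int.natCast_ediv]
            omega
          simpa [Function.update_apply, hjm, hjm'] using ih.1 j hj
      · by_cases hjm : m / b = j
        · rw [if_pos (Or.inr ⟨hPm, hjm⟩)]
          simp [hjm]
        · have hjm' : (j : ℤ) ≠ (m : ℤ) / b := by
            rw [← Int.natCast_ediv]
            omega
          simpa [Function.update_apply, hjm, hjm'] using ih.2.1 j hj
      · have hW : (((s'.setArr a_W (((k / a : ℕ) : ℤ) * n + (m / b : ℕ))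
            (s'.arr a_W (((k / a : ℕ) : ℤ) * n + (m / b : ℕ)) + 1)).setArr a_pa
            (m / b : ℕ) a).setArr a_pb (m / b : ℕ) b).arr a_W =
            Function.update (s'.arr a_W) (((k / a : ℕ) : ℤ) * n + (m / b : ℕ))
              (s'.arr a_W (((k / a : ℕ) : ℤ) * n + (m / b : ℕ)) + 1) := by
          rw [State.arr_setArr, if_neg (by decide), State.arr_setArr, if_neg (by decide),
            State.arr_setArr, if_pos rfl]
        rw [hW, Function.update_apply]
        simp only [entry_inj hj hmb, hQm]
        split
        · rename_i h
          obtain ⟨rfl, rfl⟩ := h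
          rw [ih.2.2 _ hi _ hj]
          push_cast
          ring
        · rw [ih.2.2 _ hi _ hj, add_zero]
    · have hQm : ∀ i j, ¬ Q i j m := fun i j ⟨k, hk, hkS, _⟩ => hPm ⟨k, hk, hkS⟩
      have hout : handOutCopy.out s' = s' := by
        rw [handOutCopy, Program.out]
        split
        · rw [Program.out]
          split
          · rename_i h1 h2
            exfalso
            simp only [Expr.eval, hv, hmate'] at h1
            rcases hm.mate_eq m hm' with hnone | ⟨k, hk, hkn, -⟩
            · omega
            · have hk' : s.arr a_mate m = k := hk
              have hagent : agentOf.eval s' = (k / a : ℕ) := by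
                simp [agentOf, Expr.eval, hmate', hv, hk', ha']
              rw [Expr.eval, hagent, hS', hS _ (IsPriceMatching.div_lt hkn)] at h2
              by_cases hkS : k / a ∈ S
              · exact hPm ⟨k, hk, hkS⟩
              · simp [hkS] at h2
          · rfl
        · rfl
      rw [hout]
      simpa [hPm, hQm] using ih
  · rintro s' - ⟨h1, h2, h3⟩
    have hiff : ∀ j, (∃ d < n * b, P d ∧ d / b = j) ↔
        ∃ d ∈ matchedTo n a b (fun d => s.arr a_mate d) S, d / b = j := by
      intro j
      simp only [mem_matchedTo, P]
      constructor
      · rintro ⟨d, hd, hk, hj⟩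
        exact ⟨d, ⟨hd, hk⟩, hj⟩
      · rintro ⟨d, ⟨hd, hk⟩, hj⟩
        exact ⟨d, hd, hk, hj⟩
    simp only [hiff] at h1 h2
    exact ⟨h1, h2, h3⟩

theorem retire_spec {n a b : ℕ} {R S : Finset ℕ} {s : State}
    (hn : s.var v_n = n) (ha : s.var v_a = a) (hb : s.var v_b = b)
    (hleft : s.var v_left = R.card) (hrb : ∀ i : ℕ, i < n → (s.arr a_rb i ≤ 0 ↔ i ∈ R))
    (hR : R ⊆ range n) (hSR : S ⊆ R)
    (hS : ∀ i : ℕ, i < n → s.arr a_S i = if i ∈ S then 1 else 0) :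
    Reach retire s (n * 10 + 2) fun s' =>
      (∀ i : ℕ, i < n → s'.arr a_ra i = if i ∈ S then (a : ℤ) else s.arr a_ra i) ∧
      (∀ i : ℕ, i < n → s'.arr a_rb i = if i ∈ S then (b : ℤ) else s.arr a_rb i) ∧
      (∀ i : ℕ, i < n → s'.arr a_S i = if i ∈ R \ S then 1 else 0) ∧
      s'.var v_left = (R \ S).card := by
  refine Reach.imp (Reach.for_ n 8 (fun m s' =>
      (∀ i : ℕ, i < n → s'.arr a_ra i = if i ∈ S ∧ i < m then (a : ℤ) else s.arr a_ra i) ∧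
      (∀ i : ℕ, i < n → s'.arr a_rb i = if i ∈ S ∧ i < m then (b : ℤ) else s.arr a_rb i) ∧
      (∀ i : ℕ, i < n → s'.arr a_S i = if i < m then if i ∈ R \ S then 1 else 0
        else s.arr a_S i) ∧
      s'.var v_left = (R.card : ℤ) - (S.filter (· < m)).card)
    (by decide) rfl rfl hn (fun _ _ _ h => h) (by simp [hleft]) ?_) ?_
  · intro m hm s' hs hv ⟨h1, h2, h3, h4⟩
    have ha' : s'.var v_a = a := (hs.var v_a rfl).trans ha
    have hb' : s'.var v_b = b := (hs.var v_b rfl).trans hb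
    have hSm : s'.arr a_S m = if m ∈ S then 1 else 0 := by
      rw [h3 m hm, if_neg (lt_irrefl _), hS m hm]
    have hlt : ∀ i, i ≠ m → (i < m + 1 ↔ i < m) := fun i hi => by omega
    refine Reach.out rfl (by decide) ?_
    rw [card_filter_lt_succ]
    by_cases hmS : m ∈ S
    · rw [Program.out, if_pos (by simp [Expr.eval, hv, hSm, hmS])]
      simp only [Program.out, Expr.eval]
      refine ⟨fun i hi => ?_, fun i hi => ?_, fun i hi => ?_, ?_⟩
      · rcases eq_or_ne i m with rfl | hne
        · simp [hv, hmS, ha']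
        · simpa [Function.update_apply, hv, hne, hlt i hne] using h1 i hi
      · rcases eq_or_ne i m with rfl | hne
        · simp [hv, hmS, hb']
        · simpa [Function.update_apply, hv, hne, hlt i hne] using h2 i hi
      · rcases eq_or_ne i m with rfl | hne
        · simp [hv, hmS]
        · simpa [Function.update_apply, hv, hne, hlt i hne] using h3 i hi
      · simp [h4, hmS]
        ring
    · have hrbm : s'.arr a_rb m ≤ 0 ↔ m ∈ R := by
        rw [h2 m hm, if_neg (fun h => hmS h.1)]
        exact hrb m hm
      have hout : ∀ i, (i ∈ S ∧ i < m + 1) ↔ (i ∈ S ∧ i < m) := by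
        intro i
        constructor
        · rintro ⟨h, h'⟩
          have : i ≠ m := by
            rintro rfl
            exact hmS h
          exact ⟨h, by omega⟩
        · rintro ⟨h, h'⟩
          exact ⟨h, by omega⟩
      rw [Program.out, if_neg (by simp [Expr.eval, hv, hSm, hmS]), Program.out]
      simp only [hout, hmS, if_false, add_zero]
      split
      · rename_i hpos
        have hmR : m ∉ R := fun h => by
          have := hrbm.2 h
          simp only [Expr.eval, hv] at hpos
          omega
        refine ⟨h1, h2, fun i hi => ?_, h4⟩
        rw [Program.out]
        rcases eq_or_ne i m with rfl | hne
        · rw [hSm]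
          simp [hmS, hmR]
        · simpa [hlt i hne] using h3 i hi
      · rename_i hpos
        have hmR : m ∈ R := hrbm.1 (by simpa [Expr.eval, hv] using hpos)
        refine ⟨h1, h2, fun i hi => ?_, h4⟩
        simp only [Program.out, Expr.eval, hv]
        rcases eq_or_ne i m with rfl | hne
        · simp [hmS, hmR]
        · simpa [Function.update_apply, hne, hlt i hne] using h3 i hi
  · rintro s' - ⟨h1, h2, h3, h4⟩
    have hSn : ∀ i, (i ∈ S ∧ i < n) ↔ i ∈ S := fun i =>
      ⟨And.left, fun h => ⟨h, mem_range.1 (hR (hSR h))⟩⟩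
    simp only [hSn] at h1 h2
    refine ⟨h1, h2, fun i hi => by rw [h3 i hi, if_pos hi], ?_⟩
    rw [h4, filter_lt_eq_self (hSR.trans hR), card_sdiff_of_subset hSR,
      Nat.cast_sub (card_le_card hSR)]

open scoped Classical in
/-- The invariant of the main loop: the agents in `R` remain, those in `S ⊆ R` are the candidates
for the share `a / b`, and the shares handed out so far are at most `la / lb`. When no agent remains,
there is no candidate. -/
structure Invariant (n : ℕ) (D : ℕ → ℕ → Prop) (a b la lb : ℕ) (R S : Finset ℕ) (s : State) :
    Prop where
  n_eq : s.var v_n = n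
  a_eq : s.var v_a = a
  b_eq : s.var v_b = b
  na_eq : s.var v_na = (n * a : ℕ)
  nb_eq : s.var v_nb = (n * b : ℕ)
  left_eq : s.var v_left = R.card
  like_eq : ∀ i : ℕ, i < n → ∀ j : ℕ, j < n →
    s.arr a_like ((i : ℤ) * n + j) = if D i j then 1 else 0
  S_eq : ∀ i : ℕ, i < n → s.arr a_S i = if i ∈ S then 1 else 0
  outcome : PartialOutcome n D (fun i => s.arr a_ra i) (fun i => s.arr a_rb i)
    (fun j => s.arr a_pa j) (fun j => s.arr a_pb j) (fun i j => s.arr a_W ((i : ℤ) * n + j)) R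
    (fun i j => D i j ∧ s.arr a_pb j = 0) la lb
  candidate : R.Nonempty → IsPriceMatching.Candidate n R (fun i j => D i j ∧ s.arr a_pb j = 0) S a b

/-- The number of fractions `x / y` with `x, y ≤ n` below `a / b`. -/
def fractionsBelow (n : ℕ) (a b : ℤ) : ℕ :=
  ((range (n + 1) ×ˢ range (n + 1)).filter fun z => (z.1 : ℤ) * b < a * z.2).card

theorem fractionsBelow_le (n : ℕ) (a b : ℤ) : fractionsBelow n a b ≤ (n + 1) ^ 2 := by
  refine (card_filter_le _ _).trans ?_
  rw [card_product, card_range, sq]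

theorem fractionsBelow_lt {n a b a' b' : ℕ} (ha' : a' ≤ n) (hb' : b' ≤ n)
    (hlt : a' * b < a * b') : fractionsBelow n a' b' < fractionsBelow n a b := by
  refine card_lt_card ((ssubset_iff_of_subset ?_).2 ⟨(a', b'), ?_, ?_⟩)
  · intro ⟨x, y⟩ hz
    rw [mem_filter] at hz ⊢
    refine ⟨hz.1, ?_⟩
    have h1 : x * b' < a' * y := by exact_mod_cast hz.2
    have h2 : x * b * b' < a * y * b' := by
      have hy : 0 < y := by
        by_contra h0
        have : y = 0 := by omega
        simp [this] at h1
      rcases Nat.eq_zero_or_pos b with rfl | hb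
      · nlinarith
      · nlinarith [Nat.mul_lt_mul_of_pos_right h1 hb, Nat.mul_lt_mul_of_pos_right hlt hy]
    exact_mod_cast Nat.lt_of_mul_lt_mul_right h2
  · rw [mem_filter, mem_product, mem_range, mem_range]
    exact ⟨⟨by simpa using Nat.lt_succ_of_le ha', by simpa using Nat.lt_succ_of_le hb'⟩,
      by exact_mod_cast hlt⟩
  · simp

/-- A round of the main loop either serves an agent, or it replaces the share `a / b` by a smaller
one; the measure decreases lexicographically. -/
def mainMeasure (n : ℕ) (s : State) : ℕ :=
  (s.var v_left).toNat * ((n + 1) ^ 2 + 1) + fractionsBelow n (s.var v_a) (s.var v_b)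

/-- A bound for the number of steps of one round. -/
def mainStepBound {K : Type*} [CommSemiring K] (n : K) : K :=
  auctionBound (n * n) + 1 + ((n * n * (n * n * 5 + 8) + 3) + ((n * (n * n * 7 + 13) + 4) +
    ((n * (n * 7 + 9) + 4) + 4))) + ((n * n * 9 + 2) + ((n * 10 + 2) + 4))

namespace Invariant

variable {n : ℕ} {D : ℕ → ℕ → Prop} {a b la lb : ℕ} {R S : Finset ℕ} {s : State}

theorem decides (h : Invariant n D a b la lb R S s) :
    Decides n (fun i j => D i j ∧ s.arr a_pb j = 0) s := by
  intro i hi j hj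
  have h1 : 0 ≤ s.arr a_pb j := by
    by_contra hlt
    have := h.outcome.sold j hj (by omega)
    omega
  rw [h.like_eq i hi j hj]
  by_cases hD : D i j <;> simp only [hD, if_true, if_false, true_and, false_and, iff_false] <;>
    omega

theorem rb_nonpos_iff (h : Invariant n D a b la lb R S s) (i : ℕ) (hi : i < n) :
    s.arr a_rb i ≤ 0 ↔ i ∈ R := by
  rw [h.outcome.mem_remaining]
  refine ⟨fun hle => ⟨hi, ?_⟩, fun h0 => h0.2.le⟩
  by_contra h0
  have := h.outcome.served i hi h0
  omega

/-- After a failed auction, there is a candidate with a smaller share. -/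
theorem search_spec (h : Invariant n D a b la lb R S s) (hne : R.Nonempty)
    (hm : StoresMatching n a b R (fun i j => D i j ∧ s.arr a_pb j = 0) s)
    (hbl : Blocked n a b R (fun i j => D i j ∧ s.arr a_pb j = 0) s) :
    Reach (.seq findLevel (.seq findS (.seq countNbr setShare))) s
      ((n * n * (n * n * 5 + 8) + 3) + ((n * (n * n * 7 + 13) + 4) + ((n * (n * 7 + 9) + 4) + 4)))
      fun s' => ∃ a' b' S', Invariant n D a' b' la lb R S' s' ∧
        mainMeasure n s' < mainMeasure n s := by
  classical
  have hcand := h.candidate hne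
  have hbn : b ≤ n := hcand.2.2.2.1
  have ha : 0 < a := hcand.2.2.1
  have hab : a ≤ b := by
    rcases hcand.2.2.2.2 with ⟨rfl, rfl, -⟩ | ⟨hab, -⟩ <;> omega
  have hRn := h.outcome.subset_range
  have hnb : n * b ≤ n * n := Nat.mul_le_mul_left n hbn
  refine Reach.seq (P := fun s' => ∃ t : ℕ, t ≤ n * b ∧ s'.var v_lev = t ∧
    ∀ d : ℕ, d < n * b → s'.arr a_price d ≠ t)
    (Reach.mono (findLevel_spec h.nb_eq) (by gcongr) fun _ _ h => h) ?_
  rintro s₁ hs₁ ⟨t, htn, ht, hempty⟩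
  have hprice₁ : s₁.arr a_price = s.arr a_price := hs₁.arr _ rfl
  rw [hprice₁] at hempty
  obtain ⟨S', hS'mem⟩ : ∃ S' : Finset ℕ, ∀ i, i ∈ S' ↔ i ∈ R ∧ ∀ d < n * b,
      (D i (d / b) ∧ s.arr a_pb (d / b : ℕ) = 0) → (t : ℤ) < s.arr a_price d :=
    ⟨R.filter fun i => ∀ d < n * b, (D i (d / b) ∧ s.arr a_pb (d / b : ℕ) = 0) →
      (t : ℤ) < s.arr a_price d, fun i => mem_filter⟩
  have hS'R : S' ⊆ R := fun i hi => ((hS'mem i).1 hi).1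
  have hviolator : S'.Nonempty ∧
      b * (nbr n (fun i j => D i j ∧ s.arr a_pb j = 0) S').card < a * S'.card := by
    obtain ⟨-, k, hk, hkR, hfree, hmin⟩ := hbl
    have hup : ∀ d < n * b, (D (k / a) (d / b) ∧ s.arr a_pb (d / b : ℕ) = 0) →
        (t : ℤ) < s.arr a_price d := fun d hd hE => by
      have h1 := hmin d hd hE
      have h2 := hempty d hd
      omega
    obtain ⟨h1, h2⟩ := hm.violator ha (by omega) hRn hk hkR hfree (by omega) hup hempty hS'mem
    exact ⟨⟨_, h1⟩, h2⟩
  have hcand' := h.outcome.candidate hcand hS'R hviolator.1 hviolator.2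
  refine Reach.seq (P := fun s' => (∀ i : ℕ, i < n → s'.arr a_S i = if i ∈ S' then 1 else 0) ∧
      s'.var v_cb = S'.card ∧ s'.var v_cnb = (n * S'.card : ℕ))
    (Reach.mono (findS_spec ((hs₁.var _ rfl).trans h.n_eq) ((hs₁.var _ rfl).trans h.b_eq)
      ((hs₁.var _ rfl).trans h.nb_eq) ht (h.decides.congr (hs₁.arr _ rfl) (hs₁.arr _ rfl))
      (fun i hi => by rw [hs₁.arr a_rb rfl]; exact h.rb_nonpos_iff i hi) hRn
      (by rw [hprice₁]; exact hS'mem)) (by gcongr) fun _ _ h => h) ?_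
  rintro s₂ hs₂ ⟨hS₂, hcb₂, hcnb₂⟩
  refine Reach.seq (countNbr_spec ((hs₂.var _ rfl).trans ((hs₁.var _ rfl).trans h.n_eq))
    (h.decides.congr ((hs₂.arr _ rfl).trans (hs₁.arr _ rfl))
      ((hs₂.arr _ rfl).trans (hs₁.arr _ rfl))) (hS'R.trans hRn) hS₂) ?_
  rintro s₃ hs₃ ⟨hca₃, hcna₃⟩
  have hvar : ∀ k, findLevel.writesVar k = false → findS.writesVar k = false →
      countNbr.writesVar k = false → s₃.var k = s.var k := fun k h1 h2 h3 =>
    (hs₃.var k h3).trans ((hs₂.var k h2).trans (hs₁.var k h1))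
  have harr : ∀ k, findLevel.writesArr k = false → findS.writesArr k = false →
      countNbr.writesArr k = false → s₃.arr k = s.arr k := fun k h1 h2 h3 =>
    (hs₃.arr k h3).trans ((hs₂.arr k h2).trans (hs₁.arr k h1))
  have hcb₃ := (hs₃.var v_cb rfl).trans hcb₂
  have hcnb₃ := (hs₃.var v_cnb rfl).trans hcnb₂
  refine Reach.out rfl (by decide) ?_
  have hn₃ := (hvar v_n rfl rfl rfl).trans h.n_eq
  have hleft₃ := (hvar v_left rfl rfl rfl).trans h.left_eq
  refine ⟨(nbr n (fun i j => D i j ∧ s.arr a_pb j = 0) S').card, S'.card, S',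
    ⟨?_, ?_, ?_, ?_, ?_, ?_, ?_, ?_, ?_, ?_⟩, ?_⟩
  · simpa [setShare, Program.out] using hn₃
  · simpa [setShare, Program.out, Expr.eval] using hca₃
  · simpa [setShare, Program.out, Expr.eval] using hcb₃
  · simpa [setShare, Program.out, Expr.eval] using hcna₃
  · simpa [setShare, Program.out, Expr.eval] using hcnb₃
  · simpa [setShare, Program.out] using hleft₃
  · simpa only [setShare, Program.out, State.arr_setVar, harr a_like rfl rfl rfl] using h.like_eq
  · simpa only [setShare, Program.out, State.arr_setVar, hs₃.arr a_S rfl] using hS₂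
  · simpa only [setShare, Program.out, State.arr_setVar, harr a_ra rfl rfl rfl,
      harr a_rb rfl rfl rfl, harr a_pa rfl rfl rfl, harr a_pb rfl rfl rfl,
      harr a_W rfl rfl rfl] using h.outcome
  · intro _
    simpa only [setShare, Program.out, State.arr_setVar, harr a_pb rfl rfl rfl] using hcand'
  · have hlt := fractionsBelow_lt (a := a) (b := b) (by
      simpa using card_le_card (IsPriceMatching.nbr_subset (n := n)
        (E := fun i j => D i j ∧ s.arr a_pb j = 0) (S := S'))) hcand'.2.2.2.1
      (by rw [mul_comm]; exact hviolator.2)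
    simp only [mainMeasure, setShare, Program.out, Expr.eval, State.var_setVar]
    simp [hleft₃, h.left_eq, h.a_eq, h.b_eq, hca₃, hcb₃]
    exact hlt

/-- After a successful auction, `S` is served, and the agents that are left are the next
candidate. -/
theorem serve_spec (h : Invariant n D a b la lb R S s) (hne : R.Nonempty)
    (hm : StoresMatching n a b R (fun i j => D i j ∧ s.arr a_pb j = 0) s)
    (hc : IsPriceMatching.Complete n a b R fun d => s.arr a_mate d) :
    Reach (.seq handOut (.seq retire resetShare)) s
      ((n * n * 9 + 2) + ((n * 10 + 2) + 4))
      fun s' => ∃ a' b' la' lb' R' S', Invariant n D a' b' la' lb' R' S' s' ∧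
        mainMeasure n s' < mainMeasure n s := by
  classical
  have hcand := h.candidate hne
  have hRn := h.outcome.subset_range
  have hSR := hcand.1
  have hn0 : 0 < n := by
    obtain ⟨i, hi⟩ := hne
    exact (Nat.zero_le i).trans_lt (mem_range.1 (hRn hi))
  have hnb : n * b ≤ n * n := Nat.mul_le_mul_left n hcand.2.2.2.1
  refine Reach.seq (Reach.mono (handOut_spec h.n_eq h.a_eq h.b_eq h.nb_eq hm h.S_eq) (by gcongr)
    fun _ _ h => h) ?_
  rintro s₁ hs₁ ⟨hpa₁, hpb₁, hW₁⟩
  refine Reach.seq (retire_spec ((hs₁.var _ rfl).trans h.n_eq) ((hs₁.var _ rfl).trans h.a_eq)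
    ((hs₁.var _ rfl).trans h.b_eq) ((hs₁.var _ rfl).trans h.left_eq)
    (fun i hi => by rw [hs₁.arr a_rb rfl]; exact h.rb_nonpos_iff i hi) hRn hSR
    (fun i hi => by rw [hs₁.arr a_S rfl]; exact h.S_eq i hi)) ?_
  rintro s₂ hs₂ ⟨hra₂, hrb₂, hS₂, hleft₂⟩
  rw [hs₁.arr a_ra rfl] at hra₂
  rw [hs₁.arr a_rb rfl] at hrb₂
  have hn₂ : s₂.var v_n = n := (hs₂.var _ rfl).trans ((hs₁.var _ rfl).trans h.n_eq)
  have hb : 0 < b := by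
    rcases hcand.2.2.2.2 with ⟨-, rfl, -⟩ | ⟨hab, -⟩ <;> omega
  refine Reach.out rfl (by decide) ?_
  refine ⟨1, 1, a, b, R \ S, R \ S, ⟨?_, ?_, ?_, ?_, ?_, ?_, ?_, ?_, ?_, ?_⟩, ?_⟩
  · simpa [resetShare, Program.out] using hn₂
  · simp [resetShare, Program.out, Expr.eval]
  · simp [resetShare, Program.out, Expr.eval]
  · simpa [resetShare, Program.out, Expr.eval] using hn₂
  · simpa [resetShare, Program.out, Expr.eval] using hn₂
  · simpa [resetShare, Program.out] using hleft₂
  · simpa only [resetShare, Program.out, State.arr_setVar, hs₂.arr a_like rfl,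
      hs₁.arr a_like rfl] using h.like_eq
  · simpa only [resetShare, Program.out, State.arr_setVar] using hS₂
  · simp only [resetShare, Program.out, State.arr_setVar, hs₂.arr a_pa rfl, hs₂.arr a_pb rfl,
      hs₂.arr a_W rfl]
    refine h.outcome.serve hcand hm hc hra₂ hrb₂ (fun j hj => ?_) (fun j hj => ?_) hW₁
      (fun i => ?_) fun i j => Iff.rfl
    · rw [hpa₁ j hj]
    · rw [hpb₁ j hj]
    · rw [mem_sdiff, h.outcome.mem_remaining]
      constructor
      · rintro ⟨⟨hi, h0⟩, hiS⟩
        exact ⟨hi, by rw [hrb₂ i hi, if_neg hiS]; exact h0⟩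
      · rintro ⟨hi, h0⟩
        rw [hrb₂ i hi] at h0
        split at h0
        · omega
        · exact ⟨⟨hi, h0⟩, ‹_›⟩
  · intro hne'
    exact ⟨Subset.rfl, hne', one_pos, hn0, Or.inl ⟨rfl, rfl, rfl⟩⟩
  · have h1 := fractionsBelow_le n 1 1
    have h2 : (R \ S).card < R.card := card_lt_card (sdiff_ssubset hSR hcand.2.1)
    have h3 := Nat.mul_le_mul_right ((n + 1) ^ 2 + 1) (Nat.succ_le_of_lt h2)
    simp only [mainMeasure, resetShare, Program.out, Expr.eval, State.var_setVar]
    norm_num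
    rw [hleft₂, h.left_eq, Int.toNat_natCast, Int.toNat_natCast]
    rw [Nat.succ_mul] at h3
    omega

theorem mainStep_spec (h : Invariant n D a b la lb R S s)
    (hpos : 0 < (Expr.var v_left).eval s) :
    Reach mainStep s (mainStepBound n) fun s' =>
      (∃ a' b' la' lb' R' S', Invariant n D a' b' la' lb' R' S' s') ∧
        mainMeasure n s' < mainMeasure n s := by
  have hne : R.Nonempty := by
    simp only [Expr.eval, h.left_eq] at hpos
    exact card_pos.1 (by exact_mod_cast hpos)
  have hcand := h.candidate hne
  have hbn : b ≤ n := hcand.2.2.2.1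
  have han : a ≤ n := by
    rcases hcand.2.2.2.2 with ⟨rfl, rfl, -⟩ | ⟨hab, -⟩ <;> omega
  refine Reach.mono (Reach.seq (auction_spec h.n_eq h.a_eq h.b_eq h.na_eq h.nb_eq h.decides
    h.rb_nonpos_iff han hbn) (N₂ := ((n * n * (n * n * 5 + 8) + 3) + ((n * (n * n * 7 + 13) + 4) +
    ((n * (n * 7 + 9) + 4) + 4))) + ((n * n * 9 + 2) + ((n * 10 + 2) + 4)) + 1) ?_)
    (by unfold mainStepBound; omega) fun _ _ h => h
  rintro s₁ hs₁ ⟨hm, hcase⟩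
  have hpb₁ : s₁.arr a_pb = s.arr a_pb := hs₁.arr _ rfl
  have h₁ : Invariant n D a b la lb R S s₁ := by
    refine ⟨(hs₁.var _ rfl).trans h.n_eq, (hs₁.var _ rfl).trans h.a_eq,
      (hs₁.var _ rfl).trans h.b_eq, (hs₁.var _ rfl).trans h.na_eq, (hs₁.var _ rfl).trans h.nb_eq,
      (hs₁.var _ rfl).trans h.left_eq, ?_, ?_, ?_, ?_⟩
    · rw [hs₁.arr a_like rfl]
      exact h.like_eq
    · rw [hs₁.arr a_S rfl]
      exact h.S_eq
    · rw [hs₁.arr a_ra rfl, hs₁.arr a_rb rfl, hs₁.arr a_pa rfl, hs₁.arr a_pb rfl,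
        hs₁.arr a_W rfl]
      exact h.outcome
    · rw [hs₁.arr a_pb rfl]
      exact h.candidate
  have hμ : mainMeasure n s₁ = mainMeasure n s := by
    unfold mainMeasure
    rw [hs₁.var v_left rfl, hs₁.var v_a rfl, hs₁.var v_b rfl]
  rw [← hpb₁] at hm hcase
  rw [← hμ]
  refine Reach.ite (fun hviol => ?_) fun hviol => ?_
  · rcases hcase with hbl | ⟨h0, -⟩
    · refine Reach.mono (h₁.search_spec hne hm hbl) (by omega) ?_
      rintro s' - ⟨a', b', S', h', hlt⟩
      exact ⟨⟨a', b', la, lb, R, S', h'⟩, hlt⟩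
    · simp [Expr.eval, h0] at hviol
  · rcases hcase with hbl | ⟨-, hc⟩
    · simp [Expr.eval, hbl.1] at hviol
    · refine Reach.mono (h₁.serve_spec hne hm hc) (by omega) ?_
      rintro s' - ⟨a', b', la', lb', R', S', h', hlt⟩
      exact ⟨⟨a', b', la', lb', R', S', h'⟩, hlt⟩

end Invariant

end Main

end RAM

namespace RAM

/-! ### Correctness of the programs -/

section Correct

open Finset

/-- The fraction at `(i, j)` is maximal in its row. Fractions are compared by cross-multiplication,
the denominators of the input being positive. -/
def MaximalInRow (n : ℕ) (s : State) (i j : ℕ) : Prop :=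
  ∀ l < n, s.arr a_num ((i : ℤ) * n + l) * s.arr a_den ((i : ℤ) * n + j) ≤
    s.arr a_num ((i : ℤ) * n + j) * s.arr a_den ((i : ℤ) * n + l)

open scoped Classical in
theorem findLikes_spec {n : ℕ} {s : State} (hn : s.var v_n = n) :
    Reach findLikes s (n * (n * (n * 5 + 5) + 4) + 2) fun s' =>
      ∀ i : ℕ, i < n → ∀ j : ℕ, j < n →
        s'.arr a_like ((i : ℤ) * n + j) = if MaximalInRow n s i j then 1 else 0 := by
  refine Reach.imp (Reach.for_ n _ (fun m s' => ∀ i : ℕ, i < m → ∀ j : ℕ, j < n →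
      s'.arr a_like ((i : ℤ) * n + j) = if MaximalInRow n s i j then 1 else 0)
    (by decide) rfl rfl hn (fun _ _ _ h => h) (by simp) ?_) fun _ _ h => h
  intro i hi s₁ hs₁ hv₁ ih₁
  refine Reach.imp (Reach.for_ n (n * 5 + 3) (fun m s' => ∀ i' : ℕ, i' < i + 1 → ∀ j : ℕ, j < n →
      (i' < i ∨ j < m) →
      s'.arr a_like ((i' : ℤ) * n + j) = if MaximalInRow n s i' j then 1 else 0)
    (by decide) rfl rfl ((hs₁.var _ rfl).trans hn) (fun _ _ _ h => h) ?_ ?_) ?_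
  · intro i' _ j hj h
    exact ih₁ i' (by omega) j hj
  · intro j hj s₂ hs₂ hv₂ ih₂
    have hi₂ : s₂.var v_i = i := (hs₂.var _ rfl).trans hv₁
    have hn₂ : s₂.var v_n = n := (hs₂.var _ rfl).trans ((hs₁.var _ rfl).trans hn)
    have hnum₂ : s₂.arr a_num = s.arr a_num := (hs₂.arr _ rfl).trans (hs₁.arr _ rfl)
    have hden₂ : s₂.arr a_den = s.arr a_den := (hs₂.arr _ rfl).trans (hs₁.arr _ rfl)
    refine Reach.mono (Reach.seq (N₁ := 1) (N₂ := n * 5 + 2)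
      (P := fun s' => s'.arr a_like = Function.update (s₂.arr a_like) ((i : ℤ) * n + j) 1)
      (Reach.out rfl le_rfl ?_) fun s₃ hs₃ h₃ => Reach.for_ n 3 (fun m s' =>
        s'.arr a_like = Function.update (s₂.arr a_like) ((i : ℤ) * n + j)
          (if ∀ l < m, s.arr a_num ((i : ℤ) * n + l) * s.arr a_den ((i : ℤ) * n + j) ≤
            s.arr a_num ((i : ℤ) * n + j) * s.arr a_den ((i : ℤ) * n + l) then 1 else 0))
        (by decide) rfl rfl ((hs₃.var _ rfl).trans hn₂) (fun _ _ _ h => h) ?_ ?_) (by omega) ?_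
    · simp [Program.out, Expr.eval, entry, hi₂, hv₂, hn₂]
    · simpa using h₃
    · intro l hl s₄ hs₄ hv₄ ih₄
      have hi₄ : s₄.var v_i = i := (hs₄.var _ rfl).trans ((hs₃.var _ rfl).trans hi₂)
      have hj₄ : s₄.var v_j = j := (hs₄.var _ rfl).trans ((hs₃.var _ rfl).trans hv₂)
      have hn₄ : s₄.var v_n = n := (hs₄.var _ rfl).trans ((hs₃.var _ rfl).trans hn₂)
      have hnum₄ : s₄.arr a_num = s.arr a_num :=
        (hs₄.arr _ rfl).trans ((hs₃.arr _ rfl).trans hnum₂)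
      have hden₄ : s₄.arr a_den = s.arr a_den :=
        (hs₄.arr _ rfl).trans ((hs₃.arr _ rfl).trans hden₂)
      refine Reach.out rfl le_rfl ?_
      simp only [Nat.lt_succ_iff_lt_or_eq, or_imp, forall_and, forall_eq]
      rw [Program.out]
      split
      · rename_i hpos
        simp only [Expr.eval, entry, hi₄, hj₄, hn₄, hv₄, hnum₄, hden₄, sub_pos] at hpos
        simp only [Program.out, Expr.eval, entry, hi₄, hj₄, hn₄, State.arr_setArr, if_true, ih₄,
          Function.update_idem]
        rw [if_neg fun h => absurd h.2 (not_le.2 hpos)]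
      · rename_i hpos
        simp only [Expr.eval, entry, hi₄, hj₄, hn₄, hv₄, hnum₄, hden₄, sub_pos, not_lt] at hpos
        simp only [Program.out, ih₄, hpos, and_true]
    · intro s₄ _ h₄ i' hi' j' hj' hlt
      rw [h₄, Function.update_apply]
      simp only [entry_inj hj' hj]
      split
      · rename_i h
        rw [h.1, h.2]
        unfold MaximalInRow
        congr
      · exact ih₂ i' hi' j' hj' (by omega)
  · intro s₂ _ h i' hi' j hj
    exact h i' hi' j hj (Or.inr hj)

theorem start_spec {n : ℕ} {D : ℕ → ℕ → Prop} {s : State} (hn : s.var v_n = n)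
    (hlike : ∀ i : ℕ, i < n → ∀ j : ℕ, j < n →
      s.arr a_like ((i : ℤ) * n + j) = open scoped Classical in if D i j then 1 else 0)
    (hD : ∀ i < n, ∃ j < n, D i j) (hra : s.arr a_ra = fun _ => 0) (hrb : s.arr a_rb = fun _ => 0)
    (hpa : s.arr a_pa = fun _ => 0) (hpb : s.arr a_pb = fun _ => 0) (hW : s.arr a_W = fun _ => 0) :
    Reach start s (n * 3 + 7) (Invariant n D 1 1 1 (n + 1) (range n) (range n)) := by
  refine Reach.mono (Reach.seq (N₁ := 1) (P := fun s' => s' = s.setVar v_left n)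
    (N₂ := n * 3 + 6) (Reach.assign (by simp [Expr.eval, hn])) ?_) (by omega) fun _ _ h => h
  rintro _ - rfl
  refine Reach.seq (N₂ := 4) (Reach.for_ n 1 (fun m s' =>
    ∀ i : ℕ, i < m → s'.arr a_S i = 1) (by decide) rfl rfl (by simpa using hn)
    (fun _ _ _ h => h) (by simp) ?_) ?_
  · intro m _ s' _ hv ih
    refine Reach.out rfl le_rfl fun i hi => ?_
    rcases eq_or_ne i m with rfl | hne
    · simp [Program.out, Expr.eval, hv]
    · simpa [Program.out, Expr.eval, hv, Function.update_apply, hne] using ih i (by omega)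
  · intro s₁ hs₁ hS₁
    have hn₁ : s₁.var v_n = n := (hs₁.var _ rfl).trans (by simpa using hn)
    have harr : ∀ k, (forLoop v_i v_n (.store a_S (.var v_i) (.const 1))).writesArr k = false →
      s₁.arr k = s.arr k := fun k hk => hs₁.arr k hk
    refine Reach.out rfl le_rfl ⟨?_, ?_, ?_, ?_, ?_, ?_, ?_, ?_, ?_, ?_⟩
    · simpa [resetShare, Program.out] using hn₁
    · simp [resetShare, Program.out, Expr.eval]
    · simp [resetShare, Program.out, Expr.eval]
    · simpa [resetShare, Program.out, Expr.eval] using hn₁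
    · simpa [resetShare, Program.out, Expr.eval] using hn₁
    · simp [resetShare, Program.out, hs₁.var v_left rfl]
    · simpa only [resetShare, Program.out, State.arr_setVar, harr a_like rfl] using hlike
    · intro i hi
      simp [resetShare, Program.out, hS₁ i hi, hi]
    · simp only [resetShare, Program.out, State.arr_setVar, harr a_ra rfl, harr a_rb rfl,
        harr a_pa rfl, harr a_pb rfl, harr a_W rfl, hra, hrb, hpa, hpb, hW]
      simpa using PartialOutcome.initial hD
    · intro hne
      obtain ⟨i, hi⟩ := hne
      exact ⟨Subset.rfl, ⟨i, hi⟩, one_pos, (Nat.zero_le i).trans_lt (mem_range.1 hi),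
        Or.inl ⟨rfl, rfl, rfl⟩⟩

/-- A bound for the number of steps of `decompose`. -/
def decomposeBound {K : Type*} [CommSemiring K] (n : K) : K :=
  (n * (n * (n * 5 + 5) + 4) + 2) + ((n * 3 + 7) +
    ((n * ((n + 1) ^ 2 + 1) + (n + 1) ^ 2) * (mainStepBound n + 1) + 1))

theorem decompose_spec {n : ℕ} {s : State} (hn : s.var v_n = n)
    (hD : ∀ i < n, ∃ j < n, MaximalInRow n s i j) (hs : ∀ k, 2 ≤ k → s.arr k = fun _ => 0) :
    Reach decompose s (decomposeBound n) fun s' =>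
      ∃ a b la lb S, Invariant n (MaximalInRow n s) a b la lb ∅ S s' := by
  refine Reach.seq (findLikes_spec hn) fun s₁ hs₁ hlike => ?_
  have hz : ∀ k, 2 ≤ k → findLikes.writesArr k = false → s₁.arr k = fun _ => 0 :=
    fun k hk hw => (hs₁.arr k hw).trans (hs k hk)
  refine Reach.seq (start_spec ((hs₁.var _ rfl).trans hn) hlike hD (hz _ (by decide) rfl)
    (hz _ (by decide) rfl) (hz _ (by decide) rfl) (hz _ (by decide) rfl) (hz _ (by decide) rfl))
    fun s₂ _ hI => ?_
  have hμ : mainMeasure n s₂ ≤ n * ((n + 1) ^ 2 + 1) + (n + 1) ^ 2 := by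
    unfold mainMeasure
    rw [hI.left_eq, Int.toNat_natCast, card_range]
    have := fractionsBelow_le n (s₂.var v_a) (s₂.var v_b)
    omega
  refine Reach.mono (Reach.while_ (fun s' => ∃ a b la lb R S,
    Invariant n (MaximalInRow n s) a b la lb R S s') (mainMeasure n) (mainStepBound n) ?_
    ⟨_, _, _, _, _, _, hI⟩) (by push_cast; gcongr) ?_
  · rintro s' - ⟨a, b, la, lb, R, S, h⟩ hpos
    exact h.mainStep_spec hpos
  · rintro s' - ⟨⟨a, b, la, lb, R, S, h⟩, hle⟩
    have hR : R = ∅ := by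
      simp only [Expr.eval, h.left_eq] at hle
      exact card_eq_zero.1 (by omega)
    exact ⟨a, b, la, lb, S, hR ▸ h⟩

/-- The final outcome is stored, together with the number of unsold items and the allocation. -/
structure Allocated (n : ℕ) (D : ℕ → ℕ → Prop) (s : State) : Prop where
  n_eq : s.var v_n = n
  outcome : ∃ la lb, PartialOutcome n D (fun i => s.arr a_ra i) (fun i => s.arr a_rb i)
    (fun j => s.arr a_pa j) (fun j => s.arr a_pb j) (fun i j => s.arr a_W ((i : ℤ) * n + j)) ∅
    (fun i j => D i j ∧ s.arr a_pb j = 0) la lb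
  free_eq : s.var v_free = ((range n).filter fun j : ℕ => s.arr a_pb j = 0).card
  alloc_num : ∀ i : ℕ, i < n → ∀ j : ℕ, j < n → s.arr 2 ((i : ℤ) * n + j) =
    if s.arr a_pb j = 0 then s.arr a_rb i - s.arr a_ra i else s.arr a_W ((i : ℤ) * n + j)
  alloc_den : ∀ i : ℕ, i < n → ∀ j : ℕ, j < n → s.arr 3 ((i : ℤ) * n + j) =
    if s.arr a_pb j = 0 then s.arr a_rb i * s.var v_free else s.arr a_rb i

theorem countFree_spec {n : ℕ} {s : State} (hn : s.var v_n = n)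
    (hpb : ∀ j : ℕ, j < n → 0 ≤ s.arr a_pb j) :
    Reach countFree s (n * 5 + 3) fun s' =>
      s'.var v_free = ((range n).filter fun j : ℕ => s.arr a_pb j = 0).card := by
  refine Reach.mono (Reach.seq (N₁ := 1) (P := fun s' => s' = s.setVar v_free 0)
    (N₂ := n * 5 + 2) (Reach.assign rfl) ?_) (by omega) fun _ _ h => h
  rintro _ - rfl
  refine Reach.imp (Reach.for_ n 3 (fun m s' => s'.arr a_pb = s.arr a_pb ∧
    s'.var v_free = ((range m).filter fun j : ℕ => s.arr a_pb j = 0).card)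
    (by decide) rfl rfl (by simpa using hn) (fun _ _ _ h => by simpa using h) (by simp) ?_)
    fun _ _ h => h.2
  rintro m hm s' - hv ⟨harr, ih⟩
  refine Reach.out rfl le_rfl ?_
  have := hpb m hm
  rw [range_add_one, filter_insert, Program.out]
  split
  · rename_i hpos
    simp only [Expr.eval, hv, harr] at hpos
    rw [if_neg (by omega)]
    exact ⟨harr, ih⟩
  · rename_i hpos
    simp only [Expr.eval, hv, harr] at hpos
    rw [if_pos (by omega), card_insert_of_notMem (by simp)]
    exact ⟨harr, by simp [Program.out, Expr.eval, ih]⟩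

theorem writeAllocation_spec {n : ℕ} {s : State} (hn : s.var v_n = n)
    (hpb : ∀ j : ℕ, j < n → 0 ≤ s.arr a_pb j) :
    Reach writeAllocation s (n * (n * 7 + 4) + 2) fun s' =>
      ∀ i : ℕ, i < n → ∀ j : ℕ, j < n → s'.arr 2 ((i : ℤ) * n + j) =
        (if s.arr a_pb j = 0 then s.arr a_rb i - s.arr a_ra i else s.arr a_W ((i : ℤ) * n + j)) ∧
        s'.arr 3 ((i : ℤ) * n + j) =
          if s.arr a_pb j = 0 then s.arr a_rb i * s.var v_free else s.arr a_rb i := by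
  refine Reach.imp (Reach.for_ n _ (fun m s' => ∀ i : ℕ, i < m → ∀ j : ℕ, j < n →
      s'.arr 2 ((i : ℤ) * n + j) =
        (if s.arr a_pb j = 0 then s.arr a_rb i - s.arr a_ra i else s.arr a_W ((i : ℤ) * n + j)) ∧
        s'.arr 3 ((i : ℤ) * n + j) =
          if s.arr a_pb j = 0 then s.arr a_rb i * s.var v_free else s.arr a_rb i)
    (by decide) rfl rfl hn (fun _ _ _ h => h) (by simp) ?_) fun _ _ h => h
  intro i hi s₁ hs₁ hv₁ ih₁
  refine Reach.imp (Reach.for_ n 5 (fun m s' => ∀ i' : ℕ, i' < i + 1 → ∀ j : ℕ, j < n →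
      (i' < i ∨ j < m) → s'.arr 2 ((i' : ℤ) * n + j) =
        (if s.arr a_pb j = 0 then s.arr a_rb i' - s.arr a_ra i'
          else s.arr a_W ((i' : ℤ) * n + j)) ∧
        s'.arr 3 ((i' : ℤ) * n + j) =
          if s.arr a_pb j = 0 then s.arr a_rb i' * s.var v_free else s.arr a_rb i')
    (by decide) rfl rfl ((hs₁.var _ rfl).trans hn) (fun _ _ _ h => h) ?_ ?_) ?_
  · intro i' _ j hj h
    exact ih₁ i' (by omega) j hj
  · intro j hj s₂ hs₂ hv₂ ih₂
    have hi₂ : s₂.var v_i = i := (hs₂.var _ rfl).trans hv₁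
    have hn₂ : s₂.var v_n = n := (hs₂.var _ rfl).trans ((hs₁.var _ rfl).trans hn)
    have hf₂ : s₂.var v_free = s.var v_free := (hs₂.var _ rfl).trans (hs₁.var _ rfl)
    have hra₂ : s₂.arr a_ra = s.arr a_ra := (hs₂.arr _ rfl).trans (hs₁.arr _ rfl)
    have hrb₂ : s₂.arr a_rb = s.arr a_rb := (hs₂.arr _ rfl).trans (hs₁.arr _ rfl)
    have hpb₂ : s₂.arr a_pb = s.arr a_pb := (hs₂.arr _ rfl).trans (hs₁.arr _ rfl)
    have hW₂ : s₂.arr a_W = s.arr a_W := (hs₂.arr _ rfl).trans (hs₁.arr _ rfl)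
    refine Reach.out rfl le_rfl ?_
    intro i' hi' j' hj' hlt
    have h0 := hpb j hj
    rw [Program.out]
    simp only [Expr.eval, hv₂, hpb₂]
    split <;> rename_i hpos <;>
    · simp [Program.out, Expr.eval, entry, hi₂, hv₂, hn₂, hf₂, hra₂, hrb₂, hW₂,
        Function.update_apply, entry_inj hj' hj]
      split
      · rename_i h
        rw [h.1, h.2]
        have : s.arr a_pb j ≠ 0 ∨ s.arr a_pb j = 0 := by omega
        first
        | rw [if_neg (by omega), if_neg (by omega)]; simp
        | rw [if_pos (by omega), if_pos (by omega)]; simp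
      · exact ih₂ i' hi' j' hj' (by omega)
  · intro s₂ _ h i' hi' j hj
    exact h i' hi' j hj (Or.inr hj)

/-- A bound for the number of steps of `allocate`. -/
def allocateBound {K : Type*} [CommSemiring K] (n : K) : K :=
  decomposeBound n + ((n * 5 + 3) + (n * (n * 7 + 4) + 2))

theorem allocate_spec {n : ℕ} {s : State} (hn : s.var v_n = n)
    (hD : ∀ i < n, ∃ j < n, MaximalInRow n s i j) (hs : ∀ k, 2 ≤ k → s.arr k = fun _ => 0) :
    Reach allocate s (allocateBound n) (Allocated n (MaximalInRow n s)) := by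
  refine Reach.seq (decompose_spec hn hD hs) ?_
  rintro s₁ - ⟨a, b, la, lb, S, h⟩
  have hpb : ∀ j : ℕ, j < n → 0 ≤ s₁.arr a_pb j := by
    intro j hj
    by_contra hlt
    have := h.outcome.sold j hj (by omega)
    omega
  refine Reach.seq (countFree_spec h.n_eq hpb) fun s₂ hs₂ hfree => ?_
  have hn₂ : s₂.var v_n = n := (hs₂.var _ rfl).trans h.n_eq
  have hpb₂ : s₂.arr a_pb = s₁.arr a_pb := hs₂.arr _ rfl
  refine Reach.imp (writeAllocation_spec hn₂ (hpb₂ ▸ hpb)) fun s₃ hs₃ hx => ?_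
  refine ⟨(hs₃.var _ rfl).trans hn₂, ⟨la, lb, ?_⟩, ?_, fun i hi j hj => ?_, fun i hi j hj => ?_⟩
  · rw [hs₃.arr a_ra rfl, hs₃.arr a_rb rfl, hs₃.arr a_pa rfl, hs₃.arr a_pb rfl, hs₃.arr a_W rfl,
      hs₂.arr a_ra rfl, hs₂.arr a_rb rfl, hs₂.arr a_pa rfl, hs₂.arr a_pb rfl, hs₂.arr a_W rfl]
    exact h.outcome
  · rw [hs₃.var v_free rfl, hs₃.arr a_pb rfl, hpb₂]
    exact hfree
  · rw [hs₃.arr a_pb rfl, hs₃.arr a_rb rfl, hs₃.arr a_ra rfl, hs₃.arr a_W rfl]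
    exact (hx i hi j hj).1
  · rw [hs₃.arr a_pb rfl, hs₃.arr a_rb rfl, hs₃.var v_free rfl]
    exact (hx i hi j hj).2

theorem writePrices_spec {n : ℕ} {s : State} (hn : s.var v_n = n) :
    Reach writePrices s (n * 7 + 2) fun s' => ∀ j : ℕ, j < n →
      (s'.arr 4 j = if s.arr a_pa j < s.arr a_pb j then s.arr a_pb j else 0) ∧
      s'.arr 5 j = if s.arr a_pa j < s.arr a_pb j then s.arr a_pa j else 1 := by
  refine Reach.imp (Reach.for_ n 5 (fun m s' => ∀ j : ℕ, j < m →
      (s'.arr 4 j = if s.arr a_pa j < s.arr a_pb j then s.arr a_pb j else 0) ∧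
      s'.arr 5 j = if s.arr a_pa j < s.arr a_pb j then s.arr a_pa j else 1)
    (by decide) rfl rfl hn (fun _ _ _ h => h) (by simp) ?_) fun _ _ h => h
  intro m _ s' hs hv ih
  have hpa : s'.arr a_pa = s.arr a_pa := hs.arr _ rfl
  have hpb : s'.arr a_pb = s.arr a_pb := hs.arr _ rfl
  refine Reach.out rfl le_rfl fun j hj => ?_
  rw [Program.out]
  simp only [Expr.eval, hv, hpa, hpb, sub_pos]
  rcases eq_or_ne j m with rfl | hne
  · split <;> simp [Program.out, Expr.eval, hv, hpa, hpb]
  · split <;> simpa [Program.out, Expr.eval, hv, hpa, hpb, Function.update_apply, hne] using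
      ih j (by omega)

theorem writePayments_spec {n : ℕ} {s : State} (hn : s.var v_n = n) :
    Reach writePayments s (n * 7 + 2) fun s' => ∀ j : ℕ, j < n →
      (s'.arr 4 j = if s.arr a_pa j < s.arr a_pb j then (n + 1) * s.arr a_pa j - s.arr a_pb j
        else n + 1) ∧
      s'.arr 5 j = if s.arr a_pa j < s.arr a_pb j then n * s.arr a_pa j else n := by
  refine Reach.imp (Reach.for_ n 5 (fun m s' => ∀ j : ℕ, j < m →
      (s'.arr 4 j = if s.arr a_pa j < s.arr a_pb j then (n + 1) * s.arr a_pa j - s.arr a_pb j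
        else n + 1) ∧
      s'.arr 5 j = if s.arr a_pa j < s.arr a_pb j then n * s.arr a_pa j else n)
    (by decide) rfl rfl hn (fun _ _ _ h => h) (by simp) ?_) fun _ _ h => h
  intro m _ s' hs hv ih
  have hn' : s'.var v_n = n := (hs.var _ rfl).trans hn
  have hpa : s'.arr a_pa = s.arr a_pa := hs.arr _ rfl
  have hpb : s'.arr a_pb = s.arr a_pb := hs.arr _ rfl
  refine Reach.out rfl le_rfl fun j hj => ?_
  rw [Program.out]
  simp only [Expr.eval, hv, hpa, hpb, sub_pos]
  rcases eq_or_ne j m with rfl | hne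
  · split <;> simp [Program.out, Expr.eval, hv, hpa, hpb, hn']
  · split <;> simpa [Program.out, Expr.eval, hv, hpa, hpb, hn', Function.update_apply, hne] using
      ih j (by omega)

end Correct

end RAM

/-! ### The mechanism and its prices -/

namespace RAM

open Finset

theorem initialState_num {n : ℕ} (u : Profile n) (i j : Fin n) :
    (initialState u).arr a_num ((i : ℤ) * n + j) = (u i j).num := by
  simp only [initialState, if_true]
  rw [sum_eq_single i, sum_eq_single j]
  · simp
  · intro j' _ hne
    rw [if_neg]
    rw [entry_inj j.2 j'.2]
    exact fun h => hne (Fin.ext h.2.symm)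
  · simp
  · intro i' _ hne
    refine sum_eq_zero fun j' _ => ?_
    rw [if_neg]
    rw [entry_inj j.2 j'.2]
    exact fun h => hne (Fin.ext h.1.symm)
  · simp

theorem initialState_den {n : ℕ} (u : Profile n) (i j : Fin n) :
    (initialState u).arr a_den ((i : ℤ) * n + j) = (u i j).den := by
  simp only [initialState, one_ne_zero, if_true, if_false]
  rw [sum_eq_single i, sum_eq_single j]
  · simp
  · intro j' _ hne
    rw [if_neg]
    rw [entry_inj j.2 j'.2]
    exact fun h => hne (Fin.ext h.2.symm)
  · simp
  · intro i' _ hne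
    refine sum_eq_zero fun j' _ => ?_
    rw [if_neg]
    rw [entry_inj j.2 j'.2]
    exact fun h => hne (Fin.ext h.1.symm)
  · simp

theorem maximalInRow_iff {n : ℕ} (u : Profile n) (i j : Fin n) :
    MaximalInRow n (initialState u) i j ↔ Likes (fun i j => (u i j : ℝ)) i j := by
  have key : ∀ l : Fin n, (initialState u).arr a_num ((i : ℤ) * n + l) *
      (initialState u).arr a_den ((i : ℤ) * n + j) ≤ (initialState u).arr a_num ((i : ℤ) * n + j) *
      (initialState u).arr a_den ((i : ℤ) * n + l) ↔ (u i l : ℝ) ≤ u i j := fun l => by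
    rw [initialState_num, initialState_num, initialState_den, initialState_den, Rat.cast_le,
      Rat.le_iff]
  exact ⟨fun h l => (key l).1 (h l l.2), fun h l hl => (key ⟨l, hl⟩).2 (h ⟨l, hl⟩)⟩

theorem exists_maximalInRow {n : ℕ} (u : Profile n) (i : ℕ) (hi : i < n) :
    ∃ j < n, MaximalInRow n (initialState u) i j := by
  have : Nonempty (Fin n) := ⟨⟨i, hi⟩⟩
  obtain ⟨j, hj⟩ := Finite.exists_max (u ⟨i, hi⟩)
  exact ⟨j, j.2, (maximalInRow_iff u ⟨i, hi⟩ j).2 fun l => Rat.cast_le.2 (hj l)⟩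

theorem exists_run_allocate {n : ℕ} (u : Profile n) :
    ∃ s : State, (∃ N ≤ allocateBound n, Run allocate (initialState u) s N) ∧
      Allocated n (MaximalInRow n (initialState u)) s := by
  obtain ⟨s, N, hN, hr, h⟩ := allocate_spec (s := initialState u) (n := n) (by simp [initialState])
    (exists_maximalInRow u) fun k hk => by
      funext m
      simp only [initialState]
      rw [if_neg (by omega), if_neg (by omega)]
  exact ⟨s, ⟨N, by simpa using hN, hr⟩, h⟩

/-- The memory after `allocate` has run on the profile `u`. -/
noncomputable def finalState {n : ℕ} (u : Profile n) : State := (exists_run_allocate u).choose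

theorem run_allocate {n : ℕ} (u : Profile n) :
    ∃ N ≤ allocateBound n, Run allocate (initialState u) (finalState u) N :=
  (exists_run_allocate u).choose_spec.1

theorem allocated {n : ℕ} (u : Profile n) :
    Allocated n (MaximalInRow n (initialState u)) (finalState u) :=
  (exists_run_allocate u).choose_spec.2

/-- The egalitarian mechanism. -/
noncomputable def egalitarianMechanism : Mechanism := fun n u i j =>
  ((finalState u).arr 2 ((i : ℤ) * n + j) : ℚ) / ((finalState u).arr 3 ((i : ℤ) * n + j) : ℚ)

/-- An item that is sold in fractions of size `a / b < 1` has the price `b / a`; the others are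
free. -/
noncomputable def egalitarianPrice : PricingRule := fun _ u j =>
  if (finalState u).arr a_pa j < (finalState u).arr a_pb j then
    ((finalState u).arr a_pb j : ℚ) / ((finalState u).arr a_pa j : ℚ) else 0

/-- As the prices are at most `n`, they are turned into payments by the affine map
`p ↦ (n + 1 - p) / n`, which maps the budget `1` to the earning `1`. -/
noncomputable def egalitarianPayment : PricingRule := fun n u j =>
  (n + 1 - egalitarianPrice n u j) / n

theorem isEgalitarian_egalitarianMechanism {n : ℕ} (u : Profile n) :
    IsEgalitarian (Likes fun i j => (u i j : ℝ)) (fun i j => (egalitarianMechanism n u i j : ℝ))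
      (fun j => (egalitarianPrice n u j : ℝ))
      fun i => ((finalState u).arr a_ra i : ℝ) / (finalState u).arr a_rb i := by
  obtain ⟨la, lb, h⟩ := (allocated u).outcome
  have hD : (fun i j : Fin n => MaximalInRow n (initialState u) i j) =
      Likes fun i j => (u i j : ℝ) := by
    funext i j
    exact propext (maximalInRow_iff u i j)
  rw [← hD]
  refine h.isEgalitarian rfl (fun i j => ?_) fun j => ?_
  · rw [egalitarianMechanism, (allocated u).alloc_num i i.2 j j.2,
      (allocated u).alloc_den i i.2 j j.2, (allocated u).free_eq]
    split <;> push_cast <;> rfl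
  · rw [egalitarianPrice]
    split <;> push_cast <;> rfl

theorem egalitarianPrice_le {n : ℕ} (u : Profile n) (j : Fin n) :
    (egalitarianPrice n u j : ℝ) ≤ n := by
  obtain ⟨la, lb, h⟩ := (allocated u).outcome
  refine h.price_le (p := fun j => (egalitarianPrice n u j : ℝ)) (fun j => ?_) j
  simp only [egalitarianPrice]
  split <;> push_cast <;> rfl

theorem finalState_alloc_den_ne_zero {n : ℕ} (u : Profile n) (i j : Fin n) :
    (finalState u).arr 3 ((i : ℤ) * n + j) ≠ 0 := by
  obtain ⟨la, lb, h⟩ := (allocated u).outcome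
  have hrb : (finalState u).arr a_rb i ≠ 0 := fun h0 =>
    absurd ((h.mem_remaining i).2 ⟨i.2, h0⟩) (notMem_empty _)
  rw [(allocated u).alloc_den i i.2 j j.2]
  split
  · rename_i h0
    refine mul_ne_zero hrb ?_
    rw [(allocated u).free_eq]
    exact_mod_cast (card_pos.2 ⟨(j : ℕ), by simp [h0]⟩).ne'
  · exact hrb

theorem finalState_price_ne_zero {n : ℕ} (u : Profile n) (j : Fin n)
    (hlt : (finalState u).arr a_pa j < (finalState u).arr a_pb j) :
    (finalState u).arr a_pa j ≠ 0 := by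
  obtain ⟨la, lb, h⟩ := (allocated u).outcome
  intro h0
  have := h.sold j j.2 (by omega)
  omega

/-- A program that runs `allocate` and then, in few steps, a program that leaves the allocation
alone and writes the prices, computes the egalitarian mechanism and the prices in polynomial
time. -/
theorem polyTimeComputable_of_write {c : Program} {p : PricingRule}
    (htame : (Program.seq allocate c).tame = true) (h₂ : c.writesArr 2 = false)
    (h₃ : c.writesArr 3 = false)
    (hc : ∀ (n : ℕ) (u : Profile n), Reach c (finalState u) (n * 7 + 2) fun s =>
      ∀ j : Fin n, s.arr 5 (j : ℤ) ≠ 0 ∧ p n u j = (s.arr 4 (j : ℤ) : ℚ) / (s.arr 5 (j : ℤ) : ℚ)) :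
    PolyTimeComputableOnBivalued egalitarianMechanism p := by
  obtain ⟨P, hP⟩ := exists_poly_cost _ htame (allocateBound Polynomial.X + (Polynomial.X * 7 + 2))
  refine ⟨.seq allocate c, P, fun n u _ => ?_⟩
  obtain ⟨N, hN, hr⟩ := run_allocate u
  obtain ⟨s, N', hN', hr', hs⟩ := hc n u
  obtain ⟨t, ht, htP⟩ := hP n u s (N + N') (by
    simp only [allocateBound, decomposeBound, mainStepBound, auctionBound, Polynomial.eval_add,
      Polynomial.eval_mul, Polynomial.eval_pow, Polynomial.eval_X, Polynomial.eval_one,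
      Polynomial.eval_ofNat]
    exact add_le_add hN hN') (.seq hr hr')
  refine ⟨s, t, ht, htP, fun i j => ?_, hs⟩
  rw [hr'.same.arr 2 h₂, hr'.same.arr 3 h₃]
  exact ⟨finalState_alloc_den_ne_zero u i j, rfl⟩

theorem polyTimeComputable_egalitarianPrice :
    PolyTimeComputableOnBivalued egalitarianMechanism egalitarianPrice := by
  refine polyTimeComputable_of_write tame_priceProgram rfl rfl fun n u =>
    Reach.imp (writePrices_spec (allocated u).n_eq) fun s _ hs j => ?_
  obtain ⟨h4, h5⟩ := hs j j.2
  rw [h4, h5, egalitarianPrice]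
  split
  · rename_i hlt
    exact ⟨finalState_price_ne_zero u j hlt, rfl⟩
  · simp

theorem polyTimeComputable_egalitarianPayment :
    PolyTimeComputableOnBivalued egalitarianMechanism egalitarianPayment := by
  refine polyTimeComputable_of_write tame_paymentProgram rfl rfl fun n u =>
    Reach.imp (writePayments_spec (allocated u).n_eq) fun s _ hs j => ?_
  obtain ⟨h4, h5⟩ := hs j j.2
  have hn : (n : ℤ) ≠ 0 := by
    have := j.2
    omega
  rw [h4, h5, egalitarianPayment, egalitarianPrice]
  split
  · rename_i hlt
    have h0 := finalState_price_ne_zero u j hlt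
    have h0' : ((finalState u).arr a_pa j : ℚ) ≠ 0 := by exact_mod_cast h0
    refine ⟨mul_ne_zero hn h0, ?_⟩
    push_cast
    field_simp
  · exact ⟨hn, by push_cast; simp⟩

theorem isDichotomous_of_bivalued {n : ℕ} {u : Profile n} (hu : Bivalued u) (i : Fin n) :
    IsDichotomous (fun i j => (u i j : ℝ)) i := by
  obtain ⟨a, b, h⟩ := hu
  refine isDichotomous_of_two_values (a := (a i : ℝ)) (b := (b i : ℝ)) fun j => ?_
  rcases h i j with h | h <;> simp [h]

theorem isStrategyproof_egalitarianMechanism : IsStrategyproofOnBivalued egalitarianMechanism := by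
  intro n u hu i v hv
  have h := (isEgalitarian_egalitarianMechanism u).dotProduct_le (isDichotomous_of_bivalued hu i)
    (isEgalitarian_egalitarianMechanism (Function.update u i v)) fun k hk => by
      funext j
      simp [hk]
  simp only [dotProduct] at h ⊢
  exact_mod_cast h

end RAM

theorem mainTheorem10 :
    ∃ (x : Mechanism) (p q : PricingRule),
      (∀ (n : ℕ) (u : Profile n), Bivalued u →
        IsHZEquilibrium (fun i j => (u i j : ℝ)) (fun i j => (x n u i j : ℝ))
          (fun j => (p n u j : ℝ))) ∧
      RAM.PolyTimeComputableOnBivalued x p ∧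
      (∀ (n : ℕ) (u : Profile n), Bivalued u →
        IsHZEarningsEquilibrium (fun i j => (u i j : ℝ)) (fun i j => (x n u i j : ℝ))
          (fun j => (q n u j : ℝ))) ∧
      RAM.PolyTimeComputableOnBivalued x q ∧
      IsStrategyproofOnBivalued x := by

  have hHZ : ∀ (n : ℕ) (u : Profile n), Bivalued u → IsHZEquilibrium (fun i j => (u i j : ℝ))
      (fun i j => (RAM.egalitarianMechanism n u i j : ℝ))
      (fun j => (RAM.egalitarianPrice n u j : ℝ)) := fun n u hu =>
    (RAM.isEgalitarian_egalitarianMechanism u).isHZEquilibrium (RAM.isDichotomous_of_bivalued hu)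
  refine ⟨RAM.egalitarianMechanism, RAM.egalitarianPrice, RAM.egalitarianPayment, hHZ,
    RAM.polyTimeComputable_egalitarianPrice, fun n u hu => ?_,
    RAM.polyTimeComputable_egalitarianPayment, RAM.isStrategyproof_egalitarianMechanism⟩
  rcases Nat.eq_zero_or_pos n with rfl | hn
  · exact ⟨(hHZ 0 u hu).matching, fun j => j.elim0, fun i => i.elim0, fun i => i.elim0⟩
  · refine (hHZ n u hu).isHZEarningsEquilibrium (c := n) (by exact_mod_cast hn)
      (RAM.egalitarianPrice_le u) fun j => ?_
    simp only [RAM.egalitarianPayment]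
    push_cast
    rfl
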